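/- Let $N$ be a complex manifold of dimension $n+1$ with a pseudo-Kähler metric $\tilde g$ of arbitrary signature (fundamental form $\Phi(X,Y)=\tilde g(X,JY)$, $d\Phi=0$) and a real, flat, torsionfree connection $\tilde\nabla$ on $TN$ with $\tilde\nabla\Phi=0$ and $d_{\tilde\nabla}J=0$ (a rigid special pseudo-Kähler manifold). Let $\mathbb{C}^\times$ act freely and holomorphically on $N$, with fundamental vector field $H(x)=\frac{d}{d\lambda}\big|_{\lambda=0}e^{\lambda}\cdot x$ of type $(1,0)$, such that $\tilde\nabla_YH=cY$ for all $Y\in T^{1,0}N$, with a real constant $c\neq0$, and $\tilde g(H,\bar H)\neq0$ everywhere. Let $M=N/\mathbb{C}^\times$ be a complex manifold of dimension $n$, with the quotient map $\pi:N\to M$ a surjective holomorphic submersion whose fibres are the orbits. Thus $M$ carries a projective special Kähler structure. Metrics and tensors are extended complex linearly, and $g_{i\bar\jmath}=g(\partial_i,\partial_{\bar\jmath})$. 1. The function $K=c^{-2}\tilde g(H,\bar H)$ is a smooth Kähler potential of $\tilde g$: $\tilde g_{\alpha\bar\beta}=\partial_\alpha\partial_{\bar\beta}K$ in all holomorphic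 coordinates of $N$. It is homogeneous: $K(e^\lambda\cdot x)=|e^{c\lambda}|^2K(x)$. 2. There is a unique pseudo-Kähler metric $g$ on $M$ with $g_{i\bar\jmath}=\partial_i\partial_{\bar\jmath}(\pm\log|K|)$, i.e. whose pullback to $N$ is $\pm\partial\bar\partial\log|K|$, where $\pm$ is the sign of $K$. 3. Let $\tilde\Xi(X,Y,Z)=2\Phi(\pi^{1,0}X,(\tilde\nabla_Y\pi^{1,0})Z)$ be the holomorphic cubic form of $N$, where $\pi^{1,0}=\frac12(1-iJ)$; in holomorphic coordinates $\tilde\Xi_{\alpha\beta\gamma}=-2i\,\tilde g_{\alpha\bar\delta}A^{\bar\delta}_{\beta\gamma}$ with $A$ the coefficients of $\tilde\nabla$. For $x\in N$ and $X,Y,Z\in T_{\pi(x)}M$ let $\Xi_x(X,Y,Z)=\tilde\Xi(\tilde X,\tilde Y,\tilde Z)$, where $\tilde X,\tilde Y,\tilde Z\in T_xN$ are the horizontal lifts for the connection form $\omega=\partial\log|K|$ (the Hermitian connection of the line bundle $L$). Then $\Xi$ is well defined, and it is a holomorphic section of $(L^*)^{\otimes2}\otimes\mathrm{Sym}^3T^*M$: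 each $\Xi_x$ is complex trilinear and symmetric, the components $\Xi_{ijk}$ in holomorphic coordinates of $M$ are holomorphic functions on $N$, and $\Xi_{ijk}(e^{\lambda}\cdot x)=(e^{c\lambda})^2\,\Xi_{ijk}(x)$. 4. The Riemann tensor $R(X,Y)Z=[D_X,D_Y]Z-D_{[X,Y]}Z$ of the Levi-Civita connection $D$ of $g$, with components $R(\partial_k,\partial_{\bar\ell})\partial_i=R^j{}_{ik\bar\ell}\,\partial_j$ in any holomorphic coordinates $z^i$ of $M$, satisfies at every point $\pi(x)$, $x\in N$, $$R^j{}_{ik\bar\ell}=\frac1{4K(x)^2}\,g^{j\bar\jmath'}g^{p'\bar p}\,\Xi_{p'ki}(x)\,\overline{\Xi_{pj'\ell}(x)}\;\pm\;\delta^j_i\,g_{k\bar\ell}\;\pm\;\delta^j_k\,g_{i\bar\ell},$$ where repeated indices $j',p',p$ are summed, $g^{j\bar\jmath'}g_{i\bar\jmath'}=\delta^j_i$, and both signs $\pm$ are the sign of $K(x)$. -/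

import Mathlib

open scoped Manifold ContDiff Topology

noncomputable section

/-! ## Complex manifolds and their real tangent spaces

A complex manifold of dimension `n` is a space charted on `Fin n → ℂ` with holomorphic transition
maps.  Its real tangent bundle is that of the underlying real manifold, modelled on `Fin n → ℂ`
regarded as a real vector space; vectors `u` of the real tangent space stand for the vectors
`π^{1,0} u = (u - i J u) / 2` of type (1,0) whenever complex components are taken. -/

/-- The coordinate space `ℂⁿ`. -/
abbrev Cn (n : ℕ) : Type := Fin n → ℂ

/-- A complex manifold is a real manifold. -/
instance realManifold {n : ℕ} {M : Type*} [TopologicalSpace M] [ChartedSpace (Cn n) M]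
    [h : IsManifold 𝓘(ℂ, Cn n) ω M] : IsManifold 𝓘(ℝ, Cn n) ω M := by
  refine isManifold_of_contDiffOn _ _ _ fun e e' he he' => ?_
  have h1 := contDiffGroupoid ω 𝓘(ℂ, Cn n) |>.compatible he he'
  have h2 := (contDiffGroupoid ω 𝓘(ℂ, Cn n)).mem_of_eqOnSource h1 (Setoid.refl _)
  rw [contDiffGroupoid, mem_groupoid_of_pregroupoid] at h2
  have h3 := h2.1
  simp only [contDiffPregroupoid] at h3 ⊢
  exact h3.restrict_scalars ℝ

/-- The real tangent space of a complex manifold. -/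
abbrev RTangent (n : ℕ) {M : Type*} [TopologicalSpace M] [ChartedSpace (Cn n) M] (x : M) : Type :=
  TangentSpace 𝓘(ℝ, Cn n) x

/-- The complex structure of `ℂⁿ` as a real linear map. -/
def multI (n : ℕ) : Cn n →L[ℝ] Cn n :=
  ((Complex.I : ℂ) • ContinuousLinearMap.id ℂ (Cn n)).restrictScalars ℝ

/-- The complex structure `J` on the real tangent spaces of a complex manifold. -/
def cplxJ (n : ℕ) {M : Type*} [TopologicalSpace M] [ChartedSpace (Cn n) M] (x : M) :
    RTangent n x →L[ℝ] RTangent n x :=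
  multI n

/-- The holomorphic charts of a complex manifold. -/
abbrev holoAtlas (n : ℕ) (M : Type*) [TopologicalSpace M] [ChartedSpace (Cn n) M] :
    Set (OpenPartialHomeomorph M (Cn n)) :=
  IsManifold.maximalAtlas 𝓘(ℂ, Cn n) ω M

/-! ## Complex-linear extension -/

/-- For a real linear `f`, the value of its complex-linear extension at the vector
`π^{1,0} u = (u - i J u) / 2`. -/
def extHol {V : Type*} (J : V → V) (f : V → ℂ) (u : V) : ℂ :=
  (f u - Complex.I * f (J u)) / 2

/-- For a real linear `f`, the value of its complex-linear extension at the vector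
`π^{0,1} u = (u + i J u) / 2`. -/
def extAnti {V : Type*} (J : V → V) (f : V → ℂ) (u : V) : ℂ :=
  (f u + Complex.I * f (J u)) / 2

/-- For a real bilinear `G`, the value `G (π^{1,0} u, π^{0,1} v)` of its complex-bilinear
extension. -/
def hermPart {V : Type*} (J : V → V) (G : V → V → ℝ) (u v : V) : ℂ :=
  extHol J (fun u' => extAnti J (fun v' => ((G u' v' : ℝ) : ℂ)) v) u

/-- The mixed second derivative `∑ u^a v̄^b ∂_a ∂_{b̄} φ` of a real function on `ℂⁿ`. -/
def ddbar {n : ℕ} (φ : Cn n → ℝ) (p u v : Cn n) : ℂ :=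
  hermPart (multI n) (fun u' v' => fderiv ℝ (fderiv ℝ φ) p u' v') u v

/-! ## Pseudo-Kähler metrics -/

section Metric

variable {n : ℕ} {M : Type*} [TopologicalSpace M] [ChartedSpace (Cn n) M]

/-- Fields of real bilinear forms on the tangent spaces. -/
abbrev BilinField (n : ℕ) (M : Type*) [TopologicalSpace M] [ChartedSpace (Cn n) M] : Type _ :=
  (x : M) → RTangent n x →L[ℝ] RTangent n x →L[ℝ] ℝ

/-- The expression of a field of bilinear forms in a chart `e` (its pullback under `e.symm`). -/
def inChart (B : BilinField n M) (e : OpenPartialHomeomorph M (Cn n)) (p : Cn n) :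
    Cn n →L[ℝ] Cn n →L[ℝ] ℝ :=
  let D : Cn n →L[ℝ] RTangent n (e.symm p) := mfderiv 𝓘(ℝ, Cn n) 𝓘(ℝ, Cn n) e.symm p
  (ContinuousLinearMap.precomp ℝ D).comp ((B (e.symm p)).comp D)

/-- The fundamental form `Φ(u, v) = g(u, J v)`. -/
def fundForm (g : BilinField n M) : BilinField n M :=
  fun x => (ContinuousLinearMap.precomp ℝ (cplxJ n x)).comp (g x)

/-- The differential of a real function, as a real linear form on the tangent space. -/
def rdiff (f : M → ℝ) (x : M) : RTangent n x →L[ℝ] ℝ := mfderiv 𝓘(ℝ, Cn n) 𝓘(ℝ, ℝ) f x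

/-- A pseudo-Kähler metric: a smooth symmetric nondegenerate `J`-invariant bilinear form, of any
signature, whose fundamental form is closed. -/
structure IsPseudoKahler (g : BilinField n M) : Prop where
  smooth : ∀ e ∈ holoAtlas n M, ContDiffOn ℝ ∞ (inChart g e) e.target
  symm : ∀ x u v, g x u v = g x v u
  nondegenerate : ∀ x u, (∀ v, g x u v = 0) → u = 0
  hermitian : ∀ x u v, g x (cplxJ n x u) (cplxJ n x v) = g x u v
  closed : ∀ e ∈ holoAtlas n M, ∀ p ∈ e.target, ∀ u v w,
    fderiv ℝ (inChart (fundForm g) e) p u v w + fderiv ℝ (inChart (fundForm g) e) p v w u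
      + fderiv ℝ (inChart (fundForm g) e) p w u v = 0

end Metric

/-! ## Levi-Civita connection and Riemann curvature in coordinates -/

section Curvature

variable {n : ℕ}

/-- The Levi-Civita connection of a pseudo-Riemannian metric `G` on an open set of `ℂⁿ = ℝ²ⁿ`:
`christoffel G p u v` is the vector `Γ(u, v)` with
`2 G(Γ(u, v), w) = ∂_u G(v, w) + ∂_v G(u, w) - ∂_w G(u, v)`, so that `D_u V = ∂_u V + Γ(u, V)`. -/
def christoffel (G : Cn n → Cn n →L[ℝ] Cn n →L[ℝ] ℝ) (p u v : Cn n) : Cn n :=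
  (G p).inverse ((1 / 2 : ℝ) •
    (fderiv ℝ G p u v + fderiv ℝ G p v u - ((fderiv ℝ G p).flip u).flip v))

/-- The Riemann tensor `R(u, v) w = [D_u, D_v] w` for constant vector fields `u`, `v`, `w`. -/
def riemann (G : Cn n → Cn n →L[ℝ] Cn n →L[ℝ] ℝ) (p u v w : Cn n) : Cn n :=
  fderiv ℝ (fun q => christoffel G q v w) p u - fderiv ℝ (fun q => christoffel G q u w) p v
    + christoffel G p u (christoffel G p v w) - christoffel G p v (christoffel G p u w)

/-- The coordinate vector `e_i` of `ℂⁿ`; `π^{1,0} e_i = ∂ / ∂ z^i`. -/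
abbrev coordVec (i : Fin n) : Cn n := Pi.single i 1

/-- The component `R^j_{i k l̄} = dz^j (R(∂_k, ∂_{l̄}) ∂_i)` of the Riemann tensor, extended complex
linearly. -/
def riemannComp (G : Cn n → Cn n →L[ℝ] Cn n →L[ℝ] ℝ) (p : Cn n) (j i k l : Fin n) : ℂ :=
  extHol (multI n) (fun u => extAnti (multI n) (fun v => extHol (multI n)
    (fun w => riemann G p u v w j) (coordVec i)) (coordVec l)) (coordVec k)

/-- The components `g_{i j̄} = G(∂_i, ∂_{j̄})`. -/
def metricComp (G : Cn n → Cn n →L[ℝ] Cn n →L[ℝ] ℝ) (p : Cn n) : Matrix (Fin n) (Fin n) ℂ :=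
  Matrix.of fun i j => hermPart (multI n) (fun u v => G p u v) (coordVec i) (coordVec j)

/-- The inverse metric `g^{i j̄}`, normalised by `∑_j g^{i j̄} g_{k j̄} = δ^i_k`. -/
def invMetricComp (G : Cn n → Cn n →L[ℝ] Cn n →L[ℝ] ℝ) (p : Cn n) (i j : Fin n) : ℂ :=
  (metricComp G p)⁻¹ j i

end Curvature

/-! ## Rigid special pseudo-Kähler structures -/

section Rigid

variable {n : ℕ} {M : Type*} [TopologicalSpace M] [ChartedSpace (Cn n) M]

/-- (Real) vector fields on a complex manifold. -/
abbrev VField (n : ℕ) (M : Type*) [TopologicalSpace M] [ChartedSpace (Cn n) M] : Type _ :=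
  (x : M) → RTangent n x

variable [IsManifold 𝓘(ℂ, Cn n) ω M]

/-- The vector field `X` is smooth in a neighbourhood of `x`. -/
def SmoothNear (X : VField n M) (x : M) : Prop :=
  ∀ᶠ y in 𝓝 x, ContMDiffAt 𝓘(ℝ, Cn n) 𝓘(ℝ, Cn n).tangent ∞
    (fun z => (⟨z, X z⟩ : TangentBundle 𝓘(ℝ, Cn n) M)) y

/-- The vector field `J X`. -/
def applyJ (X : VField n M) : VField n M := fun x => cplxJ n x (X x)

/-- Connections on the real tangent bundle.  Here `∇ Y x u` is the covariant derivative `∇_u Y`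
at `x`. -/
abbrev AffineConn (n : ℕ) (M : Type*) [TopologicalSpace M] [ChartedSpace (Cn n) M]
    [IsManifold 𝓘(ℂ, Cn n) ω M] : Type _ :=
  CovariantDerivative 𝓘(ℝ, Cn n) (Cn n) (fun x : M => TangentSpace 𝓘(ℝ, Cn n) x)

/-- A special Kähler structure on a (pseudo-)Kähler manifold: a real, flat, torsionfree, symplectic
connection `∇` with `d_∇ J = 0`. -/
structure IsSpecialConnection (g : BilinField n M) (nab : AffineConn n M) : Prop where
  smooth : ∀ U : Set M, IsOpen U → ContMDiffCovariantDerivativeOn (Cn n) ∞ nab U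
  flat : ∀ (x : M) (X Y Z : VField n M), SmoothNear X x → SmoothNear Y x → SmoothNear Z x →
    nab (fun y => nab Z y (Y y)) x (X x) - nab (fun y => nab Z y (X y)) x (Y x)
      - nab Z x (VectorField.mlieBracket 𝓘(ℝ, Cn n) X Y x) = 0
  torsionfree : nab.torsion = 0
  symplectic : ∀ (x : M) (u : RTangent n x) (Y Z : VField n M), SmoothNear Y x → SmoothNear Z x →
    rdiff (fun y => fundForm g y (Y y) (Z y)) x u
      = fundForm g x (nab Y x u) (Z x) + fundForm g x (Y x) (nab Z x u)
  dJ_eq_zero : ∀ (x : M) (X Y : VField n M), SmoothNear X x → SmoothNear Y x →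
    nab (applyJ Y) x (X x) - nab (applyJ X) x (Y x)
      - cplxJ n x (VectorField.mlieBracket 𝓘(ℝ, Cn n) X Y x) = 0

/-- The holomorphic cubic form `Ξ(u, v, W) = 2 Φ(π^{1,0} u, (∇_v π^{1,0}) W)`, where
`∇_v π^{1,0} = -(i/2) ∇_v J`.  In holomorphic coordinates this is
`Ξ_{ijk} = -2 i g_{i l̄} A^{l̄}_{jk}` with `A` the coefficients of `∇`.  The expression only depends
on the value of the vector field `W` at `x`. -/
def cubicForm (g : BilinField n M) (nab : AffineConn n M) (x : M) (u v : RTangent n x)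
    (W : VField n M) : ℂ :=
  2 * extHol (cplxJ n x) (fun u' => -(Complex.I / 2) *
    ((fundForm g x u' (nab (applyJ W) x v - cplxJ n x (nab W x v)) : ℝ) : ℂ)) u

end Rigid

/-! ## Projective special Kähler structures -/

/-- The exponential `ℂ → ℂˣ`. -/
def expUnit (z : ℂ) : ℂˣ := Units.mk0 (Complex.exp z) (Complex.exp_ne_zero z)

/-- The fundamental vector field `H = d/dλ|_{λ = 0} (exp λ • x)` of a holomorphic action of `ℂˣ`,
represented by the real vector field `H + H̄`, so that `H = π^{1,0} (fundField x)`. -/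
def fundField (n : ℕ) {M : Type*} [TopologicalSpace M] [ChartedSpace (Cn n) M] [MulAction ℂˣ M] :
    VField n M := fun x =>
  (mfderiv 𝓘(ℝ, ℂ) 𝓘(ℝ, Cn n) (fun z : ℂ => expUnit z • x) 0 (1 : ℂ) : Cn n)

/-- A projective special Kähler structure on the `n`-dimensional complex manifold `M`: a rigid
special pseudo-Kähler manifold `N` of dimension `n + 1` with a free holomorphic action of `ℂˣ` whose
fundamental vector field `H` is a non null homothetic Killing vector for the flat connection, and
`M = N / ℂˣ`. -/
structure ProjSpecialKahler (n : ℕ) (N M : Type*) [TopologicalSpace N]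
    [ChartedSpace (Cn (n + 1)) N] [IsManifold 𝓘(ℂ, Cn (n + 1)) ω N] [TopologicalSpace M]
    [ChartedSpace (Cn n) M] [IsManifold 𝓘(ℂ, Cn n) ω M] [MulAction ℂˣ N]
    [ContMDiffSMul 𝓘(ℂ, ℂ) 𝓘(ℂ, Cn (n + 1)) ω ℂˣ N] where
  /-- the metric of `N` -/
  metric : BilinField (n + 1) N
  isPseudoKahler : IsPseudoKahler metric
  /-- the flat connection of `N` -/
  nab : AffineConn (n + 1) N
  isSpecial : IsSpecialConnection metric nab
  free : ∀ (b : ℂˣ) (x : N), b • x = x → b = 1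
  /-- the homothety constant -/
  c : ℝ
  c_ne_zero : c ≠ 0
  /-- `∇_Y H = c Y` for all `Y` of type (1,0), in real and imaginary parts for
  `Y = (u - i J u) / 2` and `H = (h - i J h) / 2`. -/
  homothetic : ∀ (x : N) (u : RTangent (n + 1) x),
    nab (fundField (n + 1)) x u
        - nab (applyJ (fundField (n + 1))) x (cplxJ (n + 1) x u) = (2 * c) • u ∧
      nab (applyJ (fundField (n + 1))) x u
        + nab (fundField (n + 1)) x (cplxJ (n + 1) x u) = (2 * c) • cplxJ (n + 1) x u
  nonnull : ∀ x : N, hermPart (cplxJ (n + 1) x) (fun u v => metric x u v)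
    (fundField (n + 1) x) (fundField (n + 1) x) ≠ 0
  /-- the quotient map -/
  proj : N → M
  proj_submersion : Manifold.IsSubmersion 𝓘(ℂ, Cn (n + 1)) 𝓘(ℂ, Cn n) ω proj
  proj_surjective : Function.Surjective proj
  proj_eq_iff : ∀ x y : N, proj x = proj y ↔ ∃ b : ℂˣ, b • x = y

namespace ProjSpecialKahler

variable {n : ℕ} {N M : Type*} [TopologicalSpace N]
    [ChartedSpace (Cn (n + 1)) N] [IsManifold 𝓘(ℂ, Cn (n + 1)) ω N] [TopologicalSpace M]
    [ChartedSpace (Cn n) M] [IsManifold 𝓘(ℂ, Cn n) ω M] [MulAction ℂˣ N]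
    [ContMDiffSMul 𝓘(ℂ, ℂ) 𝓘(ℂ, Cn (n + 1)) ω ℂˣ N] (S : ProjSpecialKahler n N M)

/-- The Kähler potential `K = c⁻² g(H, H̄)` on `N`. -/
def potential (x : N) : ℝ :=
  (hermPart (cplxJ (n + 1) x) (fun u v => S.metric x u v)
    (fundField (n + 1) x) (fundField (n + 1) x)).re / S.c ^ 2

/-- `K` is a Kähler potential of the metric of `N`, homogeneous of bidegree (1,1) along the orbits:
`g_{a b̄} = ∂_a ∂_{b̄} K` and `K(exp λ • x) = e^{cλ} e^{cλ̄} K(x)`. -/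
def IsHomogeneousPotential (K : N → ℝ) : Prop :=
  ContMDiff 𝓘(ℝ, Cn (n + 1)) 𝓘(ℝ, ℝ) ∞ K ∧
  (∀ e ∈ holoAtlas (n + 1) N, ∀ p ∈ e.target, ∀ u v : Cn (n + 1),
    hermPart (multI (n + 1)) (fun u' v' => inChart S.metric e p u' v') u v
      = ddbar (fun q => K (e.symm q)) p u v) ∧
  ∀ (z : ℂ) (x : N), K (expUnit z • x) = ‖Complex.exp (S.c * z)‖ ^ 2 * K x

/-- The differential of the quotient map. -/
def dproj (x : N) : RTangent (n + 1) x →L[ℝ] RTangent n (S.proj x) :=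
  mfderiv 𝓘(ℝ, Cn (n + 1)) 𝓘(ℝ, Cn n) S.proj x

/-- The metric of `M`: the pseudo-Kähler metric `g_{i j̄} = ∂_i ∂_{j̄} (± log |K|)`, where `±` is the
sign of `K`; that is, the one whose pullback to `N` is `± ∂ ∂̄ log |K|`. -/
def IsProjectedMetric (g : BilinField n M) : Prop :=
  IsPseudoKahler g ∧
  ∀ e ∈ holoAtlas (n + 1) N, ∀ p ∈ e.target, ∀ u v : Cn (n + 1),
    hermPart (cplxJ n (S.proj (e.symm p))) (fun u' v' => g (S.proj (e.symm p)) u' v')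
        (S.dproj (e.symm p) (mfderiv 𝓘(ℝ, Cn (n + 1)) 𝓘(ℝ, Cn (n + 1)) e.symm p u))
        (S.dproj (e.symm p) (mfderiv 𝓘(ℝ, Cn (n + 1)) 𝓘(ℝ, Cn (n + 1)) e.symm p v))
      = (Real.sign (S.potential (e.symm p)) : ℂ)
        * ddbar (fun q => Real.log |S.potential (e.symm q)|) p u v

/-- The connection form `ω = ∂ log |K|` of the Hermitian connection on the principal bundle
`N → M`; a vector is horizontal if `ω` vanishes on it. -/
def IsHorizontal (x : N) (u : RTangent (n + 1) x) : Prop :=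
  extHol (cplxJ (n + 1) x)
    (fun w => ((rdiff (n := n + 1) (fun y => Real.log |S.potential y|) x w : ℝ) : ℂ)) u = 0

/-- Families of cubic forms on the tangent spaces of `M`, parametrised by the points of `N`. -/
abbrev CubicFamily : Type _ :=
  (x : N) → RTangent n (S.proj x) →L[ℝ] RTangent n (S.proj x) →L[ℝ] RTangent n (S.proj x) →L[ℝ] ℂ

/-- The descended cubic form: `Ξ(X, Y, Z)` at a point `x` of `N` is the value of the cubic form
of `N` at the horizontal lifts of `X`, `Y`, `Z` to `x`. -/
def IsDescendedCubic (Xi : S.CubicFamily) : Prop :=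
  ∀ (x : N) (u v : RTangent (n + 1) x) (W : VField (n + 1) N),
    S.IsHorizontal x u → S.IsHorizontal x v → SmoothNear W x → S.IsHorizontal x (W x) →
    Xi x (S.dproj x u) (S.dproj x v) (S.dproj x (W x)) = cubicForm S.metric S.nab x u v W

/-- The components `Ξ_{ijk}` at `x`, in the holomorphic chart `e` of `M` at the image of `x`. -/
def cubicComp (Xi : S.CubicFamily) (e : OpenPartialHomeomorph M (Cn n)) (x : N)
    (i j k : Fin n) : ℂ :=
  let D : Cn n →L[ℝ] RTangent n (S.proj x) :=
    (mfderiv 𝓘(ℝ, Cn n) 𝓘(ℝ, Cn n) e (S.proj x)).inverse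
  Xi x (D (coordVec i)) (D (coordVec j)) (D (coordVec k))

/-- `Ξ` is a holomorphic section of `(L*)^{⊗2} ⊗ Sym³ T*M`: it is complex trilinear and symmetric,
its components are holomorphic functions on `N`, and these are homogeneous of degree 2 along the
orbits of `ℂˣ`, where sections of `L*` are the functions `f` on `N` with
`f(b • x) = b f(x)` for `b • x` standing for `exp λ • x` and `b = e^{cλ}`. -/
def IsHolomorphicSection (Xi : S.CubicFamily) : Prop :=
  (∀ x u v w, Xi x (cplxJ n _ u) v w = Complex.I * Xi x u v w) ∧
  (∀ x u v w, Xi x u v w = Xi x v u w) ∧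
  (∀ x u v w, Xi x u v w = Xi x u w v) ∧
  (∀ e ∈ holoAtlas n M, ∀ i j k : Fin n,
    ContMDiffOn 𝓘(ℂ, Cn (n + 1)) 𝓘(ℂ, ℂ) ω (fun x => S.cubicComp Xi e x i j k)
      (S.proj ⁻¹' e.source)) ∧
  ∀ e ∈ holoAtlas n M, ∀ (x : N), S.proj x ∈ e.source → ∀ (z : ℂ) (i j k : Fin n),
    S.cubicComp Xi e (expUnit z • x) i j k
      = Complex.exp (S.c * z) ^ 2 * S.cubicComp Xi e x i j k

end ProjSpecialKahler

end

noncomputable section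

/-! ## Complex-linear and antilinear parts -/

section ComplexParts

variable {m : ℕ} {F : Type*} [NormedAddCommGroup F] [NormedSpace ℂ F]

/-! In a holomorphic chart of `N`, torsionfreeness and `d_∇ J = 0` say that the connection
coefficients satisfy `Γ(u, v) = Γ(v, u)` and `Γ(iu, v) = Γ(u, iv)`. Hence `Γ = B + C`, with `B`
(`holPart`) complex bilinear and `C` (`antiPart`) antilinear in both arguments. Since `Φ` is
parallel, `B` is the Levi-Civita connection of the metric and `C` is self-adjoint for it
(`fderiv_metric`, `metric_antiPart`). Let `h` be the (1,1) part of the metric. The cubic form is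
`-2i h(u, C(v, w))`, which is therefore totally symmetric. Flatness splits by type: one component
says that the antiholomorphic derivative of `B` is `-C C` (`fderiv_holPart_anti`), another that `C`
is covariantly constant in (1,0) directions, which makes the cubic form holomorphic
(`fderiv_antiPart_hol`, `locCubic_differentiable`).

Let `η` be the fundamental field in the chart. Homothety gives `C(u, η) = 0` and `B(u, η) = c u -
∂_u η`. So `dK = G(·, η) / c` and `∂∂̄K = h`, the cubic form annihilates `η`, and its Lie derivative
along `η` is `2c` times itself (`fderiv_locCubic_field`). Moreover `∂∂̄ log |K| = h / K - ω ⊗ ω̄`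
with `ω = h(·, η) / (cK)`, and the null directions of this form are exactly the multiples of `η`.
The action multiplies `K` by positive constants, so the form is invariant; it descends to a
nondegenerate form on `M`. Likewise the cubic form descends along arbitrary lifts, not only
horizontal ones.

Around each point there are charts in which the quotient map is a linear map `P` with right inverse
`Q` (`exists_isAdapted`). There the Levi-Civita connection of the projected metric is `P B(Qu, Qv) -
ω(Qu) v - ω(Qv) u` (`christoffel_proj`). It is complex bilinear, so `R(∂_k, ∂_{l̄}) ∂_i` is minus
its derivative in the direction `∂_{l̄}`: the derivative of `B` contributes `P C(l, C(k, i))`, and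
`∂̄ω`, which is `∂∂̄ log |K|` up to order, contributes the two metric terms with the sign of `K`.
Expressing `C` through the cubic form and the projected metric produces the factor `1 / (4K²)`
(`riemannComp_eq`). -/

theorem multI_apply (u : Cn m) : multI m u = Complex.I • u := rfl

theorem I_smul_I_smul {V : Type*} [AddCommGroup V] [Module ℂ V] (u : V) :
    Complex.I • Complex.I • u = -u := by
  rw [smul_smul, Complex.I_mul_I, neg_one_smul]

theorem complex_smul_eq (z : ℂ) (u : Cn m) : z • u = z.re • u + z.im • Complex.I • u := by
  ext i
  simp only [Pi.smul_apply, Pi.add_apply, smul_eq_mul, Complex.real_smul]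
  conv_lhs => rw [← Complex.re_add_im z]
  ring

theorem map_complex_smul {W : Type*} [NormedAddCommGroup W] [NormedSpace ℝ W]
    (f : Cn m →L[ℝ] W) (z : ℂ) (u : Cn m) :
    f (z • u) = z.re • f u + z.im • f (Complex.I • u) := by
  rw [complex_smul_eq, map_add, map_smul, map_smul]

/-- A real linear map commuting with multiplication by `i` is complex linear. -/
theorem map_complex_smul_of_I {f : Cn m →L[ℝ] F}
    (h : ∀ u, f (Complex.I • u) = Complex.I • f u) (z : ℂ) (u : Cn m) : f (z • u) = z • f u := by
  rw [map_complex_smul, h, ← Complex.coe_smul z.re, ← Complex.coe_smul z.im, smul_smul, ← add_smul,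
    Complex.re_add_im]

/-- The component of type (1,1) of a real bilinear form. -/
def hermOf (g : Cn m →L[ℝ] Cn m →L[ℝ] ℝ) (u v : Cn m) : ℂ :=
  hermPart (multI m) (fun a b => g a b) u v

theorem hermOf_eq (g : Cn m →L[ℝ] Cn m →L[ℝ] ℝ) (u v : Cn m) :
    hermOf g u v = ((g u v + Complex.I * g u (Complex.I • v))
      - Complex.I * (g (Complex.I • u) v + Complex.I * g (Complex.I • u) (Complex.I • v))) / 4 := by
  simp only [hermOf, hermPart, extHol, extAnti, multI_apply]
  ring

theorem hermOf_add_left (g : Cn m →L[ℝ] Cn m →L[ℝ] ℝ) (u u' v : Cn m) :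
    hermOf g (u + u') v = hermOf g u v + hermOf g u' v := by
  simp only [hermOf_eq, smul_add, map_add, add_apply, Complex.ofReal_add]
  ring

theorem hermOf_add_right (g : Cn m →L[ℝ] Cn m →L[ℝ] ℝ) (u v v' : Cn m) :
    hermOf g u (v + v') = hermOf g u v + hermOf g u v' := by
  simp only [hermOf_eq, smul_add, map_add, Complex.ofReal_add]
  ring

/-- Sesquilinearity holds for every real bilinear form: the projections to types (1,0) and (0,1)
already enforce it. Symmetry and invariance enter only through `IsHermBilin`. -/
theorem hermOf_smul_left (g : Cn m →L[ℝ] Cn m →L[ℝ] ℝ) (z : ℂ) (u v : Cn m) :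
    hermOf g (z • u) v = z * hermOf g u v := by
  have h1 : hermOf g (Complex.I • u) v = Complex.I * hermOf g u v := by
    simp only [hermOf_eq, I_smul_I_smul, map_neg, neg_apply]
    push_cast
    linear_combination ((g (Complex.I • u) v + Complex.I * g (Complex.I • u) (Complex.I • v)) / 4
      : ℂ) * Complex.I_sq
  have h2 : ∀ (r : ℝ) (u : Cn m), hermOf g (r • u) v = r * hermOf g u v := by
    intro r u
    simp only [hermOf_eq, smul_comm Complex.I r, map_smul, smul_apply, smul_eq_mul]
    push_cast
    ring
  rw [complex_smul_eq, hermOf_add_left, h2, h2, h1]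
  conv_rhs => rw [← Complex.re_add_im z]
  ring

theorem hermOf_smul_right (g : Cn m →L[ℝ] Cn m →L[ℝ] ℝ) (z : ℂ) (u v : Cn m) :
    hermOf g u (z • v) = (starRingEnd ℂ) z * hermOf g u v := by
  have h1 : hermOf g u (Complex.I • v) = -Complex.I * hermOf g u v := by
    simp only [hermOf_eq, I_smul_I_smul, map_neg]
    push_cast
    linear_combination ((g u (Complex.I • v) : ℂ)
      - Complex.I * g (Complex.I • u) (Complex.I • v)) / 4 * Complex.I_sq
  have h2 : ∀ (r : ℝ) (v : Cn m), hermOf g u (r • v) = r * hermOf g u v := by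
    intro r u
    simp only [hermOf_eq, smul_comm Complex.I r, map_smul, smul_eq_mul]
    push_cast
    ring
  have : (starRingEnd ℂ) z = z.re - z.im * Complex.I := by
    apply Complex.ext <;> simp
  rw [complex_smul_eq, hermOf_add_right, h2, h2, h1, this]
  ring

theorem hermOf_neg_left (g : Cn m →L[ℝ] Cn m →L[ℝ] ℝ) (u v : Cn m) :
    hermOf g (-u) v = -hermOf g u v := by
  simpa using hermOf_smul_left g (-1) u v

theorem hermOf_neg_right (g : Cn m →L[ℝ] Cn m →L[ℝ] ℝ) (u v : Cn m) :
    hermOf g u (-v) = -hermOf g u v := by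
  simpa using hermOf_smul_right g (-1) u v

theorem hermOf_sub_left (g : Cn m →L[ℝ] Cn m →L[ℝ] ℝ) (u u' v : Cn m) :
    hermOf g (u - u') v = hermOf g u v - hermOf g u' v := by
  rw [sub_eq_add_neg, hermOf_add_left, hermOf_neg_left, sub_eq_add_neg]

/-- A symmetric real bilinear form invariant under the complex structure. -/
structure IsHermBilin (g : Cn m →L[ℝ] Cn m →L[ℝ] ℝ) : Prop where
  symm : ∀ u v, g u v = g v u
  inv : ∀ u v, g (Complex.I • u) (Complex.I • v) = g u v

namespace IsHermBilin

variable {g : Cn m →L[ℝ] Cn m →L[ℝ] ℝ} (hg : IsHermBilin g)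
include hg

theorem I_left (u v : Cn m) : g (Complex.I • u) v = -g u (Complex.I • v) := by
  have := hg.inv u (Complex.I • v)
  rw [I_smul_I_smul, map_neg] at this
  linarith

theorem I_self (u : Cn m) : g (Complex.I • u) u = 0 := by
  have h1 := hg.I_left u u
  have h2 := hg.symm u (Complex.I • u)
  linarith

theorem hermOf_eq_left (u v : Cn m) :
    hermOf g u v = (g u v - Complex.I * g (Complex.I • u) v) / 2 := by
  rw [hermOf_eq, hg.inv]
  have : g u (Complex.I • v) = -g (Complex.I • u) v := by rw [hg.I_left, neg_neg]
  rw [this]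
  push_cast
  linear_combination -(g u v : ℂ) / 4 * Complex.I_sq

theorem hermOf_eq_right (u v : Cn m) :
    hermOf g u v = (g u v + Complex.I * g u (Complex.I • v)) / 2 := by
  rw [hg.hermOf_eq_left, hg.I_left]
  push_cast
  ring

theorem re_hermOf (u v : Cn m) : (hermOf g u v).re = g u v / 2 := by
  rw [hg.hermOf_eq_left]
  simp

theorem hermOf_self (u : Cn m) : hermOf g u u = ((g u u / 2 : ℝ) : ℂ) := by
  rw [hg.hermOf_eq_left, hg.I_self]
  push_cast
  ring

theorem conj_hermOf (u v : Cn m) : (starRingEnd ℂ) (hermOf g u v) = hermOf g v u := by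
  rw [hg.hermOf_eq_left, hg.hermOf_eq_right, hg.symm v u, hg.symm v (Complex.I • u)]
  simp only [map_div₀, map_sub, map_mul, Complex.conj_ofReal, Complex.conj_I, map_ofNat]
  ring

end IsHermBilin

/-- Two invariant forms agree if their components of type (1,1) do. -/
theorem IsHermBilin.ext_hermOf {g g' : Cn m →L[ℝ] Cn m →L[ℝ] ℝ} (hg : IsHermBilin g)
    (hg' : IsHermBilin g') (h : ∀ u v, hermOf g u v = hermOf g' u v) : g = g' := by
  ext u v : 2
  have := congrArg Complex.re (h u v)
  rw [hg.re_hermOf, hg'.re_hermOf] at this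
  linarith

/-- The product rule for the component of type (1,1) of a family of bilinear forms. -/
theorem fderiv_hermOf {W : Type*} [NormedAddCommGroup W] [NormedSpace ℝ W]
    {G : W → Cn m →L[ℝ] Cn m →L[ℝ] ℝ} {X Y : W → Cn m} {p : W}
    (hG : DifferentiableAt ℝ G p) (hX : DifferentiableAt ℝ X p) (hY : DifferentiableAt ℝ Y p) :
    DifferentiableAt ℝ (fun q => hermOf (G q) (X q) (Y q)) p ∧
      ∀ t, fderiv ℝ (fun q => hermOf (G q) (X q) (Y q)) p t
        = hermOf (fderiv ℝ G p t) (X p) (Y p) + hermOf (G p) (fderiv ℝ X p t) (Y p)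
          + hermOf (G p) (X p) (fderiv ℝ Y p t) := by
  have key : ∀ {a b : W → Cn m} {a' b' : W →L[ℝ] Cn m}, HasFDerivAt a a' p → HasFDerivAt b b' p →
      HasFDerivAt (fun q => ((G q (a q) (b q) : ℝ) : ℂ))
        (Complex.ofRealCLM.comp (((fderiv ℝ G p).flip (a p)).flip (b p)
          + ((G p).comp a').flip (b p) + (G p (a p)).comp b')) p := by
    intro a b a' b' ha hb
    have h1 := (hG.hasFDerivAt.clm_apply ha).clm_apply hb
    refine (Complex.ofRealCLM.hasFDerivAt.comp p h1).congr_fderiv ?_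
    ext t
    simp
    ring
  have hIX : HasFDerivAt (fun q => Complex.I • X q) (Complex.I • fderiv ℝ X p) p :=
    hX.hasFDerivAt.const_smul Complex.I
  have hIY : HasFDerivAt (fun q => Complex.I • Y q) (Complex.I • fderiv ℝ Y p) p :=
    hY.hasFDerivAt.const_smul Complex.I
  have h := (((key hX.hasFDerivAt hY.hasFDerivAt).add
    ((key hX.hasFDerivAt hIY).const_mul Complex.I)).sub
    (((key hIX hY.hasFDerivAt).add ((key hIX hIY).const_mul Complex.I)).const_mul
      Complex.I)).const_mul (1 / 4 : ℂ)
  have h' : HasFDerivAt (fun q => hermOf (G q) (X q) (Y q)) _ p := h.congr_of_eventuallyEq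
    (Filter.Eventually.of_forall fun q => by simp only [hermOf_eq]; simp; ring)
  refine ⟨h'.differentiableAt, fun t => ?_⟩
  rw [h'.fderiv, hermOf_eq, hermOf_eq, hermOf_eq]
  simp
  ring

/-- A real differentiable map whose derivative is complex linear is complex differentiable. -/
theorem differentiableAt_complex_of_real {f : Cn m → F} {p : Cn m} (hf : DifferentiableAt ℝ f p)
    (h : ∀ t, fderiv ℝ f p (Complex.I • t) = Complex.I • fderiv ℝ f p t) :
    DifferentiableAt ℂ f p := by
  let L : Cn m →L[ℂ] F :=
    { toFun := fderiv ℝ f p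
      map_add' := map_add _
      map_smul' := map_complex_smul_of_I h
      cont := (fderiv ℝ f p).cont }
  exact (hasFDerivAt_of_restrictScalars (f' := L) ℝ hf.hasFDerivAt (by ext; rfl)).differentiableAt

theorem fderiv_real_I_smul {f : Cn m → F} {p : Cn m} (hf : DifferentiableAt ℂ f p) (t : Cn m) :
    fderiv ℝ f p (Complex.I • t) = Complex.I • fderiv ℝ f p t := by
  rw [hf.fderiv_restrictScalars ℝ]
  simp

/-! ## Special bilinear maps -/

/-- The complex linear part in the first argument of a real bilinear map. -/
def holPart (Γ : Cn m →L[ℝ] Cn m →L[ℝ] Cn m) (u v : Cn m) : Cn m :=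
  (1 / 2 : ℂ) • (Γ u v - Complex.I • Γ (Complex.I • u) v)

/-- The complex antilinear part in the first argument of a real bilinear map. -/
def antiPart (Γ : Cn m →L[ℝ] Cn m →L[ℝ] Cn m) (u v : Cn m) : Cn m :=
  (1 / 2 : ℂ) • (Γ u v + Complex.I • Γ (Complex.I • u) v)

section Parts

variable (Γ : Cn m →L[ℝ] Cn m →L[ℝ] Cn m)

theorem holPart_add_antiPart (u v : Cn m) : Γ u v = holPart Γ u v + antiPart Γ u v := by
  simp only [holPart, antiPart]
  module

theorem holPart_add_right (u v v' : Cn m) :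
    holPart Γ u (v + v') = holPart Γ u v + holPart Γ u v' := by
  simp only [holPart, map_add]
  module

theorem antiPart_add_right (u v v' : Cn m) :
    antiPart Γ u (v + v') = antiPart Γ u v + antiPart Γ u v' := by
  simp only [antiPart, map_add]
  module

theorem holPart_I_left (u v : Cn m) :
    holPart Γ (Complex.I • u) v = Complex.I • holPart Γ u v := by
  simp only [holPart, I_smul_I_smul, map_neg, neg_apply]
  match_scalars <;> grind [Complex.I_sq]

theorem antiPart_I_left (u v : Cn m) :
    antiPart Γ (Complex.I • u) v = -(Complex.I • antiPart Γ u v) := by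
  simp only [antiPart, I_smul_I_smul, map_neg, neg_apply]
  match_scalars <;> grind [Complex.I_sq]

theorem holPart_real_smul_right (r : ℝ) (u v : Cn m) :
    holPart Γ u (r • v) = r • holPart Γ u v := by
  simp only [holPart, map_smul]
  simp only [← Complex.coe_smul r]
  module

theorem antiPart_real_smul_right (r : ℝ) (u v : Cn m) :
    antiPart Γ u (r • v) = r • antiPart Γ u v := by
  simp only [antiPart, map_smul]
  simp only [← Complex.coe_smul r]
  module

end Parts

/-- The symmetries of the coefficients of a torsionfree connection with `d_∇ J = 0`. -/
structure IsSpecialBilin (Γ : Cn m →L[ℝ] Cn m →L[ℝ] Cn m) : Prop where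
  symm : ∀ u v, Γ u v = Γ v u
  I_left : ∀ u v, Γ (Complex.I • u) v = Γ u (Complex.I • v)

namespace IsSpecialBilin

variable {Γ : Cn m →L[ℝ] Cn m →L[ℝ] Cn m} (hΓ : IsSpecialBilin Γ)
include hΓ

/-- Symmetry together with `I_left` lets a factor `i` pass from one argument to the other. Thus the
two parts are complex bilinear and bi-antilinear, and `Γ` has no component of mixed type. -/
theorem holPart_symm (u v : Cn m) : holPart Γ u v = holPart Γ v u := by
  simp only [holPart, hΓ.symm u v, hΓ.I_left u v, hΓ.symm u (Complex.I • v)]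

theorem antiPart_symm (u v : Cn m) : antiPart Γ u v = antiPart Γ v u := by
  simp only [antiPart, hΓ.symm u v, hΓ.I_left u v, hΓ.symm u (Complex.I • v)]

theorem holPart_I_right (u v : Cn m) :
    holPart Γ u (Complex.I • v) = Complex.I • holPart Γ u v := by
  rw [hΓ.holPart_symm, holPart_I_left, hΓ.holPart_symm]

theorem antiPart_I_right (u v : Cn m) :
    antiPart Γ u (Complex.I • v) = -(Complex.I • antiPart Γ u v) := by
  rw [hΓ.antiPart_symm, antiPart_I_left, hΓ.antiPart_symm]

theorem holPart_smul_right (z : ℂ) (u v : Cn m) :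
    holPart Γ u (z • v) = z • holPart Γ u v := by
  rw [complex_smul_eq z v, complex_smul_eq z, holPart_add_right, holPart_real_smul_right,
    holPart_real_smul_right, hΓ.holPart_I_right]

theorem holPart_smul_left (z : ℂ) (u v : Cn m) :
    holPart Γ (z • u) v = z • holPart Γ u v := by
  rw [hΓ.holPart_symm, hΓ.holPart_smul_right, hΓ.holPart_symm]

theorem antiPart_smul_right (z : ℂ) (u v : Cn m) :
    antiPart Γ u (z • v) = (starRingEnd ℂ) z • antiPart Γ u v := by
  rw [complex_smul_eq z v, complex_smul_eq ((starRingEnd ℂ) z), antiPart_add_right,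
    antiPart_real_smul_right, antiPart_real_smul_right, hΓ.antiPart_I_right]
  simp

end IsSpecialBilin

end ComplexParts

/-! ### Special Kähler geometry in a holomorphic chart -/

section LocalGeometry

variable {m : ℕ}

/-- Product rule for a family of bilinear maps. -/
theorem hasFDerivAt_bilin {W E' F' : Type*} [NormedAddCommGroup W] [NormedSpace ℝ W]
    [NormedAddCommGroup E'] [NormedSpace ℝ E'] [NormedAddCommGroup F'] [NormedSpace ℝ F']
    {Γ : W → E' →L[ℝ] E' →L[ℝ] F'} {X Y : W → E'} {p : W}
    (hΓ : DifferentiableAt ℝ Γ p) (hX : DifferentiableAt ℝ X p) (hY : DifferentiableAt ℝ Y p) :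
    HasFDerivAt (fun q => Γ q (X q) (Y q))
      (((fderiv ℝ Γ p).flip (X p)).flip (Y p) + ((Γ p).comp (fderiv ℝ X p)).flip (Y p)
        + (Γ p (X p)).comp (fderiv ℝ Y p)) p := by
  refine ((hΓ.hasFDerivAt.clm_apply hX.hasFDerivAt).clm_apply hY.hasFDerivAt).congr_fderiv ?_
  ext t
  simp
  abel

theorem fderiv_bilin {W E' F' : Type*} [NormedAddCommGroup W] [NormedSpace ℝ W]
    [NormedAddCommGroup E'] [NormedSpace ℝ E'] [NormedAddCommGroup F'] [NormedSpace ℝ F']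
    {Γ : W → E' →L[ℝ] E' →L[ℝ] F'} {X Y : W → E'} {p : W}
    (hΓ : DifferentiableAt ℝ Γ p) (hX : DifferentiableAt ℝ X p) (hY : DifferentiableAt ℝ Y p)
    (t : W) :
    fderiv ℝ (fun q => Γ q (X q) (Y q)) p t
      = fderiv ℝ Γ p t (X p) (Y p) + Γ p (fderiv ℝ X p t) (Y p)
        + Γ p (X p) (fderiv ℝ Y p t) := by
  rw [(hasFDerivAt_bilin hΓ hX hY).fderiv]
  simp

theorem fderiv_bilin_const {W E' F' : Type*} [NormedAddCommGroup W] [NormedSpace ℝ W]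
    [NormedAddCommGroup E'] [NormedSpace ℝ E'] [NormedAddCommGroup F'] [NormedSpace ℝ F']
    {Γ : W → E' →L[ℝ] E' →L[ℝ] F'} {p : W} (hΓ : DifferentiableAt ℝ Γ p) (u v : E') (t : W) :
    fderiv ℝ (fun q => Γ q u v) p t = fderiv ℝ Γ p t u v := by
  rw [fderiv_bilin hΓ (differentiableAt_const u) (differentiableAt_const v)]
  simp

theorem hasFDerivAt_holPart {Γ : Cn m → Cn m →L[ℝ] Cn m →L[ℝ] Cn m} {p : Cn m}
    (hΓ : DifferentiableAt ℝ Γ p) (u v : Cn m) :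
    DifferentiableAt ℝ (fun q => holPart (Γ q) u v) p ∧
      ∀ t, fderiv ℝ (fun q => holPart (Γ q) u v) p t = holPart (fderiv ℝ Γ p t) u v := by
  have h1 := hasFDerivAt_bilin hΓ (differentiableAt_const u) (differentiableAt_const v)
  have h2 := hasFDerivAt_bilin hΓ (differentiableAt_const (Complex.I • u)) (differentiableAt_const v)
  have h := (h1.sub (h2.const_smul Complex.I)).const_smul (1 / 2 : ℂ)
  refine ⟨h.differentiableAt, fun t => ?_⟩
  erw [h.fderiv]
  simp [holPart]

theorem hasFDerivAt_antiPart {Γ : Cn m → Cn m →L[ℝ] Cn m →L[ℝ] Cn m} {Y : Cn m → Cn m} {p : Cn m}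
    (hΓ : DifferentiableAt ℝ Γ p) (u : Cn m) (hY : DifferentiableAt ℝ Y p) :
    DifferentiableAt ℝ (fun q => antiPart (Γ q) u (Y q)) p ∧
      ∀ t, fderiv ℝ (fun q => antiPart (Γ q) u (Y q)) p t
        = antiPart (fderiv ℝ Γ p t) u (Y p) + antiPart (Γ p) u (fderiv ℝ Y p t) := by
  have h1 := hasFDerivAt_bilin hΓ (differentiableAt_const u) hY
  have h2 := hasFDerivAt_bilin hΓ (differentiableAt_const (Complex.I • u)) hY
  have h := (h1.add (h2.const_smul Complex.I)).const_smul (1 / 2 : ℂ)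
  refine ⟨h.differentiableAt, fun t => ?_⟩
  erw [h.fderiv]
  simp [antiPart]
  module

/-- The expression in a holomorphic chart of a rigid special pseudo-Kähler structure with a
homothetic Killing field: `G` is the metric, `Γ` are the coefficients of the flat connection and
`η` is the vector field. -/
structure LocalSpecial (U : Set (Cn m)) (G : Cn m → Cn m →L[ℝ] Cn m →L[ℝ] ℝ)
    (Γ : Cn m → Cn m →L[ℝ] Cn m →L[ℝ] Cn m) (η : Cn m → Cn m) (c : ℝ) : Prop where
  isOpen : IsOpen U
  metric_smooth : ContDiffOn ℝ ∞ G U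
  conn_smooth : ContDiffOn ℝ ∞ Γ U
  field_holo : ∀ p ∈ U, ContDiffAt ℂ ω η p
  c_ne : c ≠ 0
  isHerm : ∀ p ∈ U, IsHermBilin (G p)
  nondeg : ∀ p ∈ U, ∀ u, (∀ v, G p u v = 0) → u = 0
  isSpecial : ∀ p ∈ U, IsSpecialBilin (Γ p)
  symplectic : ∀ p ∈ U, ∀ t u v, fderiv ℝ G p t u (Complex.I • v)
    = G p (Γ p t u) (Complex.I • v) + G p u (Complex.I • Γ p t v)
  flat : ∀ p ∈ U, ∀ u v w, fderiv ℝ Γ p u v w - fderiv ℝ Γ p v u w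
    + Γ p u (Γ p v w) - Γ p v (Γ p u w) = 0
  homothetic : ∀ p ∈ U, ∀ u, fderiv ℝ η p u + Γ p u (η p) = c • u
  homothetic_I : ∀ p ∈ U, ∀ u,
    Complex.I • fderiv ℝ η p u + Γ p u (Complex.I • η p) = c • Complex.I • u
  nonnull : ∀ p ∈ U, G p (η p) (η p) ≠ 0

namespace LocalSpecial

variable {U : Set (Cn m)} {G : Cn m → Cn m →L[ℝ] Cn m →L[ℝ] ℝ}
    {Γ : Cn m → Cn m →L[ℝ] Cn m →L[ℝ] Cn m} {η : Cn m → Cn m} {c : ℝ}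
    (S : LocalSpecial U G Γ η c)
include S

theorem mem_nhds {p : Cn m} (hp : p ∈ U) : U ∈ 𝓝 p := S.isOpen.mem_nhds hp

theorem metric_diff {p : Cn m} (hp : p ∈ U) : DifferentiableAt ℝ G p :=
  (S.metric_smooth.contDiffAt (S.mem_nhds hp)).differentiableAt (by simp)

theorem conn_diff {p : Cn m} (hp : p ∈ U) : DifferentiableAt ℝ Γ p :=
  (S.conn_smooth.contDiffAt (S.mem_nhds hp)).differentiableAt (by simp)

theorem field_diff {p : Cn m} (hp : p ∈ U) : DifferentiableAt ℂ η p :=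
  (S.field_holo p hp).differentiableAt (by simp)

theorem field_diff_real {p : Cn m} (hp : p ∈ U) : DifferentiableAt ℝ η p :=
  (S.field_diff hp).restrictScalars ℝ

/-- The algebraic identities hold on an open set and may be differentiated. -/
theorem fderiv_isHerm {p : Cn m} (hp : p ∈ U) (t : Cn m) : IsHermBilin (fderiv ℝ G p t) := by
  constructor
  · intro u v
    rw [← fderiv_bilin_const (S.metric_diff hp), ← fderiv_bilin_const (S.metric_diff hp)]
    refine congrArg (fun f : Cn m →L[ℝ] ℝ => f t) (Filter.EventuallyEq.fderiv_eq ?_)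
    filter_upwards [S.mem_nhds hp] with q hq using (S.isHerm q hq).symm u v
  · intro u v
    rw [← fderiv_bilin_const (S.metric_diff hp), ← fderiv_bilin_const (S.metric_diff hp)]
    refine congrArg (fun f : Cn m →L[ℝ] ℝ => f t) (Filter.EventuallyEq.fderiv_eq ?_)
    filter_upwards [S.mem_nhds hp] with q hq using (S.isHerm q hq).inv u v

theorem fderiv_isSpecial {p : Cn m} (hp : p ∈ U) (t : Cn m) :
    IsSpecialBilin (fderiv ℝ Γ p t) := by
  constructor
  · intro u v
    rw [← fderiv_bilin_const (S.conn_diff hp), ← fderiv_bilin_const (S.conn_diff hp)]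
    refine congrArg (fun f : Cn m →L[ℝ] Cn m => f t) (Filter.EventuallyEq.fderiv_eq ?_)
    filter_upwards [S.mem_nhds hp] with q hq using (S.isSpecial q hq).symm u v
  · intro u v
    rw [← fderiv_bilin_const (S.conn_diff hp), ← fderiv_bilin_const (S.conn_diff hp)]
    refine congrArg (fun f : Cn m →L[ℝ] Cn m => f t) (Filter.EventuallyEq.fderiv_eq ?_)
    filter_upwards [S.mem_nhds hp] with q hq using (S.isSpecial q hq).I_left u v

/-! ### The metric connection -/

/-- Parallelism of `Φ` gives one equation for each pair `(u, v)`. Passing to `(iu, iv)` preserves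
the derivative of `G` and the terms with `holPart`, but reverses the terms with `antiPart`; the sum
and the difference of the two equations are the two claims. The first makes `holPart` the
Levi-Civita connection of `N`, the second is the source of the symmetry of the cubic form. -/
theorem fderiv_metric_aux {p : Cn m} (hp : p ∈ U) (t u v : Cn m) :
    fderiv ℝ G p t u v = G p (holPart (Γ p) t u) v + G p u (holPart (Γ p) t v) ∧
      G p (antiPart (Γ p) t u) v = G p u (antiPart (Γ p) t v) := by
  have hS := S.isSpecial p hp
  have hG := S.isHerm p hp
  have key : ∀ u v, fderiv ℝ G p t u v = G p (holPart (Γ p) t u) v + G p u (holPart (Γ p) t v)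
      + (G p (antiPart (Γ p) t u) v - G p u (antiPart (Γ p) t v)) := by
    intro u v
    have h := S.symplectic p hp t u (Complex.I • v)
    simp only [smul_neg, I_smul_I_smul, neg_neg, map_neg, holPart_add_antiPart (Γ p),
      hS.holPart_I_right, hS.antiPart_I_right, smul_add, map_add, add_apply] at h
    linarith
  have h1 := key u v
  have h2 := key (Complex.I • u) (Complex.I • v)
  rw [(S.fderiv_isHerm hp t).inv, hS.holPart_I_right, hS.holPart_I_right, hS.antiPart_I_right,
    hS.antiPart_I_right, hG.inv, hG.inv, map_neg, map_neg, neg_apply, hG.inv, hG.inv] at h2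
  constructor <;> linarith

theorem fderiv_metric {p : Cn m} (hp : p ∈ U) (t u v : Cn m) :
    fderiv ℝ G p t u v = G p (holPart (Γ p) t u) v + G p u (holPart (Γ p) t v) :=
  (S.fderiv_metric_aux hp t u v).1

theorem metric_antiPart {p : Cn m} (hp : p ∈ U) (t u v : Cn m) :
    G p (antiPart (Γ p) t u) v = G p u (antiPart (Γ p) t v) :=
  (S.fderiv_metric_aux hp t u v).2

theorem hermOf_fderiv_metric {p : Cn m} (hp : p ∈ U) (t u v : Cn m) :
    hermOf (fderiv ℝ G p t) u v
      = hermOf (G p) (holPart (Γ p) t u) v + hermOf (G p) u (holPart (Γ p) t v) := by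
  simp only [hermOf_eq, S.fderiv_metric hp, (S.isSpecial p hp).holPart_I_right]
  push_cast
  ring

/-! ### Curvature -/

/-- This is the component of flatness of type (0,1) in `v` and complex linear in `w`. In it `∂_u
Γ(v, w)` drops out, having no mixed type in `v` and `w`; of the quadratic terms only `C(v, C(u, w))`
remains. -/
theorem fderiv_holPart_anti {p : Cn m} (hp : p ∈ U) (u v w : Cn m) :
    holPart (fderiv ℝ Γ p v) u w + Complex.I • holPart (fderiv ℝ Γ p (Complex.I • v)) u w
      = -((2 : ℂ) • antiPart (Γ p) v (antiPart (Γ p) u w)) := by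
  have hS := S.isSpecial p hp
  have hd := fun t => S.fderiv_isSpecial hp t
  have h1 := S.flat p hp u v w
  have h2 := S.flat p hp u v (Complex.I • w)
  have h3 := S.flat p hp u (Complex.I • v) w
  have h4 := S.flat p hp u (Complex.I • v) (Complex.I • w)
  simp only [holPart_add_antiPart (Γ p), holPart_add_antiPart (fderiv ℝ Γ p _),
    holPart_add_right, antiPart_add_right, hS.holPart_I_right, hS.antiPart_I_right,
    (hd _).holPart_I_right, (hd _).antiPart_I_right, holPart_I_left, antiPart_I_left,
    ← neg_smul, hS.holPart_smul_right, hS.antiPart_smul_right, map_neg, Complex.conj_I, neg_neg]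
    at h1 h2 h3 h4
  -- The weights project onto the part antilinear in `v` and complex linear in `w`.
  linear_combination (norm := (match_scalars <;> grind [Complex.I_sq]))
    (-1 / 2 : ℂ) • h1 + (Complex.I / 2) • h2 - (Complex.I / 2) • h3 - (1 / 2 : ℂ) • h4

end LocalSpecial

end LocalGeometry

/-! ### The homothetic field, the potential and its logarithm in a chart -/

section LocalGeometry

variable {m : ℕ}

/-- The Kähler potential in a chart. -/
def locPot (G : Cn m → Cn m →L[ℝ] Cn m →L[ℝ] ℝ) (η : Cn m → Cn m) (c : ℝ) (p : Cn m) : ℝ :=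
  G p (η p) (η p) / (2 * c ^ 2)

/-- The connection form `∂ log |K|` in a chart. -/
def locOmega (G : Cn m → Cn m →L[ℝ] Cn m →L[ℝ] ℝ) (η : Cn m → Cn m) (c : ℝ) (p u : Cn m) : ℂ :=
  hermOf (G p) u (η p) / (c * locPot G η c p)

/-- The holomorphic cubic form in a chart. -/
def locCubic (G : Cn m → Cn m →L[ℝ] Cn m →L[ℝ] ℝ) (Γ : Cn m → Cn m →L[ℝ] Cn m →L[ℝ] Cn m)
    (p u v w : Cn m) : ℂ :=
  -2 * Complex.I * hermOf (G p) u (antiPart (Γ p) v w)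

theorem differentiableAt_fderiv {W F' : Type*} [NormedAddCommGroup W] [NormedSpace ℝ W]
    [NormedAddCommGroup F'] [NormedSpace ℝ F']
    {f : W → F'} {p : W} (hf : ContDiffAt ℝ ∞ f p) : DifferentiableAt ℝ (fderiv ℝ f) p :=
  (hf.fderiv_right (m := ∞) (by simp)).differentiableAt (by simp)

theorem fderiv_fderiv_apply {W F' : Type*} [NormedAddCommGroup W] [NormedSpace ℝ W]
    [NormedAddCommGroup F'] [NormedSpace ℝ F']
    {f : W → F'} {p : W} (hf : ContDiffAt ℝ ∞ f p) (t u : W) :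
    fderiv ℝ (fderiv ℝ f) p t u = fderiv ℝ (fun q => fderiv ℝ f q u) p t := by
  have h := differentiableAt_fderiv hf
  rw [fderiv_clm_apply h (differentiableAt_const u)]
  simp

namespace LocalSpecial

variable {U : Set (Cn m)} {G : Cn m → Cn m →L[ℝ] Cn m →L[ℝ] ℝ}
    {Γ : Cn m → Cn m →L[ℝ] Cn m →L[ℝ] Cn m} {η : Cn m → Cn m} {c : ℝ}
    (S : LocalSpecial U G Γ η c)
include S

/-- The component of flatness of type (1,0) in `t` and antilinear in `w`. It says that `C`, as a
form with values in (1,0) vectors, is annihilated by the (1,0) covariant derivative; holomorphy of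
the cubic form rests on it. -/
theorem fderiv_antiPart_hol {p : Cn m} (hp : p ∈ U) (t v w : Cn m) :
    antiPart (fderiv ℝ Γ p t) v w - Complex.I • antiPart (fderiv ℝ Γ p (Complex.I • t)) v w
      = -((2 : ℂ) • holPart (Γ p) t (antiPart (Γ p) v w)) := by
  have hS := S.isSpecial p hp
  have hd := fun t => S.fderiv_isSpecial hp t
  have h1 := S.flat p hp t v w
  have h2 := S.flat p hp t v (Complex.I • w)
  have h3 := S.flat p hp (Complex.I • t) v w
  have h4 := S.flat p hp (Complex.I • t) v (Complex.I • w)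
  simp only [holPart_add_antiPart (Γ p), holPart_add_antiPart (fderiv ℝ Γ p _),
    holPart_add_right, antiPart_add_right, hS.holPart_I_right, hS.antiPart_I_right,
    (hd _).holPart_I_right, (hd _).antiPart_I_right, holPart_I_left, antiPart_I_left,
    ← neg_smul, hS.holPart_smul_right, hS.antiPart_smul_right, map_neg, Complex.conj_I, neg_neg]
    at h1 h2 h3 h4
  linear_combination (norm := (match_scalars <;> grind [Complex.I_sq]))
    (1 / 2 : ℂ) • h1 + (Complex.I / 2) • h2 - (Complex.I / 2) • h3 + (1 / 2 : ℂ) • h4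

/-! ### The homothetic field -/

/-- The equations for `η` and `iη` agree on their complex linear terms after division by `i`, while
the antilinear term changes sign. Hence the latter vanishes. -/
theorem antiPart_field {p : Cn m} (hp : p ∈ U) (u : Cn m) : antiPart (Γ p) u (η p) = 0 := by
  have hS := S.isSpecial p hp
  have h1 := S.homothetic p hp u
  have h2 := S.homothetic_I p hp u
  rw [holPart_add_antiPart] at h1 h2
  rw [hS.holPart_I_right, hS.antiPart_I_right] at h2
  rw [← Complex.coe_smul] at h1 h2
  linear_combination (norm := (match_scalars <;> grind [Complex.I_sq]))
    (1 / 2 : ℂ) • h1 + (Complex.I / 2) • h2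

theorem antiPart_field_left {p : Cn m} (hp : p ∈ U) (u : Cn m) :
    antiPart (Γ p) (η p) u = 0 := by
  rw [(S.isSpecial p hp).antiPart_symm, S.antiPart_field hp]

theorem holPart_field {p : Cn m} (hp : p ∈ U) (u : Cn m) :
    holPart (Γ p) u (η p) = c • u - fderiv ℝ η p u := by
  have h1 := S.homothetic p hp u
  rw [holPart_add_antiPart, S.antiPart_field hp, add_zero] at h1
  rw [← h1, add_sub_cancel_left]

theorem metric_field_smooth : ContDiffOn ℝ ∞ η U := fun p hp =>
  (((S.field_holo p hp).restrict_scalars ℝ).of_le le_top).contDiffWithinAt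

/-! ### The potential -/

theorem locPot_smooth : ContDiffOn ℝ ∞ (locPot G η c) U :=
  (((S.metric_smooth.clm_apply S.metric_field_smooth).clm_apply
    S.metric_field_smooth)).div_const _

theorem locPot_smoothAt {p : Cn m} (hp : p ∈ U) : ContDiffAt ℝ ∞ (locPot G η c) p :=
  S.locPot_smooth.contDiffAt (S.mem_nhds hp)

theorem locPot_diff {p : Cn m} (hp : p ∈ U) : DifferentiableAt ℝ (locPot G η c) p :=
  (S.locPot_smoothAt hp).differentiableAt (by simp)

theorem locPot_ne {p : Cn m} (hp : p ∈ U) : locPot G η c p ≠ 0 :=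
  div_ne_zero (S.nonnull p hp) (by have := S.c_ne; positivity)

/-- The derivative of `G(η, η)` is `2 G(B(u, η) + ∂_u η, η)`, and homothety makes the first argument
equal to `c u`. -/
theorem fderiv_locPot {p : Cn m} (hp : p ∈ U) (u : Cn m) :
    fderiv ℝ (locPot G η c) p u = G p u (η p) / c := by
  have hη := S.field_diff_real hp
  have h := hasFDerivAt_bilin (S.metric_diff hp) hη hη
  have h' : HasFDerivAt (locPot G η c) _ p := h.mul_const (1 / (2 * c ^ 2)) |>.congr_of_eventuallyEq
    (Filter.Eventually.of_forall fun q => by simp [locPot, div_eq_mul_inv])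
  have hc := S.c_ne
  rw [h'.fderiv]
  simp only [smul_apply, add_apply, ContinuousLinearMap.flip_apply,
    ContinuousLinearMap.comp_apply, S.fderiv_metric hp, S.holPart_field hp, map_sub, sub_apply,
    map_smul, smul_eq_mul]
  rw [(S.isHerm p hp).symm (η p) u]
  field_simp
  ring

theorem hessian_locPot {p : Cn m} (hp : p ∈ U) (t u : Cn m) :
    fderiv ℝ (fderiv ℝ (locPot G η c)) p t u
      = G p u t + G p (holPart (Γ p) t u) (η p) / c := by
  rw [fderiv_fderiv_apply (S.locPot_smoothAt hp)]
  have : (fun q => fderiv ℝ (locPot G η c) q u) =ᶠ[𝓝 p] fun q => c⁻¹ • G q u (η q) := by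
    filter_upwards [S.mem_nhds hp] with q hq
    rw [S.fderiv_locPot hq, smul_eq_mul, div_eq_inv_mul]
  rw [this.fderiv_eq]
  have h := hasFDerivAt_bilin (S.metric_diff hp) (differentiableAt_const u) (S.field_diff_real hp)
  erw [(h.const_smul c⁻¹).fderiv]
  have hc := S.c_ne
  simp only [smul_apply, add_apply, ContinuousLinearMap.flip_apply, fderiv_fun_const, Pi.zero_apply,
    zero_apply, map_zero,
    ContinuousLinearMap.comp_apply, S.fderiv_metric hp, S.holPart_field hp, map_sub,
    map_smul, smul_eq_mul]
  field_simp
  ring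

/-- In the Hessian the term with `holPart` is the real part of a form that is complex bilinear in
both directions, so it has no (1,1) component. Only `G` survives. -/
theorem hermOf_hessian_locPot {p : Cn m} (hp : p ∈ U) (u v : Cn m) :
    hermOf (fderiv ℝ (fderiv ℝ (locPot G η c)) p) u v = hermOf (G p) u v := by
  have hS := S.isSpecial p hp
  have hG := S.isHerm p hp
  simp only [hermOf_eq, S.hessian_locPot hp, hS.holPart_I_right, holPart_I_left, I_smul_I_smul,
    map_neg, neg_apply, hG.symm _ u, hG.symm _ (Complex.I • u)]
  push_cast
  linear_combination ((G p (holPart (Γ p) u v) (η p) : ℂ) / c / 4) * Complex.I_sq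

theorem ddbar_locPot {p : Cn m} (hp : p ∈ U) (u v : Cn m) :
    ddbar (locPot G η c) p u v = hermOf (G p) u v :=
  S.hermOf_hessian_locPot hp u v

/-! ### The logarithm of the potential -/

theorem log_smoothAt {p : Cn m} (hp : p ∈ U) :
    ContDiffAt ℝ ∞ (fun q => Real.log |locPot G η c q|) p := by
  simp only [Real.log_abs]
  exact (S.locPot_smoothAt hp).log (S.locPot_ne hp)

theorem fderiv_log {p : Cn m} (hp : p ∈ U) (u : Cn m) :
    fderiv ℝ (fun q => Real.log |locPot G η c q|) p u = G p u (η p) / c / locPot G η c p := by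
  simp only [Real.log_abs]
  rw [fderiv.log (S.locPot_diff hp) (S.locPot_ne hp)]
  simp [S.fderiv_locPot hp]
  ring

theorem locOmega_eq {p : Cn m} (hp : p ∈ U) (u : Cn m) :
    locOmega G η c p u = (fderiv ℝ (fun q => Real.log |locPot G η c q|) p u
      - Complex.I * fderiv ℝ (fun q => Real.log |locPot G η c q|) p (Complex.I • u)) / 2 := by
  rw [S.fderiv_log hp, S.fderiv_log hp, locOmega, (S.isHerm p hp).hermOf_eq_left]
  push_cast
  ring

/-- The normalisation `K = h(η, η) / c²` is what gives `ω(η)` the constant value `c`; in particular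
every vector becomes horizontal after subtraction of a multiple of `η`. -/
theorem locOmega_field {p : Cn m} (hp : p ∈ U) : locOmega G η c p (η p) = c := by
  have hK := S.nonnull p hp
  have hc := S.c_ne
  rw [locOmega, (S.isHerm p hp).hermOf_self, locPot]
  have h1 : (c : ℂ) ≠ 0 := by exact_mod_cast hc
  have h2 : (G p (η p) (η p) : ℂ) ≠ 0 := by exact_mod_cast hK
  push_cast
  field_simp

theorem hessian_log {p : Cn m} (hp : p ∈ U) (t u : Cn m) :
    fderiv ℝ (fderiv ℝ (fun q => Real.log |locPot G η c q|)) p t u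
      = fderiv ℝ (fderiv ℝ (locPot G η c)) p t u / locPot G η c p
        - G p t (η p) / c / locPot G η c p * (G p u (η p) / c / locPot G η c p) := by
  rw [fderiv_fderiv_apply (S.log_smoothAt hp), fderiv_fderiv_apply (S.locPot_smoothAt hp)]
  have h1 : (fun q => fderiv ℝ (fun q => Real.log |locPot G η c q|) q u) =ᶠ[𝓝 p]
      fun q => fderiv ℝ (locPot G η c) q u * (locPot G η c q)⁻¹ := by
    filter_upwards [S.mem_nhds hp] with q hq
    rw [S.fderiv_log hq, S.fderiv_locPot hq, div_eq_mul_inv]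
  have h2 : DifferentiableAt ℝ (fun q => fderiv ℝ (locPot G η c) q u) p :=
    (differentiableAt_fderiv (S.locPot_smoothAt hp)).clm_apply (differentiableAt_const u)
  have hK := S.locPot_ne hp
  have h3 : HasFDerivAt (fun q => (locPot G η c q)⁻¹) _ p :=
    (hasDerivAt_inv hK).comp_hasFDerivAt p (S.locPot_diff hp).hasFDerivAt
  rw [h1.fderiv_eq, (h2.hasFDerivAt.fun_mul h3).fderiv]
  simp [S.fderiv_locPot hp]
  field_simp
  ring

/-- From `d² log |K| = d²K / K - (dK / K) ⊗ (dK / K)`: the first term has (1,1) part `h / K`, and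
`ω` is the (1,0) part of `dK / K`. -/
theorem ddbar_log {p : Cn m} (hp : p ∈ U) (u v : Cn m) :
    ddbar (fun q => Real.log |locPot G η c q|) p u v
      = hermOf (G p) u v / locPot G η c p
        - locOmega G η c p u * (starRingEnd ℂ) (locOmega G η c p v) := by
  have hG := S.isHerm p hp
  change hermOf (fderiv ℝ (fderiv ℝ (fun q => Real.log |locPot G η c q|)) p) u v = _
  rw [← S.hermOf_hessian_locPot hp]
  simp only [hermOf_eq (fderiv ℝ _ p), S.hessian_log hp, locOmega, hG.hermOf_eq_left]
  simp only [map_div₀, map_sub, map_mul, Complex.conj_ofReal, Complex.conj_I, map_ofNat]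
  push_cast
  ring

end LocalSpecial

end LocalGeometry

/-! ### Real smooth holomorphic functions are analytic -/

section Analyticity

universe u

/-- Cauchy's estimate applied `k` times, each derivative costing a shrinking of the ball by `δ`. -/
theorem norm_iteratedFDeriv_le_of_bound {E : Type u} [NormedAddCommGroup E] [NormedSpace ℂ E]
    {V : Set E} (hV : IsOpen V) {δ : ℝ} (hδ : 0 < δ) (k : ℕ) :
    ∀ {F : Type u} [NormedAddCommGroup F] [NormedSpace ℂ F] {f : E → F} {q : E} {M : ℝ},
      ContDiffOn ℂ ∞ f V → Metric.ball q ((k + 1) * δ) ⊆ V →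
      (∀ x ∈ Metric.ball q ((k + 1) * δ), ‖f x‖ < M) →
      ‖iteratedFDeriv ℂ k f q‖ ≤ M * (3 / δ) ^ k := by
  induction k with
  | zero =>
    intro F _ _ f q M hf hq hM
    have := hM q (Metric.mem_ball_self (by positivity))
    simpa using this.le
  | succ k ih =>
    intro F _ _ f q M hf hq hM
    have hsub : ∀ x ∈ Metric.ball q ((k + 1) * δ),
        Metric.ball x δ ⊆ Metric.ball q (((k + 1 : ℕ) + 1) * δ) := by
      intro x hx
      apply Metric.ball_subset_ball'
      rw [Metric.mem_ball] at hx
      push_cast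
      linarith
    have hM0 : 0 < M :=
      (norm_nonneg _).trans_lt (hM q (Metric.mem_ball_self (by positivity)))
    have h1 : ContDiffOn ℂ ∞ (fderiv ℂ f) V := hf.fderiv_of_isOpen hV (by simp)
    have h2 : ‖iteratedFDeriv ℂ k (fderiv ℂ f) q‖ ≤ (M * (3 / δ)) * (3 / δ) ^ k := by
      refine ih h1 ((Metric.ball_subset_ball (by push_cast; nlinarith)).trans hq) fun x hx => ?_
      -- Values of `f` on the ball differ by less than `2M`. The constant 3 in the statement
      -- replaces this 2 so that the bound on the derivative is strict, as the induction requires.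
      have h3 : ‖fderiv ℂ f x‖ ≤ (2 * M) / δ := by
        refine Complex.norm_fderiv_le_div_of_mapsTo_ball ((hf.differentiableOn (by simp)).mono
          ((hsub x hx).trans hq)) (fun y hy => ?_) hδ
        have := hM y (hsub x hx hy)
        have := hM x (hsub x hx (Metric.mem_ball_self hδ))
        rw [Metric.mem_closedBall, dist_eq_norm]
        have := norm_sub_le (f y) (f x)
        linarith
      refine h3.trans_lt ?_
      rw [mul_div_assoc', div_lt_div_iff_of_pos_right hδ]
      linarith
    rw [← norm_iteratedFDeriv_fderiv]
    refine h2.trans_eq ?_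
    rw [pow_succ, mul_assoc, mul_comm (3 / δ)]

/-- Complex smooth maps between complex Banach spaces are analytic. -/
theorem analyticAt_of_contDiffOn_complex {E F : Type u} [NormedAddCommGroup E] [NormedSpace ℂ E]
    [NormedAddCommGroup F] [NormedSpace ℂ F] [CompleteSpace F] {V : Set E} (hV : IsOpen V)
    {f : E → F} (hf : ContDiffOn ℂ ∞ f V) {p : E} (hp : p ∈ V) : AnalyticAt ℂ f p := by
  obtain ⟨M, r, hr, hrV, hM⟩ : ∃ M r : ℝ, 0 < r ∧ Metric.ball p r ⊆ V ∧
      ∀ x ∈ Metric.ball p r, ‖f x‖ < M := by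
    have h1 : ∀ᶠ x in 𝓝 p, ‖f x‖ < ‖f p‖ + 1 :=
      ((hf.continuousOn.continuousAt (hV.mem_nhds hp)).norm).eventually_lt continuousAt_const
        (by simp)
    obtain ⟨r, hr, h⟩ := Metric.mem_nhds_iff.1 (Filter.inter_mem h1 (hV.mem_nhds hp))
    exact ⟨_, r, hr, fun x hx => (h hx).2, fun x hx => (h hx).1⟩
  have hM0 : 0 < M := (norm_nonneg _).trans_lt (hM p (Metric.mem_ball_self hr))
  let ps : FormalMultilinearSeries ℂ E F := fun k => (k.factorial : ℂ)⁻¹ • iteratedFDeriv ℂ k f p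
  have hbound : ∀ k : ℕ, ‖ps k‖ ≤ M * Real.exp 1 * (3 * Real.exp 1 / r) ^ k := by
    intro k
    have hk : (0 : ℝ) < k + 1 := by positivity
    -- With `δ = r / (k + 1)` the `k + 1` shells exactly fill the ball of radius `r`; the resulting
    -- growth `(k + 1)^k` is compensated by `k!` up to a geometric factor.
    have h1 := norm_iteratedFDeriv_le_of_bound hV (δ := r / (k + 1)) (by positivity) k (q := p)
      (M := M) hf (by rwa [mul_div_cancel₀ _ hk.ne']) (by rwa [mul_div_cancel₀ _ hk.ne'])
    have h2 : ((k : ℝ) + 1) ^ k / k.factorial ≤ Real.exp 1 * Real.exp 1 ^ k := by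
      have := Real.pow_div_factorial_le_exp (x := (k : ℝ) + 1) hk.le k
      rwa [Real.exp_add, mul_comm, ← Real.exp_one_pow] at this
    calc ‖ps k‖ = (k.factorial : ℝ)⁻¹ * ‖iteratedFDeriv ℂ k f p‖ := by
          simp [ps, norm_smul]
      _ ≤ (k.factorial : ℝ)⁻¹ * (M * (3 / (r / (k + 1))) ^ k) := by gcongr
      _ = M * (3 / r) ^ k * (((k : ℝ) + 1) ^ k / k.factorial) := by
          rw [div_div_eq_mul_div, mul_div_right_comm, mul_pow]
          field_simp
      _ ≤ M * (3 / r) ^ k * (Real.exp 1 * Real.exp 1 ^ k) := by gcongr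
      _ = _ := by
          rw [mul_div_right_comm, mul_pow]
          ring
  let ρ : ℝ := r / (3 * Real.exp 1)
  have hρ : 0 < ρ := by positivity
  have hρr : 1 < r / ρ := by
    have := Real.add_one_le_exp 1
    simp only [ρ]
    rw [div_div_cancel₀ hr.ne']
    linarith
  have hrad : ENNReal.ofReal ρ ≤ ps.radius := by
    refine ps.le_radius_of_bound (M * Real.exp 1) (r := ρ.toNNReal) fun k => ?_
    rw [Real.coe_toNNReal _ hρ.le]
    calc ‖ps k‖ * ρ ^ k ≤ M * Real.exp 1 * (3 * Real.exp 1 / r) ^ k * ρ ^ k := by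
          gcongr
          exact hbound k
      _ = M * Real.exp 1 * (3 * Real.exp 1 / r * ρ) ^ k := by rw [mul_pow, mul_assoc]
      _ = M * Real.exp 1 := by
          have : 3 * Real.exp 1 / r * ρ = 1 := by
            simp only [ρ]
            field_simp
          rw [this, one_pow, mul_one]
  refine ⟨ps, ENNReal.ofReal ρ, hrad, by simpa using hρ, fun {y} hy => ?_⟩
  have hy' : ‖y‖ < ρ := by
    rw [Metric.mem_eball, edist_zero_right, ← ofReal_norm, ENNReal.ofReal_lt_ofReal_iff hρ] at hy
    exact hy
  -- restrict to a complex line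
  let L : ℂ →L[ℂ] E := (ContinuousLinearMap.id ℂ ℂ).smulRight y
  have hR1 : (1 : ℂ) ∈ Metric.ball (0 : ℂ) (r / ρ) := by simpa using hρr
  have hRmap : ∀ z ∈ Metric.ball (0 : ℂ) (r / ρ), p + L z ∈ Metric.ball p r := by
    intro z hz
    simp only [Metric.mem_ball, dist_zero_right] at hz
    rw [lt_div_iff₀ hρ] at hz
    simp only [L, Metric.mem_ball, dist_self_add_left, ContinuousLinearMap.smulRight_apply,
      ContinuousLinearMap.id_apply, norm_smul]
    exact (mul_le_mul_of_nonneg_left hy'.le (norm_nonneg z)).trans_lt hz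
  have hV' : IsOpen ((fun x => p + x) ⁻¹' V) := hV.preimage (by fun_prop)
  have hg : ContDiffOn ℂ ∞ (fun x => f (p + x)) ((fun x => p + x) ⁻¹' V) :=
    hf.comp (by fun_prop) fun x hx => hx
  have hVL : IsOpen (L ⁻¹' ((fun x => p + x) ⁻¹' V)) := hV'.preimage L.continuous
  have h0 : (0 : ℂ) ∈ L ⁻¹' ((fun x => p + x) ⁻¹' V) := by simpa using hp
  have hiter : ∀ k : ℕ, iteratedDeriv k (fun z => f (p + L z)) 0
      = iteratedFDeriv ℂ k f p fun _ => y := by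
    intro k
    have h1 := L.iteratedFDerivWithin_comp_right (i := k) hg hV'.uniqueDiffOn hVL.uniqueDiffOn h0
      (by exact_mod_cast le_top)
    rw [iteratedFDerivWithin_of_isOpen k hVL h0, map_zero,
      iteratedFDerivWithin_of_isOpen k hV' (by simpa using hp)] at h1
    rw [iteratedDeriv_eq_iteratedFDeriv]
    change iteratedFDeriv ℂ k ((fun x => f (p + x)) ∘ L) 0 (fun _ => 1) = _
    rw [h1, iteratedFDeriv_comp_add_left]
    simp [L]
  have hdiff : DifferentiableOn ℂ (fun z => f (p + L z)) (Metric.ball 0 (r / ρ)) :=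
    (hf.differentiableOn (by simp)).comp
      (by fun_prop) fun z hz => hrV (hRmap z hz)
  have hsum := Complex.hasSum_taylorSeries_on_ball hdiff hR1
  simp only [hiter] at hsum
  simpa [ps, L] using hsum

variable {m : ℕ}

/-- Induction on `k`: the partial derivatives are again real smooth and holomorphic, and the complex
derivative is a combination of them with constant coefficient forms. -/
theorem contDiffOn_complex_of_real {V : Set (Cn m)} (hV : IsOpen V) (k : ℕ) :
    ∀ {f : Cn m → ℂ}, ContDiffOn ℝ ∞ f V → DifferentiableOn ℂ f V → ContDiffOn ℂ k f V := by
  induction k with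
  | zero => exact fun hf _ => contDiffOn_zero.2 hf.continuousOn
  | succ k ih =>
    intro f hf hd
    have hdp : ∀ p ∈ V, DifferentiableAt ℂ f p := fun p hp => (hd p hp).differentiableAt
      (hV.mem_nhds hp)
    have hfp : ∀ p ∈ V, ContDiffAt ℝ ∞ f p := fun p hp => hf.contDiffAt (hV.mem_nhds hp)
    rw [Nat.cast_add, Nat.cast_one, contDiffOn_succ_iff_fderiv_of_isOpen hV]
    refine ⟨hd, by simp, ?_⟩
    have hpartial : ∀ i : Fin m, ContDiffOn ℂ k (fun p => fderiv ℝ f p (coordVec i)) V := by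
      intro i
      have hs : ContDiffOn ℝ ∞ (fun p => fderiv ℝ f p (coordVec i)) V :=
        (hf.fderiv_of_isOpen hV (by simp)).clm_apply contDiffOn_const
      refine ih hs fun p hp => (differentiableAt_complex_of_real
        ((hs.contDiffAt (hV.mem_nhds hp)).differentiableAt (by simp))
        fun t => ?_).differentiableWithinAt
      -- Symmetry of the second derivative moves `i t` into the slot where `f` is known to have a
      -- complex linear derivative.
      have hsymm : ∀ a b, fderiv ℝ (fderiv ℝ f) p a b = fderiv ℝ (fderiv ℝ f) p b a := fun a b =>
        (hfp p hp).isSymmSndFDerivAt (by simpa using ENat.LEInfty.out) a b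
      rw [← fderiv_fderiv_apply (hfp p hp), ← fderiv_fderiv_apply (hfp p hp), hsymm, hsymm t,
        fderiv_fderiv_apply (hfp p hp), fderiv_fderiv_apply (hfp p hp)]
      have : (fun q => fderiv ℝ f q (Complex.I • t)) =ᶠ[𝓝 p]
          fun q => Complex.I • fderiv ℝ f q t := by
        filter_upwards [hV.mem_nhds hp] with q hq using fderiv_real_I_smul (hdp q hq) t
      rw [this.fderiv_eq]
      have hdt : DifferentiableAt ℝ (fun q => fderiv ℝ f q t) p :=
        (differentiableAt_fderiv (hfp p hp)).clm_apply (differentiableAt_const t)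
      erw [(hdt.hasFDerivAt.const_smul Complex.I).fderiv]
      rfl
    have hexp : ∀ p ∈ V, fderiv ℂ f p = ∑ i : Fin m, fderiv ℝ f p (coordVec i) •
        (ContinuousLinearMap.proj i : Cn m →L[ℂ] ℂ) := by
      intro p hp
      rw [(hdp p hp).fderiv_restrictScalars ℝ]
      ext t
      have : t = ∑ i, t i • coordVec i := by
        ext j
        simp [Finset.sum_apply, Pi.single_apply]
      conv_lhs => rw [this, map_sum]
      simp [mul_comm]
    refine ContDiffOn.congr ?_ hexp
    exact ContDiffOn.sum fun i _ => (hpartial i).smul contDiffOn_const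

/-- Real smooth, complex differentiable functions are complex analytic. -/
theorem contDiffOn_omega_of_real {V : Set (Cn m)} (hV : IsOpen V) {f : Cn m → ℂ}
    (hf : ContDiffOn ℝ ∞ f V) (hd : DifferentiableOn ℂ f V) : ContDiffOn ℂ ω f V := by
  have h : ContDiffOn ℂ ∞ f V := contDiffOn_infty.2 fun k => contDiffOn_complex_of_real hV k hf hd
  exact fun p hp => (analyticAt_of_contDiffOn_complex hV h hp).contDiffAt.contDiffWithinAt

end Analyticity

/-! ### The cubic form in a chart -/

section LocalGeometry

variable {m : ℕ}

theorem locCubic_add_left (G : Cn m → Cn m →L[ℝ] Cn m →L[ℝ] ℝ)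
    (Γ : Cn m → Cn m →L[ℝ] Cn m →L[ℝ] Cn m) (p u u' v w : Cn m) :
    locCubic G Γ p (u + u') v w = locCubic G Γ p u v w + locCubic G Γ p u' v w := by
  simp only [locCubic, hermOf_add_left]
  ring

theorem locCubic_smul_left (G : Cn m → Cn m →L[ℝ] Cn m →L[ℝ] ℝ)
    (Γ : Cn m → Cn m →L[ℝ] Cn m →L[ℝ] Cn m) (z : ℂ) (p u v w : Cn m) :
    locCubic G Γ p (z • u) v w = z * locCubic G Γ p u v w := by
  simp only [locCubic, hermOf_smul_left]
  ring

theorem ContDiffOn.hermOf {W : Type*} [NormedAddCommGroup W] [NormedSpace ℝ W] {U : Set W}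
    {G : W → Cn m →L[ℝ] Cn m →L[ℝ] ℝ} {X Y : W → Cn m} {k : ℕ∞ω} (hG : ContDiffOn ℝ k G U)
    (hX : ContDiffOn ℝ k X U) (hY : ContDiffOn ℝ k Y U) :
    ContDiffOn ℝ k (fun q => _root_.hermOf (G q) (X q) (Y q)) U := by
  have hIX : ContDiffOn ℝ k (fun q => Complex.I • X q) U := hX.const_smul Complex.I
  have hIY : ContDiffOn ℝ k (fun q => Complex.I • Y q) U := hY.const_smul Complex.I
  have key : ∀ {a b : W → Cn m}, ContDiffOn ℝ k a U → ContDiffOn ℝ k b U →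
      ContDiffOn ℝ k (fun q => ((G q (a q) (b q) : ℝ) : ℂ)) U := fun ha hb =>
    Complex.ofRealCLM.contDiff.comp_contDiffOn ((hG.clm_apply ha).clm_apply hb)
  simp only [hermOf_eq]
  exact ((((key hX hY).add (contDiffOn_const.mul (key hX hIY))).sub
    (contDiffOn_const.mul ((key hIX hY).add (contDiffOn_const.mul (key hIX hIY)))))).div_const _

theorem ContDiffOn.antiPart {U : Set (Cn m)}
    {Γ : Cn m → Cn m →L[ℝ] Cn m →L[ℝ] Cn m} {k : ℕ∞ω} (hΓ : ContDiffOn ℝ k Γ U) (u v : Cn m) :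
    ContDiffOn ℝ k (fun q => _root_.antiPart (Γ q) u v) U := by
  have h : ∀ a b : Cn m, ContDiffOn ℝ k (fun q => Γ q a b) U := fun a b =>
    (hΓ.clm_apply contDiffOn_const).clm_apply contDiffOn_const
  exact ((h u v).add ((h (Complex.I • u) v).const_smul Complex.I)).const_smul (1 / 2 : ℂ)

namespace LocalSpecial

variable {U : Set (Cn m)} {G : Cn m → Cn m →L[ℝ] Cn m →L[ℝ] ℝ}
    {Γ : Cn m → Cn m →L[ℝ] Cn m →L[ℝ] Cn m} {η : Cn m → Cn m} {c : ℝ}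
    (S : LocalSpecial U G Γ η c)
include S

/-- Self-adjointness of `C` for the metric exchanges `u` and `w`; combined with the symmetry of `C`
this yields all permutations. -/
theorem locCubic_symm_left {p : Cn m} (hp : p ∈ U) (u v w : Cn m) :
    locCubic G Γ p u v w = locCubic G Γ p v u w := by
  have hS := S.isSpecial p hp
  have hG := S.isHerm p hp
  have key : ∀ u v, G p u (antiPart (Γ p) v w) = G p v (antiPart (Γ p) u w) := by
    intro u v
    rw [hG.symm, hS.antiPart_symm, S.metric_antiPart hp, hS.antiPart_symm w u, hG.symm]
  rw [locCubic, locCubic, hG.hermOf_eq_left, hG.hermOf_eq_left, key u v, key (Complex.I • u) v,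
    antiPart_I_left, map_neg, hG.I_left v]

theorem locCubic_symm_right {p : Cn m} (hp : p ∈ U) (u v w : Cn m) :
    locCubic G Γ p u v w = locCubic G Γ p u w v := by
  rw [locCubic, locCubic, (S.isSpecial p hp).antiPart_symm]

theorem locCubic_add_mid {p : Cn m} (hp : p ∈ U) (u v v' w : Cn m) :
    locCubic G Γ p u (v + v') w = locCubic G Γ p u v w + locCubic G Γ p u v' w := by
  rw [S.locCubic_symm_left hp, locCubic_add_left, S.locCubic_symm_left hp v,
    S.locCubic_symm_left hp v']

theorem locCubic_smul_mid {p : Cn m} (hp : p ∈ U) (z : ℂ) (u v w : Cn m) :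
    locCubic G Γ p u (z • v) w = z * locCubic G Γ p u v w := by
  rw [S.locCubic_symm_left hp, locCubic_smul_left, S.locCubic_symm_left hp v]

theorem locCubic_add_right {p : Cn m} (hp : p ∈ U) (u v w w' : Cn m) :
    locCubic G Γ p u v (w + w') = locCubic G Γ p u v w + locCubic G Γ p u v w' := by
  rw [S.locCubic_symm_right hp, S.locCubic_add_mid hp, S.locCubic_symm_right hp u w,
    S.locCubic_symm_right hp u w']

theorem locCubic_smul_right {p : Cn m} (hp : p ∈ U) (z : ℂ) (u v w : Cn m) :
    locCubic G Γ p u v (z • w) = z * locCubic G Γ p u v w := by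
  rw [S.locCubic_symm_right hp, S.locCubic_smul_mid hp, S.locCubic_symm_right hp u w]

theorem locCubic_field_mid {p : Cn m} (hp : p ∈ U) (u w : Cn m) :
    locCubic G Γ p u (η p) w = 0 := by
  have h := hermOf_smul_right (G p) 0 u 0
  rw [locCubic, S.antiPart_field_left hp]
  simp only [zero_smul, map_zero, zero_mul] at h
  rw [h, mul_zero]

theorem locCubic_field_left {p : Cn m} (hp : p ∈ U) (v w : Cn m) :
    locCubic G Γ p (η p) v w = 0 := by
  rw [S.locCubic_symm_left hp, S.locCubic_field_mid hp]

theorem locCubic_field_right {p : Cn m} (hp : p ∈ U) (u v : Cn m) :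
    locCubic G Γ p u v (η p) = 0 := by
  rw [S.locCubic_symm_right hp, S.locCubic_field_mid hp]

/-- The cubic form is unchanged by multiples of the homothetic field. -/
theorem locCubic_add_field {p : Cn m} (hp : p ∈ U) (u v w : Cn m) (a b d : ℂ) :
    locCubic G Γ p (u + a • η p) (v + b • η p) (w + d • η p) = locCubic G Γ p u v w := by
  simp only [S.locCubic_add_right hp, S.locCubic_add_mid hp, locCubic_add_left,
    locCubic_smul_left, S.locCubic_smul_mid hp, S.locCubic_smul_right hp,
    S.locCubic_field_left hp, S.locCubic_field_mid hp, S.locCubic_field_right hp]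
  ring

theorem locCubic_smooth (u v w : Cn m) : ContDiffOn ℝ ∞ (fun q => locCubic G Γ q u v w) U :=
  contDiffOn_const.mul (S.metric_smooth.hermOf contDiffOn_const (S.conn_smooth.antiPart v w))

theorem fderiv_locCubic {p : Cn m} (hp : p ∈ U) (t u v w : Cn m) :
    fderiv ℝ (fun q => locCubic G Γ q u v w) p t = -2 * Complex.I *
      (hermOf (G p) (holPart (Γ p) t u) (antiPart (Γ p) v w) + hermOf (G p) u
        (holPart (Γ p) t (antiPart (Γ p) v w) + antiPart (fderiv ℝ Γ p t) v w)) := by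
  have hC := hasFDerivAt_antiPart (S.conn_diff hp) v (differentiableAt_const w)
  have h := fderiv_hermOf (S.metric_diff hp) (differentiableAt_const u) hC.1
  have h0 := hermOf_smul_left (G p) 0 0 (antiPart (Γ p) v w)
  have h1 := (S.isSpecial p hp).antiPart_smul_right 0 v 0
  simp only [zero_smul, zero_mul, map_zero] at h0 h1
  simp only [locCubic]
  rw [fderiv_const_mul h.1, smul_apply, h.2, hC.2, S.hermOf_fderiv_metric hp]
  simp only [fderiv_fun_const, Pi.zero_apply, zero_apply, h0, h1, add_zero, hermOf_add_right,
    smul_eq_mul]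
  ring

/-- `C` sits in the antilinear slot of `h`, so the antiholomorphic derivative of the cubic form sees
only the (1,0) covariant derivative of `C`, which vanishes by `fderiv_antiPart_hol`. The remaining
term, with `holPart` in the first slot, is complex linear in `t`. -/
theorem locCubic_differentiable (u v w : Cn m) :
    DifferentiableOn ℂ (fun q => locCubic G Γ q u v w) U := by
  intro p hp
  refine (differentiableAt_complex_of_real
    (((S.locCubic_smooth u v w).contDiffAt (S.mem_nhds hp)).differentiableAt (by simp))
    fun t => ?_).differentiableWithinAt
  have h := S.fderiv_antiPart_hol hp t v w
  have h' : holPart (Γ p) (Complex.I • t) (antiPart (Γ p) v w)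
      + antiPart (fderiv ℝ Γ p (Complex.I • t)) v w
      = (-Complex.I) • (holPart (Γ p) t (antiPart (Γ p) v w)
        + antiPart (fderiv ℝ Γ p t) v w) := by
    rw [holPart_I_left]
    linear_combination (norm := (match_scalars <;> grind [Complex.I_sq])) Complex.I • h
  rw [S.fderiv_locCubic hp, S.fderiv_locCubic hp, h', hermOf_smul_right, holPart_I_left,
    hermOf_smul_left]
  simp only [map_neg, Complex.conj_I, neg_neg, smul_eq_mul]
  ring

theorem locCubic_analytic (u v w : Cn m) :
    ContDiffOn ℂ ω (fun q => locCubic G Γ q u v w) U :=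
  contDiffOn_omega_of_real S.isOpen (S.locCubic_smooth u v w) (S.locCubic_differentiable u v w)

/-- The derivative of the cubic form along the homothetic field. -/
theorem fderiv_locCubic_field {p : Cn m} (hp : p ∈ U) (u v w : Cn m) :
    fderiv ℝ (fun q => locCubic G Γ q u v w) p (η p) + locCubic G Γ p (fderiv ℝ η p u) v w
      + locCubic G Γ p u (fderiv ℝ η p v) w + locCubic G Γ p u v (fderiv ℝ η p w)
      = 2 * c * locCubic G Γ p u v w := by
  have hS := S.isSpecial p hp
  have hd := S.fderiv_isSpecial hp
  -- differentiate `antiPart Γ w η = 0`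
  have h0 : ∀ t, antiPart (fderiv ℝ Γ p t) w (η p) + antiPart (Γ p) w (fderiv ℝ η p t) = 0 := by
    intro t
    have h1 := hasFDerivAt_antiPart (S.conn_diff hp) w (S.field_diff_real hp)
    rw [← h1.2]
    have : (fun q => antiPart (Γ q) w (η q)) =ᶠ[𝓝 p] fun _ => 0 := by
      filter_upwards [S.mem_nhds hp] with q hq using S.antiPart_field hq w
    rw [this.fderiv_eq]
    simp
  -- Flatness with `η` in the first slot, restricted to the part antilinear in `w`; the terms with
  -- `C(η, ·)` are zero.
  have hfl : antiPart (fderiv ℝ Γ p (η p)) v w + holPart (Γ p) (η p) (antiPart (Γ p) v w)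
      = antiPart (fderiv ℝ Γ p v) (η p) w + antiPart (Γ p) v (holPart (Γ p) (η p) w) := by
    have h1 := S.flat p hp (η p) v w
    have h2 := S.flat p hp (η p) v (Complex.I • w)
    simp only [holPart_add_antiPart (Γ p), holPart_add_antiPart (fderiv ℝ Γ p _),
      holPart_add_right, antiPart_add_right, hS.holPart_I_right, hS.antiPart_I_right,
      (hd _).holPart_I_right, (hd _).antiPart_I_right,
      ← neg_smul, hS.holPart_smul_right, hS.antiPart_smul_right, map_neg, Complex.conj_I, neg_neg,
      S.antiPart_field_left hp] at h1 h2
    have hz : holPart (Γ p) v (0 : Cn m) = 0 := by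
      simpa using hS.holPart_smul_right 0 v 0
    have hz' : antiPart (Γ p) v (0 : Cn m) = 0 := by
      simpa using hS.antiPart_smul_right 0 v 0
    simp only [hz, hz', smul_zero, add_zero] at h1 h2
    linear_combination (norm := (match_scalars <;> grind [Complex.I_sq]))
      (1 / 2 : ℂ) • h1 + (Complex.I / 2) • h2
  have hw := h0 v
  rw [(hd v).antiPart_symm, hS.antiPart_symm w] at hw
  have hB : ∀ x, holPart (Γ p) (η p) x = (c : ℂ) • x - fderiv ℝ η p x := by
    intro x
    rw [hS.holPart_symm, S.holPart_field hp, Complex.coe_smul]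
  -- The derivative of `C` in the direction `v` is evaluated at `η`, so differentiating `C(·, η) =
  -- 0` turns it into `-C(∂_v η, w)`. The derivative along `η` thereby becomes algebraic.
  have hX : antiPart (fderiv ℝ Γ p (η p)) v w + holPart (Γ p) (η p) (antiPart (Γ p) v w)
      = (c : ℂ) • antiPart (Γ p) v w - antiPart (Γ p) (fderiv ℝ η p v) w
        - antiPart (Γ p) v (fderiv ℝ η p w) := by
    have hsub : antiPart (Γ p) v ((c : ℂ) • w - fderiv ℝ η p w)
        = (c : ℂ) • antiPart (Γ p) v w - antiPart (Γ p) v (fderiv ℝ η p w) := by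
      rw [sub_eq_add_neg, ← neg_one_smul ℂ (fderiv ℝ η p w), antiPart_add_right,
        hS.antiPart_smul_right, hS.antiPart_smul_right]
      simp
      module
    rw [hfl, hB, hsub]
    linear_combination (exp := 1) hw
  rw [S.fderiv_locCubic hp, add_comm (holPart (Γ p) (η p) (antiPart (Γ p) v w)), hX, hB]
  simp only [locCubic, sub_eq_add_neg, hermOf_add_left, hermOf_add_right, hermOf_smul_left,
    hermOf_smul_right, hermOf_neg_left, hermOf_neg_right, Complex.conj_ofReal]
  ring

end LocalSpecial

end LocalGeometry

/-! ### The connection form and the projection in an adapted chart -/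

section LocalGeometry

variable {m n : ℕ}

theorem sign_eventually_const {X : Type*} [TopologicalSpace X] {f : X → ℝ} {x : X}
    (hf : ContinuousAt f x) (hx : f x ≠ 0) : ∀ᶠ y in 𝓝 x, Real.sign (f y) = Real.sign (f x) := by
  rcases lt_or_gt_of_ne hx with h | h
  · filter_upwards [hf.eventually_lt continuousAt_const h] with y hy
    rw [Real.sign_of_neg hy, Real.sign_of_neg h]
  · filter_upwards [continuousAt_const.eventually_lt hf h] with y hy
    rw [Real.sign_of_pos hy, Real.sign_of_pos h]

theorem locOmega_add (G : Cn m → Cn m →L[ℝ] Cn m →L[ℝ] ℝ) (η : Cn m → Cn m) (c : ℝ)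
    (p u v : Cn m) : locOmega G η c p (u + v) = locOmega G η c p u + locOmega G η c p v := by
  rw [locOmega, hermOf_add_left, add_div]; rfl

theorem locOmega_smul (G : Cn m → Cn m →L[ℝ] Cn m →L[ℝ] ℝ) (η : Cn m → Cn m) (c : ℝ)
    (z : ℂ) (p u : Cn m) : locOmega G η c p (z • u) = z * locOmega G η c p u := by
  rw [locOmega, hermOf_smul_left, mul_div_assoc]; rfl

theorem contDiffAt_clm_apply_iff {D E F : Type*} [NormedAddCommGroup D] [NormedSpace ℝ D]
    [NormedAddCommGroup E] [NormedSpace ℝ E] [FiniteDimensional ℝ E] [NormedAddCommGroup F]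
    [NormedSpace ℝ F] {k : ℕ∞ω} {f : D → E →L[ℝ] F} {x : D} :
    ContDiffAt ℝ k f x ↔ ∀ y, ContDiffAt ℝ k (fun x => f x y) x := by
  refine ⟨fun h y => h.clm_apply contDiffAt_const, fun h => ?_⟩
  let d := Module.finrank ℝ E
  have hd : d = Module.finrank ℝ (Fin d → ℝ) := (Module.finrank_fin_fun ℝ).symm
  let e₁ := ContinuousLinearEquiv.ofFinrankEq hd
  let e₂ := (e₁.arrowCongr (1 : F ≃L[ℝ] F)).trans (ContinuousLinearEquiv.piRing (Fin d))
  rw [← Function.id_comp f, ← e₂.symm_comp_self]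
  exact e₂.symm.contDiff.contDiffAt.comp x (contDiffAt_pi.mpr fun i => h _)

/-- The form `h / K - ω ⊗ ω̄`, which is `∂ ∂̄ log |K|` in a chart. -/
def locDdbarLog (G : Cn m → Cn m →L[ℝ] Cn m →L[ℝ] ℝ) (η : Cn m → Cn m) (c : ℝ)
    (p u v : Cn m) : ℂ :=
  hermOf (G p) u v / locPot G η c p - locOmega G η c p u * (starRingEnd ℂ) (locOmega G η c p v)

/-- The derivative of `h(v, η)` simplifies through `B(t, η) + ∂_t η = c t`. Only the first summand
on the right is antilinear in `t`, so it is the antiholomorphic derivative of `ω`. -/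
theorem LocalSpecial.fderiv_locOmega {U : Set (Cn m)} {G : Cn m → Cn m →L[ℝ] Cn m →L[ℝ] ℝ}
    {Γ : Cn m → Cn m →L[ℝ] Cn m →L[ℝ] Cn m} {η : Cn m → Cn m} {c : ℝ}
    (S : LocalSpecial U G Γ η c) {p : Cn m} (hp : p ∈ U) (v : Cn m) :
    DifferentiableAt ℝ (fun q => locOmega G η c q v) p ∧
      ∀ t, fderiv ℝ (fun q => locOmega G η c q v) p t = locDdbarLog G η c p v t
        + locOmega G η c p (holPart (Γ p) t v) - locOmega G η c p v * locOmega G η c p t := by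
  have hG := S.isHerm p hp
  have hK : (locPot G η c p : ℂ) ≠ 0 := by exact_mod_cast S.locPot_ne hp
  have hc : (c : ℂ) ≠ 0 := by exact_mod_cast S.c_ne
  have h1 := fderiv_hermOf (S.metric_diff hp) (differentiableAt_const v) (S.field_diff_real hp)
  have h2 : HasFDerivAt (fun q => ((locPot G η c q : ℝ) : ℂ))
      (Complex.ofRealCLM.comp (fderiv ℝ (locPot G η c) p)) p :=
    Complex.ofRealCLM.hasFDerivAt.comp p (S.locPot_diff hp).hasFDerivAt
  have h3 : HasFDerivAt (fun q => ((c : ℂ) * locPot G η c q)⁻¹) _ p :=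
    ((hasDerivAt_inv (mul_ne_zero hc hK)).hasFDerivAt.restrictScalars ℝ).comp p (h2.const_mul (c : ℂ))
  have h4 : HasFDerivAt (fun q => locOmega G η c q v) _ p := (h1.1.hasFDerivAt.fun_mul h3)
  refine ⟨h4.differentiableAt, fun t => ?_⟩
  have h0 := hermOf_smul_left (G p) 0 0 (η p)
  simp only [zero_smul, zero_mul] at h0
  have hKt : ((fderiv ℝ (locPot G η c) p t : ℝ) : ℂ)
      = (hermOf (G p) t (η p) + hermOf (G p) (η p) t) / c := by
    rw [S.fderiv_locPot hp, hG.hermOf_eq_left, hG.hermOf_eq_right, hG.symm (η p) t,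
      hG.symm (η p) (Complex.I • t)]
    push_cast
    ring
  have hcs : hermOf (G p) v ((c : ℝ) • t) = c * hermOf (G p) v t := by
    rw [← Complex.coe_smul, hermOf_smul_right, Complex.conj_ofReal]
  have hBη : hermOf (G p) v (holPart (Γ p) t (η p)) + hermOf (G p) v (fderiv ℝ η p t)
      = c * hermOf (G p) v t := by
    rw [← hermOf_add_right, S.holPart_field hp, sub_add_cancel, hcs]
  rw [h4.fderiv]
  simp only [add_apply, smul_apply, h1.2, S.hermOf_fderiv_metric hp,
    fderiv_fun_const, Pi.zero_apply, zero_apply, h0, add_zero, smul_eq_mul,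
    ContinuousLinearMap.comp_apply, Complex.ofRealCLM_apply, hKt, ContinuousLinearMap.coe_restrictScalars',
    ContinuousLinearMap.toSpanSingleton_apply, add_assoc, hBη]
  simp only [locDdbarLog, locOmega, map_div₀, map_mul, Complex.conj_ofReal, hG.conj_hermOf]
  field_simp
  ring

/-- The expression, in an adapted chart, of a projection along the homothetic field to a
pseudo-Kähler manifold with metric `G'`. -/
structure LocalProjection (U : Set (Cn m)) (G : Cn m → Cn m →L[ℝ] Cn m →L[ℝ] ℝ)
    (Γ : Cn m → Cn m →L[ℝ] Cn m →L[ℝ] Cn m) (η : Cn m → Cn m) (c : ℝ)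
    (P : Cn m →L[ℂ] Cn n) (Q : Cn n →L[ℂ] Cn m) (G' : Cn n → Cn n →L[ℝ] Cn n →L[ℝ] ℝ) : Prop
    extends LocalSpecial U G Γ η c where
  right_inv : ∀ z, P (Q z) = z
  proj_field : ∀ p ∈ U, P (η p) = 0
  ker_proj : ∀ p ∈ U, ∀ u, P u = 0 → ∃ a : ℂ, u = a • η p
  isHerm_proj : ∀ p ∈ U, IsHermBilin (G' (P p))
  proj_metric : ∀ p ∈ U, ∀ u v, hermOf (G' (P p)) (P u) (P v)
    = Real.sign (locPot G η c p) * locDdbarLog G η c p u v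

namespace LocalProjection

variable {U : Set (Cn m)} {G : Cn m → Cn m →L[ℝ] Cn m →L[ℝ] ℝ}
    {Γ : Cn m → Cn m →L[ℝ] Cn m →L[ℝ] Cn m} {η : Cn m → Cn m} {c : ℝ}
    {P : Cn m →L[ℂ] Cn n} {Q : Cn n →L[ℂ] Cn m} {G' : Cn n → Cn n →L[ℝ] Cn n →L[ℝ] ℝ}
    (S : LocalProjection U G Γ η c P Q G')
include S

theorem sign_mul_self {p : Cn m} (hp : p ∈ U) :
    (Real.sign (locPot G η c p) : ℂ) * Real.sign (locPot G η c p) = 1 := by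
  rcases Real.sign_apply_eq_of_ne_zero _ (S.locPot_ne hp) with h | h <;> simp [h]

theorem proj_metric' {p : Cn m} (hp : p ∈ U) (u v : Cn n) :
    hermOf (G' (P p)) u v = Real.sign (locPot G η c p) * locDdbarLog G η c p (Q u) (Q v) := by
  rw [← S.proj_metric p hp, S.right_inv, S.right_inv]

/-- If `u` is null, then `h / K = ω ⊗ ω̄` on `Q u`, which says that `Q u - (ω(Q u) / c) η` is null
for `h`. Hence `Q u` is a multiple of `η`, and `u = P (Q u) = 0`. -/
theorem proj_nondeg {p : Cn m} (hp : p ∈ U) (u : Cn n) (hu : ∀ v, G' (P p) u v = 0) : u = 0 := by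
  have hG := S.isHerm p hp
  have hG' := S.isHerm_proj p hp
  have hK : (locPot G η c p : ℂ) ≠ 0 := by exact_mod_cast S.locPot_ne hp
  have hc : (c : ℂ) ≠ 0 := by exact_mod_cast S.c_ne
  have h1 : ∀ w, locDdbarLog G η c p (Q u) w = 0 := by
    intro w
    have := S.proj_metric p hp (Q u) w
    rw [S.right_inv, hG'.hermOf_eq_right, hu, hu] at this
    have h2 : (Real.sign (locPot G η c p) : ℂ) ≠ 0 := left_ne_zero_of_mul_eq_one
      (S.sign_mul_self hp)
    simpa [h2] using this.symm
  have h2 : ∀ w, hermOf (G p) (Q u - (locOmega G η c p (Q u) / c) • η p) w = 0 := by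
    intro w
    have := h1 w
    rw [locDdbarLog, sub_eq_zero] at this
    rw [hermOf_sub_left, hermOf_smul_left]
    rw [div_eq_iff hK] at this
    rw [this]
    nth_rewrite 2 [locOmega]
    rw [map_div₀, hG.conj_hermOf, map_mul, Complex.conj_ofReal, Complex.conj_ofReal]
    field_simp
    ring
  have h3 := S.nondeg p hp _ fun w => by
    have := congrArg Complex.re (h2 w)
    rw [hG.re_hermOf, Complex.zero_re] at this
    linarith
  rw [sub_eq_zero] at h3
  rw [← S.right_inv u, h3, map_smul, S.proj_field p hp, smul_zero]

/-! ### Smooth functions on the base -/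

/-- The affine section of `P` through `p`, along which functions on the base are compared with
functions above. -/
theorem hasFDerivAt_lift (p : Cn m) :
    HasFDerivAt (fun z => p + Q (z - P p)) (Q.restrictScalars ℝ) (P p) := by
  have h := HasFDerivAt.comp (g := fun z => (Q.restrictScalars ℝ) z) (P p)
    (Q.restrictScalars ℝ).hasFDerivAt ((hasFDerivAt_id (𝕜 := ℝ) (P p)).sub_const (P p))
  exact (h.const_add p).congr_fderiv (by ext; rfl)

theorem lift_mem_nhds {p : Cn m} (hp : p ∈ U) : ∀ᶠ z in 𝓝 (P p), p + Q (z - P p) ∈ U := by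
  have h := (S.hasFDerivAt_lift p).continuousAt
  refine h.eventually ?_
  simpa using S.mem_nhds hp

theorem proj_lift (p : Cn m) (z : Cn n) : P (p + Q (z - P p)) = z := by
  rw [map_add, S.right_inv, add_sub_cancel]

theorem hasFDerivAt_descend {W : Type*} [NormedAddCommGroup W] [NormedSpace ℝ W]
    {f : Cn n → W} {F : Cn m → W} {p : Cn m} (hp : p ∈ U) (h : ∀ q ∈ U, f (P q) = F q)
    (hF : DifferentiableAt ℝ F p) :
    HasFDerivAt f ((fderiv ℝ F p).comp (Q.restrictScalars ℝ)) (P p) := by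
  have hF' : HasFDerivAt F (fderiv ℝ F p) (p + Q (P p - P p)) := by
    simpa using hF.hasFDerivAt
  refine (hF'.comp (P p) (S.hasFDerivAt_lift p)).congr_of_eventuallyEq ?_
  filter_upwards [S.lift_mem_nhds hp] with z hz
  rw [Function.comp_apply, ← h _ hz, S.proj_lift]

theorem locDdbarLog_smooth (u v : Cn m) :
    ContDiffOn ℝ ∞ (fun q => locDdbarLog G η c q u v) U := by
  have hK : ContDiffOn ℝ ∞ (fun q => ((locPot G η c q : ℝ) : ℂ)) U :=
    Complex.ofRealCLM.contDiff.comp_contDiffOn S.locPot_smooth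
  have hK0 : ∀ q ∈ U, ((locPot G η c q : ℝ) : ℂ) ≠ 0 := fun q hq => by
    exact_mod_cast S.locPot_ne hq
  have hω : ∀ u, ContDiffOn ℝ ∞ (fun q => locOmega G η c q u) U := fun u => by
    simp only [locOmega, div_eq_mul_inv]
    exact (S.metric_smooth.hermOf contDiffOn_const S.metric_field_smooth).mul
      ((contDiffOn_const.mul hK).inv fun q hq =>
        mul_ne_zero (by exact_mod_cast S.c_ne) (hK0 q hq))
  simp only [locDdbarLog, div_eq_mul_inv]
  exact ((S.metric_smooth.hermOf contDiffOn_const contDiffOn_const).mul (hK.inv hK0)).sub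
    ((hω u).mul (Complex.conjCLE.contDiff.comp_contDiffOn (hω v)))

/-- An invariant form is twice the real part of its (1,1) component. Along the affine section that
component is a smooth function times the sign of `K`, which is locally constant. -/
theorem proj_metric_smooth {p : Cn m} (hp : p ∈ U) : ContDiffAt ℝ ∞ G' (P p) := by
  have hV : IsOpen ((fun q => p + Q (q - P p)) ⁻¹' U) := S.isOpen.preimage (by fun_prop)
  have hpV : P p ∈ (fun q => p + Q (q - P p)) ⁻¹' U := by simpa using hp
  have hlift : ContDiff ℝ ∞ fun q => p + Q (q - P p) :=
    contDiff_const.add ((Q.restrictScalars ℝ).contDiff.comp (contDiff_id.sub contDiff_const))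
  have key : ∀ u v, ContDiffAt ℝ ∞ (fun z => G' z u v) (P p) := by
    intro u v
    have h1 : ContDiffAt ℝ ∞ (fun z => 2 * (Real.sign (locPot G η c p)
        * (locDdbarLog G η c (p + Q (z - P p)) (Q u) (Q v)).re)) (P p) := by
      refine contDiffAt_const.mul (contDiffAt_const.mul ?_)
      have h2 : ContDiffAt ℝ ∞ (fun z => locDdbarLog G η c (p + Q (z - P p)) (Q u) (Q v)) (P p) :=
        (((S.locDdbarLog_smooth (Q u) (Q v)).comp hlift.contDiffOn fun z hz => hz).contDiffAt
          (hV.mem_nhds hpV))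
      exact Complex.reCLM.contDiff.contDiffAt.comp (P p) h2
    refine h1.congr_of_eventuallyEq ?_
    have hs : ∀ᶠ z in 𝓝 (P p), Real.sign (locPot G η c (p + Q (z - P p)))
        = Real.sign (locPot G η c p) := by
      have h0 : ∀ᶠ q in 𝓝 (p + Q (P p - P p)), Real.sign (locPot G η c q)
          = Real.sign (locPot G η c p) := by
        simpa using sign_eventually_const (S.locPot_diff hp).continuousAt (S.locPot_ne hp)
      exact (S.hasFDerivAt_lift p).continuousAt.eventually h0
    filter_upwards [S.lift_mem_nhds hp, hs] with z hz hz'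
    have h2 := S.proj_metric' hz u v
    have h3 := S.isHerm_proj _ hz
    rw [S.proj_lift, hz'] at h2
    rw [S.proj_lift] at h3
    have := congrArg Complex.re h2
    rw [h3.re_hermOf, Complex.re_ofReal_mul] at this
    linarith
  have key2 : ∀ u, ContDiffAt ℝ ∞ (fun z => G' z u) (P p) := fun u => contDiffAt_clm_apply_iff.2 fun v => key u v
  exact contDiffAt_clm_apply_iff.2 key2

end LocalProjection

end LocalGeometry

/-! ### The Levi-Civita connection of the projected metric -/

section LocalGeometry

variable {m n : ℕ}

namespace LocalSpecial

variable {U : Set (Cn m)} {G : Cn m → Cn m →L[ℝ] Cn m →L[ℝ] ℝ}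
    {Γ : Cn m → Cn m →L[ℝ] Cn m →L[ℝ] Cn m} {η : Cn m → Cn m} {c : ℝ}
    (S : LocalSpecial U G Γ η c)
include S

/-- Differentiating `1 / K` and `ω` produces terms that are absorbed by the change of `B` to `B - ω
⊗ id - id ⊗ ω`. So `∂∂̄ log |K|` is parallel for this symmetric connection already on `N`, before
projection. -/
theorem fderiv_locDdbarLog {p : Cn m} (hp : p ∈ U) (u v s : Cn m) :
    DifferentiableAt ℝ (fun q => locDdbarLog G η c q u v) p ∧
    fderiv ℝ (fun q => locDdbarLog G η c q u v) p s
      = locDdbarLog G η c p (holPart (Γ p) s u - locOmega G η c p s • u - locOmega G η c p u • s) v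
        + locDdbarLog G η c p u
            (holPart (Γ p) s v - locOmega G η c p s • v - locOmega G η c p v • s) := by
  have hG := S.isHerm p hp
  have hK : (locPot G η c p : ℂ) ≠ 0 := by exact_mod_cast S.locPot_ne hp
  have hc : (c : ℂ) ≠ 0 := by exact_mod_cast S.c_ne
  have h1 := fderiv_hermOf (S.metric_diff hp) (differentiableAt_const u) (differentiableAt_const v)
  have h2 : HasFDerivAt (fun q => ((locPot G η c q : ℝ) : ℂ))
      (Complex.ofRealCLM.comp (fderiv ℝ (locPot G η c) p)) p :=
    Complex.ofRealCLM.hasFDerivAt.comp p (S.locPot_diff hp).hasFDerivAt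
  have h3 : HasFDerivAt (fun q => ((locPot G η c q : ℂ))⁻¹) _ p :=
    ((hasDerivAt_inv hK).hasFDerivAt.restrictScalars ℝ).comp p h2
  have hu := S.fderiv_locOmega hp u
  have hv := S.fderiv_locOmega hp v
  have h4 : HasFDerivAt (fun q => (starRingEnd ℂ) (locOmega G η c q v)) _ p :=
    (Complex.conjCLE : ℂ →L[ℝ] ℂ).hasFDerivAt.comp p hv.1.hasFDerivAt
  have h5 : HasFDerivAt (fun q => locDdbarLog G η c q u v) _ p :=
    (h1.1.hasFDerivAt.fun_mul h3).sub (hu.1.hasFDerivAt.fun_mul h4)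
  refine ⟨h5.differentiableAt, ?_⟩
  have h0 := hermOf_smul_left (G p) 0 0 v
  have h0' := hermOf_smul_right (G p) 0 u 0
  simp only [zero_smul, zero_mul, map_zero] at h0 h0'
  have hKt : ((fderiv ℝ (locPot G η c) p s : ℝ) : ℂ)
      = (hermOf (G p) s (η p) + hermOf (G p) (η p) s) / c := by
    rw [S.fderiv_locPot hp, hG.hermOf_eq_left, hG.hermOf_eq_right, hG.symm (η p) s,
      hG.symm (η p) (Complex.I • s)]
    push_cast
    ring
  rw [h5.fderiv]
  simp only [add_apply, sub_apply, smul_apply, h1.2, S.hermOf_fderiv_metric hp,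
    fderiv_fun_const, Pi.zero_apply, zero_apply, h0, h0', add_zero, smul_eq_mul,
    ContinuousLinearMap.comp_apply, Complex.ofRealCLM_apply, hKt,
    ContinuousLinearMap.coe_restrictScalars', ContinuousLinearMap.toSpanSingleton_apply,
    hu.2, hv.2, ContinuousLinearEquiv.coe_coe, Complex.conjCLE_apply]
  simp only [locDdbarLog, locOmega, map_div₀, map_mul, map_sub, map_add, Complex.conj_ofReal,
    hG.conj_hermOf, sub_eq_add_neg, ← neg_smul, hermOf_add_left, hermOf_add_right,
    hermOf_smul_left, hermOf_smul_right, map_neg]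
  field_simp
  ring

/-- The antilinear part of the derivative of the connection form. -/
theorem fderiv_locOmega_anti {p : Cn m} (hp : p ∈ U) (v t : Cn m) :
    fderiv ℝ (fun q => locOmega G η c q v) p t
      + Complex.I * fderiv ℝ (fun q => locOmega G η c q v) p (Complex.I • t)
      = 2 * locDdbarLog G η c p v t := by
  have h := (S.fderiv_locOmega hp v).2
  rw [h, h, holPart_I_left, locOmega_smul, locOmega_smul]
  simp only [locDdbarLog, hermOf_smul_right, locOmega_smul, map_mul, Complex.conj_I]
  linear_combination (locOmega G η c p (holPart (Γ p) t v)
    - locOmega G η c p v * locOmega G η c p t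
    - hermOf (G p) v t / locPot G η c p
    + locOmega G η c p v * (starRingEnd ℂ) (locOmega G η c p t)) * Complex.I_sq

end LocalSpecial

/-- The connection coefficients of the projected metric in an adapted chart. -/
def locBeta (G : Cn m → Cn m →L[ℝ] Cn m →L[ℝ] ℝ) (Γ : Cn m → Cn m →L[ℝ] Cn m →L[ℝ] Cn m)
    (η : Cn m → Cn m) (c : ℝ) (P : Cn m →L[ℂ] Cn n) (Q : Cn n →L[ℂ] Cn m) (p : Cn m)
    (u v : Cn n) : Cn n :=
  P (holPart (Γ p) (Q u) (Q v)) - locOmega G η c p (Q u) • v - locOmega G η c p (Q v) • u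

namespace LocalProjection

variable {U : Set (Cn m)} {G : Cn m → Cn m →L[ℝ] Cn m →L[ℝ] ℝ}
    {Γ : Cn m → Cn m →L[ℝ] Cn m →L[ℝ] Cn m} {η : Cn m → Cn m} {c : ℝ}
    {P : Cn m →L[ℂ] Cn n} {Q : Cn n →L[ℂ] Cn m} {G' : Cn n → Cn n →L[ℝ] Cn n →L[ℝ] ℝ}
    (S : LocalProjection U G Γ η c P Q G')
include S

theorem locBeta_symm {p : Cn m} (hp : p ∈ U) (u v : Cn n) :
    locBeta G Γ η c P Q p u v = locBeta G Γ η c P Q p v u := by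
  rw [locBeta, locBeta, (S.isSpecial p hp).holPart_symm]
  abel

theorem locBeta_smul_left {p : Cn m} (hp : p ∈ U) (z : ℂ) (u v : Cn n) :
    locBeta G Γ η c P Q p (z • u) v = z • locBeta G Γ η c P Q p u v := by
  simp only [locBeta, map_smul, (S.isSpecial p hp).holPart_smul_left, locOmega_smul]
  module

theorem locBeta_smul_right {p : Cn m} (hp : p ∈ U) (z : ℂ) (u v : Cn n) :
    locBeta G Γ η c P Q p u (z • v) = z • locBeta G Γ η c P Q p u v := by
  rw [S.locBeta_symm hp, S.locBeta_smul_left hp, S.locBeta_symm hp]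

theorem proj_metric_diff {p : Cn m} (hp : p ∈ U) : DifferentiableAt ℝ G' (P p) :=
  (S.proj_metric_smooth hp).differentiableAt (by simp)

/-- The projected metric is parallel for `locBeta`. -/
theorem fderiv_proj_metric {p : Cn m} (hp : p ∈ U) (t u v : Cn n) :
    fderiv ℝ G' (P p) t u v = G' (P p) (locBeta G Γ η c P Q p t u) v
      + G' (P p) u (locBeta G Γ η c P Q p t v) := by
  have hG' := S.isHerm_proj p hp
  have hs := sign_eventually_const (S.locPot_diff hp).continuousAt (S.locPot_ne hp)
  have hL := S.fderiv_locDdbarLog hp (Q u) (Q v) (Q t)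
  -- the derivative of `q ↦ G' (P q) u v`
  have h1 : (fun q => G' (P q) u v) =ᶠ[𝓝 p] fun q => 2 * Real.sign (locPot G η c p)
      * Complex.reCLM (locDdbarLog G η c q (Q u) (Q v)) := by
    filter_upwards [S.mem_nhds hp, hs] with q hq hq'
    have h2 := congrArg Complex.re (S.proj_metric' hq u v)
    rw [(S.isHerm_proj q hq).re_hermOf, Complex.re_ofReal_mul, hq'] at h2
    simp only [Complex.reCLM_apply]
    linarith
  have h3 : HasFDerivAt (fun q => G' (P q) u v) _ p :=
    ((Complex.reCLM.hasFDerivAt.comp p hL.1.hasFDerivAt).const_mul _).congr_of_eventuallyEq h1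
  have h4 := S.hasFDerivAt_descend hp (f := fun z => G' z u v) (F := fun q => G' (P q) u v)
    (fun q _ => rfl) h3.differentiableAt
  have hβ : ∀ w, P (holPart (Γ p) (Q t) (Q w) - locOmega G η c p (Q t) • Q w
      - locOmega G η c p (Q w) • Q t) = locBeta G Γ η c P Q p t w := fun w => by
    simp only [locBeta, map_sub, map_smul, S.right_inv]
  rw [← fderiv_bilin_const (S.proj_metric_diff hp), h4.fderiv, h3.fderiv]
  simp only [smul_apply, ContinuousLinearMap.comp_apply, smul_eq_mul,
    ContinuousLinearMap.coe_restrictScalars', hL.2, map_add, Complex.reCLM_apply]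
  have h5 := congrArg Complex.re (S.proj_metric p hp (holPart (Γ p) (Q t) (Q u)
    - locOmega G η c p (Q t) • Q u - locOmega G η c p (Q u) • Q t) (Q v))
  have h6 := congrArg Complex.re (S.proj_metric p hp (Q u) (holPart (Γ p) (Q t) (Q v)
    - locOmega G η c p (Q t) • Q v - locOmega G η c p (Q v) • Q t))
  rw [hβ, S.right_inv, hG'.re_hermOf, Complex.re_ofReal_mul] at h5 h6
  linarith

/-- The projected metric has a closed fundamental form. -/
theorem proj_closed {p : Cn m} (hp : p ∈ U) (u v w : Cn n) :
    fderiv ℝ G' (P p) u v (Complex.I • w) + fderiv ℝ G' (P p) v w (Complex.I • u)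
      + fderiv ℝ G' (P p) w u (Complex.I • v) = 0 := by
  have hG' := S.isHerm_proj p hp
  have key : ∀ a b, G' (P p) a (Complex.I • b) = -G' (P p) b (Complex.I • a) := fun a b => by
    rw [hG'.symm, hG'.I_left]
  simp only [S.fderiv_proj_metric hp, S.locBeta_smul_right hp, S.locBeta_symm hp v u,
    S.locBeta_symm hp w u, S.locBeta_symm hp w v]
  have h1 := key (locBeta G Γ η c P Q p u v) w
  have h2 := key (locBeta G Γ η c P Q p v w) u
  have h3 := key (locBeta G Γ η c P Q p u w) v
  linarith

/-- The Levi-Civita connection of the projected metric. -/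
theorem christoffel_proj {p : Cn m} (hp : p ∈ U) (u v : Cn n) :
    christoffel G' (P p) u v = locBeta G Γ η c P Q p u v := by
  have hG' := S.isHerm_proj p hp
  -- `inverse` is zero on maps that are not invertible, so nondegeneracy has to be turned into
  -- invertibility, by equality of dimensions.
  have hinj : Function.Injective (G' (P p)) := by
    rw [injective_iff_map_eq_zero]
    intro u hu
    exact S.proj_nondeg hp u fun v => by rw [hu]; rfl
  have hfin : Module.finrank ℝ (Cn n) = Module.finrank ℝ (Cn n →L[ℝ] ℝ) := by
    rw [← (LinearMap.toContinuousLinearMap (𝕜 := ℝ) (E := Cn n) (F' := ℝ)).finrank_eq]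
    exact (Subspace.dual_finrank_eq (K := ℝ) (V := Cn n)).symm
  have hinv : (G' (P p)).IsInvertible :=
    ⟨(LinearEquiv.ofInjectiveOfFinrankEq (G' (P p)).toLinearMap hinj hfin).toContinuousLinearEquiv,
      by ext; rfl⟩
  -- Koszul's argument: `locBeta` is symmetric and preserves the metric, and these two properties
  -- determine it.
  have h : (1 / 2 : ℝ) • (fderiv ℝ G' (P p) u v + fderiv ℝ G' (P p) v u
      - ((fderiv ℝ G' (P p)).flip u).flip v) = G' (P p) (locBeta G Γ η c P Q p u v) := by
    ext w
    simp only [smul_apply, add_apply, sub_apply, ContinuousLinearMap.flip_apply,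
      S.fderiv_proj_metric hp, S.locBeta_symm hp v u, S.locBeta_symm hp w u,
      S.locBeta_symm hp w v, smul_eq_mul]
    rw [hG'.symm (locBeta G Γ η c P Q p u w) v]
    ring
  rw [christoffel, h, hinv.inverse_apply_self]

end LocalProjection

end LocalGeometry

/-! ### Curvature of the projected metric -/

section LocalGeometry

variable {m n : ℕ}

namespace LocalSpecial

variable {U : Set (Cn m)} {G : Cn m → Cn m →L[ℝ] Cn m →L[ℝ] ℝ}
    {Γ : Cn m → Cn m →L[ℝ] Cn m →L[ℝ] Cn m} {η : Cn m → Cn m} {c : ℝ}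
    (S : LocalSpecial U G Γ η c)
include S

/-- The values of `C` are horizontal: self-adjointness moves `C` onto `η`, where it vanishes. -/
theorem locOmega_antiPart {p : Cn m} (hp : p ∈ U) (u v : Cn m) :
    locOmega G η c p (antiPart (Γ p) u v) = 0 := by
  rw [locOmega, (S.isHerm p hp).hermOf_eq_right, S.metric_antiPart hp, S.metric_antiPart hp,
    (S.isSpecial p hp).antiPart_I_right, S.antiPart_field hp]
  simp

theorem locCubic_eq_locDdbarLog {p : Cn m} (hp : p ∈ U) (u v w : Cn m) :
    locCubic G Γ p u v w = -2 * Complex.I * locPot G η c p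
      * locDdbarLog G η c p u (antiPart (Γ p) v w) := by
  have hK : (locPot G η c p : ℂ) ≠ 0 := by exact_mod_cast S.locPot_ne hp
  rw [locCubic, locDdbarLog, S.locOmega_antiPart hp, map_zero, mul_zero, sub_zero]
  field_simp

end LocalSpecial

theorem coordVec_apply (i j : Fin n) : (coordVec i : Cn n) j = if j = i then 1 else 0 := by
  exact Pi.single_apply i 1 j

theorem eq_sum_coordVec (u : Cn n) : u = ∑ i, u i • (coordVec i : Cn n) := by
  ext j
  simp [Finset.sum_apply, coordVec_apply]

theorem hermOf_sum_left (g : Cn n →L[ℝ] Cn n →L[ℝ] ℝ) (u v : Cn n) :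
    hermOf g u v = ∑ i, u i * hermOf g (coordVec i) v := by
  let L : Cn n →ₗ[ℂ] ℂ :=
    { toFun := fun u => hermOf g u v
      map_add' := fun a b => hermOf_add_left g a b v
      map_smul' := fun a b => hermOf_smul_left g a b v }
  change L u = ∑ i, u i * L (coordVec i)
  conv_lhs => rw [eq_sum_coordVec u]
  simp

theorem hermOf_sum_right (g : Cn n →L[ℝ] Cn n →L[ℝ] ℝ) (u v : Cn n) :
    hermOf g u v = ∑ i, (starRingEnd ℂ) (v i) * hermOf g u (coordVec i) := by
  let L : Cn n →ₛₗ[starRingEnd ℂ] ℂ :=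
    { toFun := fun v => hermOf g u v
      map_add' := fun a b => hermOf_add_right g u a b
      map_smul' := fun a b => hermOf_smul_right g a u b }
  change L v = ∑ i, (starRingEnd ℂ) (v i) * L (coordVec i)
  conv_lhs => rw [eq_sum_coordVec v]
  simp

namespace LocalProjection

variable {U : Set (Cn m)} {G : Cn m → Cn m →L[ℝ] Cn m →L[ℝ] ℝ}
    {Γ : Cn m → Cn m →L[ℝ] Cn m →L[ℝ] Cn m} {η : Cn m → Cn m} {c : ℝ}
    {P : Cn m →L[ℂ] Cn n} {Q : Cn n →L[ℂ] Cn m} {G' : Cn n → Cn n →L[ℝ] Cn n →L[ℝ] ℝ}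
    (S : LocalProjection U G Γ η c P Q G')
include S

theorem fderiv_christoffel_proj {p : Cn m} (hp : p ∈ U) (t u v : Cn n) :
    fderiv ℝ (fun z => christoffel G' z u v) (P p) t
      = P (holPart (fderiv ℝ Γ p (Q t)) (Q u) (Q v))
        - fderiv ℝ (fun q => locOmega G η c q (Q u)) p (Q t) • v
        - fderiv ℝ (fun q => locOmega G η c q (Q v)) p (Q t) • u := by
  have h1 := hasFDerivAt_holPart (S.conn_diff hp) (Q u) (Q v)
  have hu := (S.fderiv_locOmega hp (Q u)).1
  have hv := (S.fderiv_locOmega hp (Q v)).1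
  have h2 : HasFDerivAt (fun q => locBeta G Γ η c P Q q u v) _ p :=
    (((P.restrictScalars ℝ).hasFDerivAt.comp p h1.1.hasFDerivAt).sub
      (hu.hasFDerivAt.smul_const v)).sub (hv.hasFDerivAt.smul_const u)
  have h3 := S.hasFDerivAt_descend hp (f := fun z => christoffel G' z u v)
    (fun q hq => S.christoffel_proj hq u v) h2.differentiableAt
  rw [h3.fderiv, h2.fderiv]
  simp [h1.2]

/-- The antilinear part of the derivative of the Levi-Civita connection. -/
theorem fderiv_christoffel_anti {p : Cn m} (hp : p ∈ U) (t u v : Cn n) :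
    fderiv ℝ (fun z => christoffel G' z u v) (P p) t
      + Complex.I • fderiv ℝ (fun z => christoffel G' z u v) (P p) (Complex.I • t)
      = -((2 : ℂ) • (P (antiPart (Γ p) (Q t) (antiPart (Γ p) (Q u) (Q v)))
        + (Real.sign (locPot G η c p) * hermOf (G' (P p)) u t) • v
        + (Real.sign (locPot G η c p) * hermOf (G' (P p)) v t) • u)) := by
  have h1 := congrArg P (S.fderiv_holPart_anti hp (Q u) (Q t) (Q v))
  simp only [map_add, map_neg, map_smul] at h1
  have h2 := S.fderiv_locOmega_anti hp (Q u) (Q t)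
  have h3 := S.fderiv_locOmega_anti hp (Q v) (Q t)
  -- The projected metric is the sign of `K` times `∂∂̄ log |K|`; as the sign squares to one, `∂∂̄
  -- log |K|` is the sign times the metric.
  simp only [S.fderiv_christoffel_proj hp, S.proj_metric' hp, ← mul_assoc, S.sign_mul_self hp,
    one_mul, map_smul]
  linear_combination (norm := module) h1 - h2 • v - h3 • u

/-- The Christoffel symbols are complex bilinear, so they vanish whenever one argument is of type
(0,1). Of the four terms of the curvature only `-∂_{l̄} Γ(∂_k, ∂_i)` is left, and
`fderiv_christoffel_anti` evaluates it. -/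
theorem riemannComp_proj {p : Cn m} (hp : p ∈ U) (j i k l : Fin n) :
    riemannComp G' (P p) j i k l
      = P (antiPart (Γ p) (Q (coordVec l)) (antiPart (Γ p) (Q (coordVec k)) (Q (coordVec i)))) j
        + Real.sign (locPot G η c p) * (if j = i then 1 else 0) * metricComp G' (P p) k l
        + Real.sign (locPot G η c p) * (if j = k then 1 else 0) * metricComp G' (P p) i l := by
  -- Complex bilinearity is needed on a neighbourhood of `P p`, since it is differentiated below.
  have hchr : ∀ z ∈ (fun q => p + Q (q - P p)) ⁻¹' U, ∀ a b,
      christoffel G' z (Complex.I • a) b = Complex.I • christoffel G' z a b ∧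
      christoffel G' z a (Complex.I • b) = Complex.I • christoffel G' z a b := by
    intro z hz a b
    have h := fun a b => S.christoffel_proj hz a b
    rw [S.proj_lift] at h
    exact ⟨by rw [h, h, S.locBeta_smul_left hz], by rw [h, h, S.locBeta_smul_right hz]⟩
  have hp' : P p ∈ (fun q => p + Q (q - P p)) ⁻¹' U := by simpa using hp
  have hI : ∀ (f f' : Cn n → Cn n), (∀ z ∈ (fun q => p + Q (q - P p)) ⁻¹' U,
      f' z = Complex.I • f z) → DifferentiableAt ℝ f (P p) → ∀ t,
      fderiv ℝ f' (P p) t = Complex.I • fderiv ℝ f (P p) t := by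
    intro f f' h hf t
    have h1 : f' =ᶠ[𝓝 (P p)] fun z => Complex.I • f z := by
      filter_upwards [S.lift_mem_nhds hp] with z hz using h z hz
    rw [h1.fderiv_eq]
    erw [(hf.hasFDerivAt.const_smul Complex.I).fderiv]
    rfl
  have hd : ∀ u v, DifferentiableAt ℝ (fun z => christoffel G' z u v) (P p) := by
    intro u v
    have h1 := hasFDerivAt_holPart (S.conn_diff hp) (Q u) (Q v)
    have hu := (S.fderiv_locOmega hp (Q u)).1
    have hv := (S.fderiv_locOmega hp (Q v)).1
    have h2 : HasFDerivAt (fun q => locBeta G Γ η c P Q q u v) _ p :=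
      (((P.restrictScalars ℝ).hasFDerivAt.comp p h1.1.hasFDerivAt).sub
        (hu.hasFDerivAt.smul_const v)).sub (hv.hasFDerivAt.smul_const u)
    exact (S.hasFDerivAt_descend hp (f := fun z => christoffel G' z u v)
      (fun q hq => S.christoffel_proj hq u v) h2.differentiableAt).differentiableAt
  have hl : ∀ a b t, fderiv ℝ (fun z => christoffel G' z (Complex.I • a) b) (P p) t
      = Complex.I • fderiv ℝ (fun z => christoffel G' z a b) (P p) t := fun a b t =>
    hI _ _ (fun z hz => (hchr z hz a b).1) (hd a b) t
  have hr : ∀ a b t, fderiv ℝ (fun z => christoffel G' z a (Complex.I • b)) (P p) t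
      = Complex.I • fderiv ℝ (fun z => christoffel G' z a b) (P p) t := fun a b t =>
    hI _ _ (fun z hz => (hchr z hz a b).2) (hd a b) t
  have hc1 := fun a b => (hchr _ hp' a b).1
  have hc2 := fun a b => (hchr _ hp' a b).2
  have key := congrFun (S.fderiv_christoffel_anti hp (coordVec l) (coordVec k) (coordVec i)) j
  simp only [Pi.add_apply, Pi.smul_apply, Pi.neg_apply, smul_eq_mul, coordVec_apply] at key
  simp only [riemannComp, extHol, extAnti, riemann, multI_apply, hl, hr, hc1, hc2,
    Pi.add_apply, Pi.sub_apply, Pi.smul_apply, smul_eq_mul]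
  change _ = _ + _ * _ * hermOf (G' (P p)) (coordVec k) (coordVec l)
    + _ * _ * hermOf (G' (P p)) (coordVec i) (coordVec l)
  grind [Complex.I_sq]

/-- The matrix inverse is a true inverse only for invertible matrices; nondegeneracy of the
projected metric supplies this. -/
theorem isUnit_metricComp {p : Cn m} (hp : p ∈ U) : IsUnit (metricComp G' (P p)) := by
  rw [← Matrix.vecMul_injective_iff_isUnit]
  intro u v huv
  rw [← sub_eq_zero] at huv ⊢
  change Matrix.vecMul u (metricComp G' (P p)) - Matrix.vecMul v (metricComp G' (P p)) = 0 at huv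
  rw [← Matrix.sub_vecMul] at huv
  refine S.proj_nondeg hp _ fun w => ?_
  have h : hermOf (G' (P p)) (u - v) w = 0 := by
    rw [hermOf_sum_right]
    refine Finset.sum_eq_zero fun i _ => ?_
    have := congrFun huv i
    rw [hermOf_sum_left]
    rw [Matrix.vecMul, dotProduct] at this
    change _ * ∑ j, (u - v) j * metricComp G' (P p) j i = 0
    rw [this, Pi.zero_apply, mul_zero]
  have h2 := congrArg Complex.re h
  rw [(S.isHerm_proj p hp).re_hermOf, Complex.zero_re] at h2
  linarith

theorem sum_invMetricComp_left {p : Cn m} (hp : p ∈ U) (j : Fin n) (u : Cn n) :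
    ∑ j', invMetricComp G' (P p) j j' * hermOf (G' (P p)) u (coordVec j') = u j := by
  have hM := (Matrix.isUnit_iff_isUnit_det _).1 (S.isUnit_metricComp hp)
  have h := congrFun (Matrix.vecMul_vecMul u (metricComp G' (P p)) (metricComp G' (P p))⁻¹) j
  rw [Matrix.mul_nonsing_inv _ hM, Matrix.vecMul_one] at h
  rw [← h, Matrix.vecMul, dotProduct]
  refine Finset.sum_congr rfl fun j' _ => ?_
  rw [mul_comm, hermOf_sum_left]
  rfl

theorem sum_invMetricComp_right {p : Cn m} (hp : p ∈ U) (j : Fin n) (u : Cn n) :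
    ∑ j', invMetricComp G' (P p) j' j * hermOf (G' (P p)) (coordVec j') u
      = (starRingEnd ℂ) (u j) := by
  have hM := (Matrix.isUnit_iff_isUnit_det _).1 (S.isUnit_metricComp hp)
  have h := congrFun (Matrix.mulVec_mulVec (star u) (metricComp G' (P p))⁻¹ (metricComp G' (P p))) j
  rw [Matrix.nonsing_inv_mul _ hM, Matrix.one_mulVec] at h
  change _ = star u j
  rw [← h, Matrix.mulVec, dotProduct]
  refine Finset.sum_congr rfl fun j' _ => ?_
  rw [hermOf_sum_right, Matrix.mulVec, dotProduct]
  congr 1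
  refine Finset.sum_congr rfl fun j' _ => ?_
  rw [mul_comm]
  rfl

/-- The values of `C` are horizontal, so `h` may be replaced by `K ∂∂̄ log |K|`, that is, by `K`
times the sign of `K` times the projected metric. -/
theorem locCubic_lift {p : Cn m} (hp : p ∈ U) (u : Cn n) (v w : Cn m) :
    locCubic G Γ p (Q u) v w = -2 * Complex.I * (Real.sign (locPot G η c p) * locPot G η c p)
      * hermOf (G' (P p)) u (P (antiPart (Γ p) v w)) := by
  have h := S.proj_metric p hp (Q u) (antiPart (Γ p) v w)
  rw [S.right_inv] at h
  rw [S.locCubic_eq_locDdbarLog hp, h]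
  linear_combination (2 * Complex.I * locPot G η c p
      * locDdbarLog G η c p (Q u) (antiPart (Γ p) v w)) * S.sign_mul_self hp

/-- `Q (P u)` and `u` differ by a multiple of `η`, which the cubic form annihilates. -/
theorem locCubic_lift_proj {p : Cn m} (hp : p ∈ U) (u v w : Cn m) :
    locCubic G Γ p (Q (P u)) v w = locCubic G Γ p u v w := by
  obtain ⟨a, ha⟩ := S.ker_proj p hp (Q (P u) - u) (by rw [map_sub, S.right_inv, sub_self])
  rw [sub_eq_iff_eq_add'] at ha
  rw [ha, locCubic_add_left, locCubic_smul_left, S.locCubic_field_left hp, mul_zero, add_zero]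

theorem locCubic_sum {p : Cn m} (u : Cn n) (v w : Cn m) :
    locCubic G Γ p (Q u) v w = ∑ i, u i * locCubic G Γ p (Q (coordVec i)) v w := by
  let L : Cn m →ₗ[ℂ] ℂ :=
    { toFun := fun u => locCubic G Γ p u v w
      map_add' := fun a b => locCubic_add_left G Γ p a b v w
      map_smul' := fun a b => locCubic_smul_left G Γ a p b v w }
  change L (Q u) = ∑ i, u i * L (Q (coordVec i))
  conv_lhs => rw [eq_sum_coordVec u]
  simp

/-- The curvature of the projected metric in terms of the cubic form. -/
theorem riemannComp_eq {p : Cn m} (hp : p ∈ U) (j i k l : Fin n) :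
    riemannComp G' (P p) j i k l = 1 / (4 * (locPot G η c p : ℂ) ^ 2) *
        (∑ j' : Fin n, ∑ p' : Fin n, ∑ a : Fin n,
          invMetricComp G' (P p) j j' * invMetricComp G' (P p) p' a
            * locCubic G Γ p (Q (coordVec p')) (Q (coordVec k)) (Q (coordVec i))
            * (starRingEnd ℂ)
              (locCubic G Γ p (Q (coordVec a)) (Q (coordVec j')) (Q (coordVec l))))
        + Real.sign (locPot G η c p) * (if j = i then 1 else 0) * metricComp G' (P p) k l
        + Real.sign (locPot G η c p) * (if j = k then 1 else 0) * metricComp G' (P p) i l := by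
  rw [S.riemannComp_proj hp]
  congr 2
  have hK : (locPot G η c p : ℂ) ≠ 0 := by exact_mod_cast S.locPot_ne hp
  set X := antiPart (Γ p) (Q (coordVec k)) (Q (coordVec i)) with hX
  set ε : ℂ := ((Real.sign (locPot G η c p) : ℝ) : ℂ) with hε
  set κ : ℂ := ((locPot G η c p : ℝ) : ℂ) with hκ
  have hεε : ε * ε = 1 := S.sign_mul_self hp
  have hεc : (starRingEnd ℂ) ε = ε := Complex.conj_ofReal _
  have hκc : (starRingEnd ℂ) κ = κ := Complex.conj_ofReal _
  -- Raising an index of the cubic form recovers the conjugate components of `P X`, where `X = C(k,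
  -- i)`.
  have h1 : ∀ a, ∑ p', invMetricComp G' (P p) p' a
      * locCubic G Γ p (Q (coordVec p')) (Q (coordVec k)) (Q (coordVec i))
      = -2 * Complex.I * (ε * κ) * (starRingEnd ℂ) (P X a) := by
    intro a
    rw [← S.sum_invMetricComp_right hp, Finset.mul_sum]
    refine Finset.sum_congr rfl fun p' _ => ?_
    rw [S.locCubic_lift hp]
    ring
  -- The sum over `a` reassembles `Q (P X)`, which may be replaced by `X`; permuting the arguments
  -- then places `X` inside `C`.
  have h2 : ∀ j', ∑ a, P X a * locCubic G Γ p (Q (coordVec a)) (Q (coordVec j')) (Q (coordVec l))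
      = -2 * Complex.I * (ε * κ)
        * hermOf (G' (P p)) (coordVec j') (P (antiPart (Γ p) (Q (coordVec l)) X)) := by
    intro j'
    rw [← S.locCubic_sum, S.locCubic_lift_proj hp, S.locCubic_symm_left hp,
      S.locCubic_symm_right hp, S.locCubic_lift hp]
  -- The constant is `(-2iεκ)(2iεκ) = 4κ²`, the second factor being conjugated; it cancels the
  -- prefactor `1 / (4K²)`.
  have h3 : ∀ j', ∑ p', ∑ a, invMetricComp G' (P p) j j' * invMetricComp G' (P p) p' a
            * locCubic G Γ p (Q (coordVec p')) (Q (coordVec k)) (Q (coordVec i))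
            * (starRingEnd ℂ)
              (locCubic G Γ p (Q (coordVec a)) (Q (coordVec j')) (Q (coordVec l)))
      = 4 * κ ^ 2 * (invMetricComp G' (P p) j j'
        * hermOf (G' (P p)) (P (antiPart (Γ p) (Q (coordVec l)) X)) (coordVec j')) := by
    intro j'
    have h4 := congrArg (starRingEnd ℂ) (h2 j')
    simp only [map_sum, map_mul, map_neg, map_ofNat, Complex.conj_I, hεc, hκc,
      (S.isHerm_proj p hp).conj_hermOf] at h4
    calc _ = ∑ a, invMetricComp G' (P p) j j' * (∑ p', invMetricComp G' (P p) p' a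
            * locCubic G Γ p (Q (coordVec p')) (Q (coordVec k)) (Q (coordVec i)))
            * (starRingEnd ℂ)
              (locCubic G Γ p (Q (coordVec a)) (Q (coordVec j')) (Q (coordVec l))) := by
          rw [Finset.sum_comm]
          refine Finset.sum_congr rfl fun a _ => ?_
          rw [Finset.mul_sum, Finset.sum_mul]
          exact Finset.sum_congr rfl fun p' _ => by ring
      _ = invMetricComp G' (P p) j j' * (-2 * Complex.I * (ε * κ)) * ∑ a, (starRingEnd ℂ) (P X a)
            * (starRingEnd ℂ)
              (locCubic G Γ p (Q (coordVec a)) (Q (coordVec j')) (Q (coordVec l))) := by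
          rw [Finset.mul_sum]
          exact Finset.sum_congr rfl fun a _ => by rw [h1]; ring
      _ = _ := by
          rw [h4]
          linear_combination (-4 * κ ^ 2 * ε * ε * invMetricComp G' (P p) j j'
            * hermOf (G' (P p)) (P (antiPart (Γ p) (Q (coordVec l)) X)) (coordVec j'))
              * Complex.I_sq + (4 * κ ^ 2 * invMetricComp G' (P p) j j'
            * hermOf (G' (P p)) (P (antiPart (Γ p) (Q (coordVec l)) X)) (coordVec j')) * hεε
  simp only [h3]
  rw [← Finset.mul_sum, S.sum_invMetricComp_left hp]
  field_simp

end LocalProjection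

end LocalGeometry

/-! ### Holomorphic maps as real smooth maps -/

section RestrictScalars

section

variable {E F N M : Type*} [NormedAddCommGroup E] [NormedSpace ℂ E] [NormedSpace ℝ E]
  [IsScalarTower ℝ ℂ E] [NormedAddCommGroup F] [NormedSpace ℂ F] [NormedSpace ℝ F]
  [IsScalarTower ℝ ℂ F] [TopologicalSpace N] [ChartedSpace E N] [TopologicalSpace M]
  [ChartedSpace F M]

theorem ContMDiffAt.real_of_complex {k : ℕ∞ω} {f : N → M} {x : N}
    (h : ContMDiffAt 𝓘(ℂ, E) 𝓘(ℂ, F) k f x) : ContMDiffAt 𝓘(ℝ, E) 𝓘(ℝ, F) k f x :=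
  ⟨h.1, ContDiffWithinAt.restrict_scalars ℝ h.2⟩

theorem HasMFDerivAt.real_of_complex {f : N → M} {x : N} {f' : E →L[ℂ] F}
    (h : HasMFDerivAt 𝓘(ℂ, E) 𝓘(ℂ, F) f x f') :
    HasMFDerivAt 𝓘(ℝ, E) 𝓘(ℝ, F) f x
      (show TangentSpace 𝓘(ℝ, E) x →L[ℝ] TangentSpace 𝓘(ℝ, F) (f x) from
        (f'.restrictScalars ℝ : E →L[ℝ] F)) :=
  ⟨h.1, HasFDerivWithinAt.restrictScalars ℝ h.2⟩

end

variable {m n : ℕ} {N M : Type*} [TopologicalSpace N] [ChartedSpace (Cn m) N]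
  [TopologicalSpace M] [ChartedSpace (Cn n) M]

/-- The real derivative of a holomorphic map commutes with the complex structures. -/
theorem mfderiv_cplxJ {f : N → M} {x : N} (h : MDifferentiableAt 𝓘(ℂ, Cn m) 𝓘(ℂ, Cn n) f x)
    (u : RTangent m x) : mfderiv 𝓘(ℝ, Cn m) 𝓘(ℝ, Cn n) f x (cplxJ m x u)
      = cplxJ n (f x) (mfderiv 𝓘(ℝ, Cn m) 𝓘(ℝ, Cn n) f x u) := by
  let L : Cn m →L[ℂ] Cn n := mfderiv 𝓘(ℂ, Cn m) 𝓘(ℂ, Cn n) f x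
  have h1 := HasMFDerivAt.real_of_complex (f' := L) h.hasMFDerivAt
  rw [h1.mfderiv]
  exact map_smul L Complex.I (show Cn m from u)

end RestrictScalars

theorem mlieBracket_vectorSpace {E : Type*} [NormedAddCommGroup E] [NormedSpace ℝ E]
    (V W : (p : E) → TangentSpace 𝓘(ℝ, E) p) (p : E) :
    VectorField.mlieBracket 𝓘(ℝ, E) V W p = VectorField.lieBracket ℝ V W p := by
  rw [← VectorField.mlieBracketWithin_univ,
    VectorField.mlieBracketWithin_eq_lieBracketWithin]
  exact congrFun VectorField.lieBracketWithin_univ p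

/-! ### Vector fields in holomorphic charts -/

section Charts

variable {m : ℕ} {N : Type*} [TopologicalSpace N] [ChartedSpace (Cn m) N]

/-- The derivative of a chart. -/
def chartD (e : OpenPartialHomeomorph N (Cn m)) (x : N) : RTangent m x →L[ℝ] Cn m :=
  mfderiv 𝓘(ℝ, Cn m) 𝓘(ℝ, Cn m) e x

/-- The derivative of the inverse of a chart. -/
def chartDinv (e : OpenPartialHomeomorph N (Cn m)) (p : Cn m) : Cn m →L[ℝ] RTangent m (e.symm p) :=
  mfderiv 𝓘(ℝ, Cn m) 𝓘(ℝ, Cn m) e.symm p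

/-- The vector field with components `V` in a chart. -/
def chartField (e : OpenPartialHomeomorph N (Cn m)) (V : Cn m → Cn m) : VField m N :=
  VectorField.mpullback 𝓘(ℝ, Cn m) 𝓘(ℝ, Cn m) e V

variable {e : OpenPartialHomeomorph N (Cn m)} (he : e ∈ holoAtlas m N)

include he in
theorem contMDiffAt_chart {x : N} (hx : x ∈ e.source) :
    ContMDiffAt 𝓘(ℝ, Cn m) 𝓘(ℝ, Cn m) ω e x :=
  (contMDiffAt_of_mem_maximalAtlas he hx).real_of_complex

include he in
theorem contMDiffAt_chart_symm {p : Cn m} (hp : p ∈ e.target) :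
    ContMDiffAt 𝓘(ℝ, Cn m) 𝓘(ℝ, Cn m) ω e.symm p :=
  (contMDiffAt_symm_of_mem_maximalAtlas he hp).real_of_complex

include he

theorem mdifferentiable_chart_real : e.MDifferentiable 𝓘(ℝ, Cn m) 𝓘(ℝ, Cn m) :=
  ⟨fun _ hx => ((contMDiffAt_chart he hx).mdifferentiableAt (by simp)).mdifferentiableWithinAt,
    fun _ hx => ((contMDiffAt_chart_symm he hx).mdifferentiableAt
      (by simp)).mdifferentiableWithinAt⟩

theorem chartD_chartDinv {p : Cn m} (hp : p ∈ e.target) (u : Cn m) :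
    chartD e (e.symm p) (chartDinv e p u) = u :=
  congrArg (fun f : Cn m →L[ℝ] Cn m => f u) ((mdifferentiable_chart_real he).comp_symm_deriv hp)

theorem chartDinv_chartD {p : Cn m} (hp : p ∈ e.target) (w : RTangent m (e.symm p)) :
    chartDinv e p (chartD e (e.symm p) w) = w := by
  have h := (mdifferentiable_chart_real he).symm_comp_deriv (e.map_target hp)
  rw [e.right_inv hp] at h
  exact congrArg (fun f : Cn m →L[ℝ] Cn m => f w) h

theorem chartD_cplxJ {x : N} (hx : x ∈ e.source) (w : RTangent m x) :
    chartD e x (cplxJ m x w) = Complex.I • chartD e x w :=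
  mfderiv_cplxJ ((contMDiffAt_of_mem_maximalAtlas he hx).mdifferentiableAt (by simp)) w

theorem chartDinv_I {p : Cn m} (hp : p ∈ e.target) (u : Cn m) :
    chartDinv e p (Complex.I • u) = cplxJ m _ (chartDinv e p u) :=
  mfderiv_cplxJ (N := Cn m) ((contMDiffAt_symm_of_mem_maximalAtlas he hp).mdifferentiableAt
    (by simp)) u

theorem isInvertible_chartD {x : N} (hx : x ∈ e.source) : (chartD e x).IsInvertible :=
  ⟨(mdifferentiable_chart_real he).mfderiv hx, rfl⟩

theorem chartD_chartField {x : N} (hx : x ∈ e.source) (V : Cn m → Cn m) :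
    chartD e x (chartField e V x) = V (e x) :=
  (isInvertible_chartD he hx).self_apply_inverse _

theorem chartD_injective {x : N} (hx : x ∈ e.source) : Function.Injective (chartD e x) :=
  (isInvertible_chartD he hx).injective

theorem chartField_eq {x : N} (hx : x ∈ e.source) {V : Cn m → Cn m} {w : RTangent m x}
    (h : chartD e x w = V (e x)) : chartField e V x = w :=
  chartD_injective he hx (by rw [chartD_chartField he hx, h])

theorem chartField_symm {p : Cn m} (hp : p ∈ e.target) (V : Cn m → Cn m) :
    chartField e V (e.symm p) = chartDinv e p (V p) :=
  chartField_eq he (e.map_target hp) (by rw [chartD_chartDinv he hp, e.right_inv hp])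

variable [IsManifold 𝓘(ℂ, Cn m) ω N]

theorem mdifferentiableAt_chartField {x : N} (hx : x ∈ e.source) {V : Cn m → Cn m}
    (hV : ContDiffAt ℝ 1 V (e x)) :
    MDifferentiableAt 𝓘(ℝ, Cn m) 𝓘(ℝ, Cn m).tangent
      (fun z => (⟨z, chartField e V z⟩ : TangentBundle 𝓘(ℝ, Cn m) N)) x := by
  have h : MDifferentiableAt 𝓘(ℝ, Cn m) 𝓘(ℝ, Cn m).tangent
      (fun z => (⟨z, V z⟩ : TangentBundle 𝓘(ℝ, Cn m) (Cn m))) (e x) :=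
    (contMDiffAt_vectorSpace_iff_contDiffAt.2 hV).mdifferentiableAt (by simp)
  exact h.mpullback_vectorField (contMDiffAt_chart he hx) (isInvertible_chartD he hx) (by simp)

theorem contMDiffAt_chartField {x : N} (hx : x ∈ e.source) {V : Cn m → Cn m} {k : ℕ∞}
    (hV : ContDiffAt ℝ k V (e x)) :
    ContMDiffAt 𝓘(ℝ, Cn m) 𝓘(ℝ, Cn m).tangent k
      (fun z => (⟨z, chartField e V z⟩ : TangentBundle 𝓘(ℝ, Cn m) N)) x := by
  have h : ContMDiffAt 𝓘(ℝ, Cn m) 𝓘(ℝ, Cn m).tangent k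
      (fun z => (⟨z, V z⟩ : TangentBundle 𝓘(ℝ, Cn m) (Cn m))) (e x) :=
    contMDiffAt_vectorSpace_iff_contDiffAt.2 hV
  exact h.mpullback_vectorField_preimage (contMDiffAt_chart he hx) (isInvertible_chartD he hx)
    (by exact_mod_cast le_top)

theorem smoothNear_chartField {x : N} (hx : x ∈ e.source) {V : Cn m → Cn m}
    (hV : ∀ q ∈ e.target, ContDiffAt ℝ ∞ V q) : SmoothNear (chartField e V) x := by
  filter_upwards [e.open_source.mem_nhds hx] with y hy
  exact contMDiffAt_chartField he hy (k := ⊤) (hV _ (e.map_source hy))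

theorem mlieBracket_chartField {x : N} (hx : x ∈ e.source) {V W : Cn m → Cn m}
    (hV : ContDiffAt ℝ 1 V (e x)) (hW : ContDiffAt ℝ 1 W (e x)) :
    chartD e x (VectorField.mlieBracket 𝓘(ℝ, Cn m) (chartField e V) (chartField e W) x)
      = fderiv ℝ W (e x) (V (e x)) - fderiv ℝ V (e x) (W (e x)) := by
  have h := VectorField.mpullback_mlieBracket (I := 𝓘(ℝ, Cn m)) (I' := 𝓘(ℝ, Cn m)) (f := e)
    (V := V) (W := W) (x₀ := x) ((contMDiffAt_vectorSpace_iff_contDiffAt.2 hV).mdifferentiableAt (by simp))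
    ((contMDiffAt_vectorSpace_iff_contDiffAt.2 hW).mdifferentiableAt (by simp)) (contMDiffAt_chart he hx) (by simp)
  have h2 : VectorField.mlieBracket 𝓘(ℝ, Cn m) V W (e x)
      = fderiv ℝ W (e x) (V (e x)) - fderiv ℝ V (e x) (W (e x)) := by
    exact mlieBracket_vectorSpace V W (e x)
  exact ((congrArg (chartD e x) h.symm).trans (chartD_chartField he hx _)).trans h2

end Charts

/-! ### Coefficients of a connection in a chart -/

section Connections

variable {m : ℕ} {N : Type*} [TopologicalSpace N] [ChartedSpace (Cn m) N]

/-- The components of a vector field in a chart. -/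
def chartComp (e : OpenPartialHomeomorph N (Cn m)) (W : VField m N) (p : Cn m) : Cn m :=
  chartD e (e.symm p) (W (e.symm p))

variable {e : OpenPartialHomeomorph N (Cn m)} (he : e ∈ holoAtlas m N)

include he in
theorem chartField_chartComp {x : N} (hx : x ∈ e.source) (W : VField m N) :
    chartField e (chartComp e W) x = W x :=
  chartField_eq he hx (by rw [chartComp, e.left_inv hx])

include he in
theorem hasMFDerivAt_comp_chart {F : Type*} [NormedAddCommGroup F] [NormedSpace ℝ F] {h : Cn m → F}
    {x : N} (hx : x ∈ e.source) (hh : DifferentiableAt ℝ h (e x)) :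
    HasMFDerivAt 𝓘(ℝ, Cn m) 𝓘(ℝ, F) (fun y => h (e y)) x
      ((fderiv ℝ h (e x)).comp (chartD e x)) :=
  HasMFDerivAt.comp x hh.hasFDerivAt.hasMFDerivAt
    ((mdifferentiable_chart_real he).mdifferentiableAt hx).hasMFDerivAt

variable [IsManifold 𝓘(ℂ, Cn m) ω N]

/-- The covariant derivative of the vector field with constant components `v` in a chart. -/
def connMap (nab : AffineConn m N) (e : OpenPartialHomeomorph N (Cn m)) (p v : Cn m) :
    Cn m →L[ℝ] Cn m :=
  (chartD e (e.symm p)).comp ((nab (chartField e fun _ => v) (e.symm p)).comp (chartDinv e p))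

/-- The coefficients of a connection in a chart. -/
def connCoeff (nab : AffineConn m N) (e : OpenPartialHomeomorph N (Cn m)) (p : Cn m) :
    Cn m →L[ℝ] Cn m →L[ℝ] Cn m :=
  ∑ i, (ContinuousLinearMap.smulRightL ℝ (Cn m) (Cn m)
    ((Module.finBasis ℝ (Cn m)).coord i).toContinuousLinearMap).comp
      (connMap nab e p (Module.finBasis ℝ (Cn m) i))

theorem connCoeff_apply (nab : AffineConn m N) (e : OpenPartialHomeomorph N (Cn m)) (p u v : Cn m) :
    connCoeff nab e p u v = ∑ i, (Module.finBasis ℝ (Cn m)).coord i v •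
      connMap nab e p (Module.finBasis ℝ (Cn m) i) u := by
  simp [connCoeff]

theorem covariantDerivative_sum (nab : AffineConn m N) {ι : Type*} (s : Finset ι)
    {F : ι → VField m N} {x : N}
    (h : ∀ i, MDifferentiableAt 𝓘(ℝ, Cn m) 𝓘(ℝ, Cn m).tangent
      (fun z => (⟨z, F i z⟩ : TangentBundle 𝓘(ℝ, Cn m) N)) x) :
    nab (fun y => ∑ i ∈ s, F i y) x = ∑ i ∈ s, nab (F i) x := by
  classical
  induction s using Finset.induction_on with
  | empty => exact congrFun (CovariantDerivative.zero nab) x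
  | insert i s hi ih =>
    have h1 : (fun y => ∑ j ∈ insert i s, F j y) = F i + fun y => ∑ j ∈ s, F j y := by
      funext y
      rw [Finset.sum_insert hi]
      rfl
    rw [Finset.sum_insert hi, h1, nab.isCovariantDerivativeOnUniv.add (h i)
      (MDifferentiableAt.sum_section fun j _ => h j), ih]

include he

theorem chartComp_contDiffAt {p : Cn m} (hp : p ∈ e.target) {W : VField m N} {k : ℕ∞}
    (hW : ContMDiffAt 𝓘(ℝ, Cn m) 𝓘(ℝ, Cn m).tangent k
      (fun z => (⟨z, W z⟩ : TangentBundle 𝓘(ℝ, Cn m) N)) (e.symm p)) :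
    ContDiffAt ℝ k (chartComp e W) p := by
  have hinv : (mfderiv 𝓘(ℝ, Cn m) 𝓘(ℝ, Cn m) e.symm p).IsInvertible :=
    ⟨(mdifferentiable_chart_real he).symm.mfderiv hp, rfl⟩
  have h := hW.mpullback_vectorField_preimage (contMDiffAt_chart_symm he hp) hinv
    (by exact_mod_cast le_top)
  have h2 := contMDiffAt_vectorSpace_iff_contDiffAt.1 h
  refine h2.congr_of_eventuallyEq ?_
  filter_upwards [e.open_target.mem_nhds hp] with q hq
  have hinv : (chartDinv e q).IsInvertible :=
    ⟨(mdifferentiable_chart_real he).symm.mfderiv hq, rfl⟩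
  refine hinv.injective ?_
  exact (chartDinv_chartD he hq _).trans (hinv.self_apply_inverse _).symm

/-- Expand `V` in the fixed real basis used by `connCoeff` and apply the Leibniz rule: the
derivatives of the coefficient functions sum to `∂_u V`, the rest is `Γ(u, V)`. -/
theorem covariantDerivative_chartField (nab : AffineConn m N) {p : Cn m} (hp : p ∈ e.target)
    {V : Cn m → Cn m} (hV : ContDiffAt ℝ 1 V p) (u : Cn m) :
    chartD e (e.symm p) (nab (chartField e V) (e.symm p) (chartDinv e p u))
      = fderiv ℝ V p u + connCoeff nab e p u (V p) := by
  have hx := e.map_target hp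
  let b := Module.finBasis ℝ (Cn m)
  let ℓ : ∀ i, Cn m →L[ℝ] ℝ := fun i => (b.coord i).toContinuousLinearMap
  let F : ∀ i, VField m N := fun i => chartField e fun _ => b i
  have hVe : ContDiffAt ℝ 1 V (e (e.symm p)) := by rwa [e.right_inv hp]
  have hb : ∀ w : Cn m, ∑ i, ℓ i w • b i = w := fun w => b.sum_repr w
  have hF : ∀ i, MDifferentiableAt 𝓘(ℝ, Cn m) 𝓘(ℝ, Cn m).tangent
      (fun z => (⟨z, F i z⟩ : TangentBundle 𝓘(ℝ, Cn m) N)) (e.symm p) := fun i =>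
    mdifferentiableAt_chartField he hx contDiffAt_const
  have hg : ∀ i, HasMFDerivAt 𝓘(ℝ, Cn m) 𝓘(ℝ, ℝ) (fun y => ℓ i (V (e y))) (e.symm p) _ := fun i =>
    hasMFDerivAt_comp_chart he hx (h := fun q => ℓ i (V q))
      ((ℓ i).differentiableAt.comp _ (hVe.differentiableAt (by simp)))
  have h1 : chartField e V = fun y => ∑ i, ((fun y => ℓ i (V (e y))) • F i) y := by
    funext y
    have : ∀ w : Cn m, (chartD e y).inverse w = ∑ i, ℓ i w • (chartD e y).inverse (b i) := fun w => by
      conv_lhs => rw [← hb w]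
      simp
    exact this (V (e y))
  have h2 : nab (chartField e V) (e.symm p)
      = ∑ i, (ℓ i (V (e (e.symm p))) • nab (F i) (e.symm p)
        + (mvfderiv 𝓘(ℝ, Cn m) (fun y => ℓ i (V (e y))) (e.symm p)).smulRight (F i (e.symm p))) := by
    rw [h1, covariantDerivative_sum nab Finset.univ fun i =>
      (hg i).mdifferentiableAt.smul_section (hF i)]
    exact Finset.sum_congr rfl fun i _ =>
      nab.isCovariantDerivativeOnUniv.leibniz (hF i) (hg i).mdifferentiableAt
  have h3 : ∀ i, mvfderiv 𝓘(ℝ, Cn m) (fun y => ℓ i (V (e y))) (e.symm p) (chartDinv e p u)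
      = ℓ i (fderiv ℝ V p u) := by
    intro i
    have h4 := congrArg (fun f : Cn m →L[ℝ] ℝ => f (chartDinv e p u)) (hg i).mfderiv
    refine h4.trans ?_
    change fderiv ℝ (fun q => ℓ i (V q)) (e (e.symm p)) (chartD e (e.symm p) (chartDinv e p u)) = _
    rw [chartD_chartDinv he hp, e.right_inv hp]
    have h5 : HasFDerivAt (fun q => ℓ i (V q)) _ p :=
      (ℓ i).hasFDerivAt.comp p (hV.differentiableAt (by simp)).hasFDerivAt
    rw [h5.fderiv]
    rfl
  have h6 : ∀ i, chartD e (e.symm p) (F i (e.symm p)) = b i := fun i => chartD_chartField he hx _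
  rw [h2, connCoeff_apply, ← hb (fderiv ℝ V p u), ← Finset.sum_add_distrib]
  simp only [sum_apply, map_sum, add_apply, smul_apply, map_add, map_smul,
    ContinuousLinearMap.smulRight_apply, h3, h6, e.right_inv hp]
  refine Finset.sum_congr rfl fun i _ => ?_
  rw [add_comm]
  rfl

theorem covariantDerivative_eq (nab : AffineConn m N) {p : Cn m} (hp : p ∈ e.target)
    {W : VField m N} (hW : ContMDiffAt 𝓘(ℝ, Cn m) 𝓘(ℝ, Cn m).tangent 1
      (fun z => (⟨z, W z⟩ : TangentBundle 𝓘(ℝ, Cn m) N)) (e.symm p)) (u : Cn m) :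
    chartD e (e.symm p) (nab W (e.symm p) (chartDinv e p u))
      = fderiv ℝ (chartComp e W) p u + connCoeff nab e p u (chartComp e W p) := by
  have hV := chartComp_contDiffAt he hp (k := 1) hW
  rw [← covariantDerivative_chartField he nab hp hV]
  congr 2
  refine nab.isCovariantDerivativeOnUniv.congr_of_eventuallyEq (hW.mdifferentiableAt (by simp))
    (mdifferentiableAt_chartField he (e.map_target hp) (by rwa [e.right_inv hp])) Filter.univ_mem ?_
  filter_upwards [e.open_source.mem_nhds (e.map_target hp)] with y hy
  rw [chartField_chartComp he hy]

/-- The coefficients are the chart components of covariant derivatives of coordinate fields along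
coordinate fields. -/
theorem connCoeff_smooth {nab : AffineConn m N}
    (hnab : ContMDiffCovariantDerivativeOn (Cn m) ∞ nab e.source) :
    ContDiffOn ℝ ∞ (connCoeff nab e) e.target := by
  have key : ∀ v, ContDiffOn ℝ ∞ (fun p => connMap nab e p v) e.target := by
    intro v
    rw [contDiffOn_clm_apply]
    intro u p hp
    refine ContDiffAt.contDiffWithinAt ?_
    have h1 : ∀ v : Cn m, ContMDiffOn 𝓘(ℝ, Cn m) 𝓘(ℝ, Cn m).tangent ∞
      (fun z => (⟨z, chartField e (fun _ => v) z⟩ : TangentBundle 𝓘(ℝ, Cn m) N)) e.source :=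
      fun v x hx => (contMDiffAt_chartField he hx (k := ⊤) contDiffAt_const).contMDiffWithinAt
    have h2 := hnab.contMDiff (σ := chartField e fun _ => v) (h1 v)
    have h3 := h2.clm_bundle_apply (h1 u)
    have h4 := chartComp_contDiffAt he hp
      (W := fun y => nab (chartField e fun _ => v) y (chartField e (fun _ => u) y)) (k := ⊤)
      (h3.contMDiffAt (e.open_source.mem_nhds (e.map_target hp)))
    refine h4.congr_of_eventuallyEq ?_
    filter_upwards [e.open_target.mem_nhds hp] with q hq
    rw [chartComp, chartField_symm he hq]
    rfl
  exact ContDiffOn.sum fun i _ => contDiffOn_const.clm_comp (key _)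

end Connections

/-! ### Orbits of the action and the fundamental field -/

section Orbits

theorem expUnit_zero : expUnit 0 = 1 := Units.ext (by simp [expUnit])

theorem expUnit_add (z w : ℂ) : expUnit (z + w) = expUnit z * expUnit w :=
  Units.ext (by simp [expUnit, Complex.exp_add])

theorem contMDiff_expUnit : ContMDiff 𝓘(ℂ, ℂ) 𝓘(ℂ, ℂ) ω expUnit := by
  apply ContMDiff.of_comp_isOpenEmbedding Units.isOpenEmbedding_val
  exact (Complex.contDiff_exp (n := ω)).contMDiff

variable {m : ℕ} {N : Type*} [TopologicalSpace N] [ChartedSpace (Cn m) N]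
  [MulAction ℂˣ N] [ContMDiffSMul 𝓘(ℂ, ℂ) 𝓘(ℂ, Cn m) ω ℂˣ N]
  {e : OpenPartialHomeomorph N (Cn m)}

theorem contMDiff_orbit (x : N) : ContMDiff 𝓘(ℂ, ℂ) 𝓘(ℂ, Cn m) ω fun z => expUnit z • x :=
  (contMDiff_smul (I := 𝓘(ℂ, ℂ)) (I' := 𝓘(ℂ, Cn m)) (G := ℂˣ) (M := N) (n := ω)).comp
    (contMDiff_expUnit.prodMk contMDiff_const)

theorem contMDiff_units_smul (b : ℂˣ) :
    ContMDiff 𝓘(ℂ, Cn m) 𝓘(ℂ, Cn m) ω fun x : N => b • x :=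
  (contMDiff_smul (I := 𝓘(ℂ, ℂ)) (I' := 𝓘(ℂ, Cn m)) (G := ℂˣ) (M := N) (n := ω)).comp
    (contMDiff_const.prodMk contMDiff_id)

theorem contDiffAt_action (he : e ∈ holoAtlas m N) {z : ℂ} {p : Cn m} (hp : p ∈ e.target)
    (hz : expUnit z • e.symm p ∈ e.source) :
    ContDiffAt ℂ ω (fun q : ℂ × Cn m => e (expUnit q.1 • e.symm q.2)) (z, p) := by
  rw [← contMDiffAt_iff_contDiffAt]
  have h1 : ContMDiffAt 𝓘(ℂ, ℂ × Cn m) 𝓘(ℂ, ℂ) ω (fun q : ℂ × Cn m => expUnit q.1) (z, p) :=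
    contMDiff_expUnit.contMDiffAt.comp (z, p) contDiff_fst.contMDiff.contMDiffAt
  have h2 : ContMDiffAt 𝓘(ℂ, ℂ × Cn m) 𝓘(ℂ, Cn m) ω (fun q : ℂ × Cn m => e.symm q.2) (z, p) :=
    (contMDiffAt_symm_of_mem_maximalAtlas he hp).comp (z, p) contDiff_snd.contMDiff.contMDiffAt
  have h3 := (contMDiff_smul (I := 𝓘(ℂ, ℂ)) (I' := 𝓘(ℂ, Cn m)) (G := ℂˣ) (M := N)
    (n := ω)).contMDiffAt.comp (z, p) (h1.prodMk h2)
  exact (contMDiffAt_of_mem_maximalAtlas he hz).comp (z, p) h3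

/-- `fundField` is a real derivative evaluated at `1`. In a chart the orbit map is holomorphic, and
uniqueness of the real derivative identifies the field with its complex derivative. -/
theorem hasDerivAt_orbit_zero (he : e ∈ holoAtlas m N) {x : N} (hx : x ∈ e.source) :
    HasDerivAt (fun w : ℂ => e (expUnit w • x)) (chartD e x (fundField m x)) 0 := by
  have hx' : expUnit 0 • x ∈ e.source := by rwa [expUnit_zero, one_smul]
  have h1 := (contMDiff_orbit (m := m) x).contMDiffAt (x := 0)
  have h2 := (contMDiffAt_of_mem_maximalAtlas he hx').comp (0 : ℂ) h1
  obtain ⟨L, hL⟩ : ∃ L : ℂ →L[ℂ] Cn m, HasFDerivAt (fun w : ℂ => e (expUnit w • x)) L 0 :=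
    (contMDiffAt_iff_contDiffAt.1 h2).differentiableAt (by simp)
  have h4 := HasMFDerivAt.real_of_complex (f' := L) hL.hasMFDerivAt
  have h5 := HasMFDerivAt.comp (0 : ℂ)
    ((contMDiffAt_chart he hx').mdifferentiableAt (by simp)).hasMFDerivAt
    (h1.real_of_complex.mdifferentiableAt (by simp)).hasMFDerivAt
  have h6 := hasMFDerivAt_unique h4 h5
  -- The chain rule yields the chart derivative at `expUnit 0 • x`, which equals `x` only
  -- propositionally.
  have h7 : ∀ y, y = x → ∀ u : Cn m, (chartD e y : Cn m →L[ℝ] Cn m) u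
      = (chartD e x : Cn m →L[ℝ] Cn m) u := by
    rintro y rfl u
    rfl
  have h9 : L 1 = _ := congrArg (fun f : ℂ →L[ℝ] Cn m => f 1) h6
  have h10 : chartD e x (fundField m x) = L 1 :=
    (h9.trans (h7 _ (by rw [expUnit_zero, one_smul]) _)).symm
  rw [h10]
  exact hL.hasDerivAt

/-- The orbits are the integral curves of the fundamental vector field. -/
theorem hasDerivAt_orbit (he : e ∈ holoAtlas m N) {x : N} {z : ℂ}
    (hx : expUnit z • x ∈ e.source) :
    HasDerivAt (fun w : ℂ => e (expUnit w • x))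
      (chartComp e (fundField m) (e (expUnit z • x))) z := by
  have h := hasDerivAt_orbit_zero he hx
  rw [← sub_self z] at h
  have h2 := h.comp_sub_const z z
  rw [chartComp, e.left_inv hx]
  refine h2.congr_of_eventuallyEq (Filter.Eventually.of_forall fun w => ?_)
  change e (expUnit w • x) = e (expUnit (w - z) • expUnit z • x)
  rw [smul_smul, ← expUnit_add, sub_add_cancel]

/-- The derivative of a function along an orbit. -/
theorem hasFDerivAt_comp_orbit {F : Type*} [NormedAddCommGroup F] [NormedSpace ℝ F]
    (he : e ∈ holoAtlas m N) {x : N} {z : ℂ} (hz : expUnit z • x ∈ e.source)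
    {f : N → F} {φ : Cn m → F} (hf : f =ᶠ[𝓝 (expUnit z • x)] fun y => φ (e y))
    (hφ : DifferentiableAt ℝ φ (e (expUnit z • x))) :
    DifferentiableAt ℝ (fun w : ℂ => f (expUnit w • x)) z ∧ ∀ v, fderiv ℝ
      (fun w : ℂ => f (expUnit w • x)) z v
        = fderiv ℝ φ (e (expUnit z • x)) (v • chartComp e (fundField m) (e (expUnit z • x))) := by
  have h1 := (hasDerivAt_orbit he hz).hasFDerivAt.restrictScalars ℝ
  have hc : ContinuousAt (fun w : ℂ => expUnit w • x) z :=
    ((contMDiff_orbit (m := m) x).continuous).continuousAt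
  have h2 := (hφ.hasFDerivAt.comp z h1).congr_of_eventuallyEq (f₁ := fun w : ℂ => f (expUnit w • x))
    (hc.eventually hf)
  refine ⟨h2.differentiableAt, fun v => ?_⟩
  rw [h2.fderiv]
  rfl

/-- The field is the derivative at time zero of the action map, which is jointly holomorphic in time
and position. -/
theorem contDiffAt_fundField (he : e ∈ holoAtlas m N) {p : Cn m} (hp : p ∈ e.target) :
    ContDiffAt ℂ ω (chartComp e (fundField m)) p := by
  have h0 : ∀ q ∈ e.target, expUnit 0 • e.symm q ∈ e.source := fun q hq => by
    rw [expUnit_zero, one_smul]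
    exact e.map_target hq
  have h1 : ContDiffAt ℂ ω (fun q => fderiv ℂ
      (fun q : ℂ × Cn m => e (expUnit q.1 • e.symm q.2)) (0, q) (1, 0)) p := by
    have h2 := (contDiffAt_action he hp (h0 p hp)).fderiv_right (m := ω) (by simp)
    exact (h2.comp p (contDiffAt_const.prodMk contDiffAt_id)).clm_apply contDiffAt_const
  refine h1.congr_of_eventuallyEq ?_
  filter_upwards [e.open_target.mem_nhds hp] with q hq
  have h3 := ((contDiffAt_action he hq (h0 q hq)).differentiableAt (by simp)).hasFDerivAt
  have h4 := h3.comp_hasDerivAt (0 : ℂ)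
    ((hasDerivAt_id (0 : ℂ)).prodMk (hasDerivAt_const (0 : ℂ) q))
  exact (hasDerivAt_orbit_zero he (e.map_target hq)).unique h4

theorem contMDiffAt_fundField [IsManifold 𝓘(ℂ, Cn m) ω N] (x : N) {k : ℕ∞} :
    ContMDiffAt 𝓘(ℝ, Cn m) 𝓘(ℝ, Cn m).tangent k
      (fun z => (⟨z, fundField m z⟩ : TangentBundle 𝓘(ℝ, Cn m) N)) x := by
  have he : chartAt (Cn m) x ∈ holoAtlas m N := IsManifold.chart_mem_maximalAtlas x
  have hx := mem_chart_source (Cn m) x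
  have h := contMDiffAt_chartField he hx (k := k)
    (((contDiffAt_fundField he ((chartAt (Cn m) x).map_source hx)).restrict_scalars ℝ).of_le
      le_top)
  refine h.congr_of_eventuallyEq ?_
  filter_upwards [(chartAt (Cn m) x).open_source.mem_nhds hx] with y hy
  rw [chartField_chartComp he hy]

end Orbits

/-! ### The metric and the special connection in a chart -/

section ChartStructure

variable {m : ℕ} {N : Type*} [TopologicalSpace N] [ChartedSpace (Cn m) N]
  {e : OpenPartialHomeomorph N (Cn m)} {g : BilinField m N}

theorem inChart_apply (g : BilinField m N) (e : OpenPartialHomeomorph N (Cn m)) (p u v : Cn m) :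
    inChart g e p u v = g (e.symm p) (chartDinv e p u) (chartDinv e p v) := rfl

theorem isHermBilin_inChart (hs : ∀ x u v, g x u v = g x v u)
    (hJ : ∀ x u v, g x (cplxJ m x u) (cplxJ m x v) = g x u v) (he : e ∈ holoAtlas m N) {p : Cn m}
    (hp : p ∈ e.target) : IsHermBilin (inChart g e p) where
  symm u v := hs _ _ _
  inv u v := by
    rw [inChart_apply, chartDinv_I he hp, chartDinv_I he hp, hJ]
    rfl

theorem inChart_nondegenerate (hg : IsPseudoKahler g) (he : e ∈ holoAtlas m N) {p : Cn m}
    (hp : p ∈ e.target) (u : Cn m) (h : ∀ v, inChart g e p u v = 0) : u = 0 := by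
  have h1 := hg.nondegenerate (e.symm p) (chartDinv e p u) fun w => by
    rw [← chartDinv_chartD he hp w]
    exact h _
  rw [← chartD_chartDinv he hp u, h1, map_zero]

theorem hermOf_inChart (he : e ∈ holoAtlas m N) {p : Cn m} (hp : p ∈ e.target) (u v : Cn m) :
    hermOf (inChart g e p) u v = hermPart (cplxJ m (e.symm p)) (fun a b => g (e.symm p) a b)
      (chartDinv e p u) (chartDinv e p v) := by
  simp only [hermOf, hermPart, extHol, extAnti, inChart_apply, multI_apply, chartDinv_I he hp]

theorem inChart_chartD (g : BilinField m N) (he : e ∈ holoAtlas m N) {x : N} (hx : x ∈ e.source)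
    (u v : RTangent m x) : inChart g e (e x) (chartD e x u) (chartD e x v) = g x u v := by
  obtain ⟨p, hp, rfl⟩ : ∃ p ∈ e.target, x = e.symm p := ⟨e x, e.map_source hx, (e.left_inv hx).symm⟩
  rw [e.right_inv hp, inChart_apply, chartDinv_chartD he hp, chartDinv_chartD he hp]

theorem hermOf_inChart_chartD (g : BilinField m N) (he : e ∈ holoAtlas m N) {x : N}
    (hx : x ∈ e.source) (u v : RTangent m x) :
    hermOf (inChart g e (e x)) (chartD e x u) (chartD e x v)
      = hermPart (cplxJ m x) (fun a b => g x a b) u v := by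
  simp only [hermOf, hermPart, extHol, extAnti, multI_apply, ← chartD_cplxJ he hx,
    inChart_chartD g he hx]

theorem chartComp_symm (he : e ∈ holoAtlas m N) {p : Cn m} (hp : p ∈ e.target) (W : VField m N) :
    chartDinv e p (chartComp e W p) = W (e.symm p) :=
  chartDinv_chartD he hp _

theorem chartComp_applyJ (he : e ∈ holoAtlas m N) {p : Cn m} (hp : p ∈ e.target) (W : VField m N) :
    chartComp e (applyJ W) p = Complex.I • chartComp e W p :=
  chartD_cplxJ he (e.map_target hp) _

theorem chartComp_chartField (he : e ∈ holoAtlas m N) {p : Cn m} (hp : p ∈ e.target)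
    (V : Cn m → Cn m) : chartComp e (chartField e V) p = V p := by
  rw [chartComp, chartD_chartField he (e.map_target hp), e.right_inv hp]

theorem chartDinv_injective (he : e ∈ holoAtlas m N) {p : Cn m} (hp : p ∈ e.target) :
    Function.Injective (chartDinv e p) := fun u v h => by
  rw [← chartD_chartDinv he hp u, h, chartD_chartDinv he hp]

variable [IsManifold 𝓘(ℂ, Cn m) ω N]

theorem contMDiffAt_of_chartComp (he : e ∈ holoAtlas m N) {p : Cn m} (hp : p ∈ e.target)
    {W : VField m N} {V : Cn m → Cn m} {k : ℕ∞} (hV : ContDiffAt ℝ k V p)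
    (hW : ∀ᶠ q in 𝓝 p, chartComp e W q = V q) :
    ContMDiffAt 𝓘(ℝ, Cn m) 𝓘(ℝ, Cn m).tangent k
      (fun z => (⟨z, W z⟩ : TangentBundle 𝓘(ℝ, Cn m) N)) (e.symm p) := by
  have hx := e.map_target hp
  have h1 := contMDiffAt_chartField he hx (V := V) (k := k) (by rwa [e.right_inv hp])
  refine h1.congr_of_eventuallyEq ?_
  have h2 := e.continuousAt hx
  rw [ContinuousAt, e.right_inv hp] at h2
  filter_upwards [e.open_source.mem_nhds hx, h2.eventually hW] with y hy hy'
  rw [← chartField_chartComp he hy W]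
  congr 1
  exact congrArg (chartD e y).inverse hy'

theorem covariantDerivative_of_chartComp (he : e ∈ holoAtlas m N) (nab : AffineConn m N) {p : Cn m}
    (hp : p ∈ e.target) {W : VField m N} {V : Cn m → Cn m} (hV : ContDiffAt ℝ 1 V p)
    (hW : ∀ᶠ q in 𝓝 p, chartComp e W q = V q) (u : Cn m) :
    nab W (e.symm p) (chartDinv e p u)
      = chartDinv e p (fderiv ℝ V p u + connCoeff nab e p u (V p)) := by
  have h := covariantDerivative_eq he nab hp (contMDiffAt_of_chartComp he hp (k := 1) hV hW) u
  rw [hW.self_of_nhds, Filter.EventuallyEq.fderiv_eq hW] at h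
  rw [← h, chartDinv_chartD he hp]

theorem covariantDerivative_const (he : e ∈ holoAtlas m N) (nab : AffineConn m N) {p : Cn m}
    (hp : p ∈ e.target) (u v : Cn m) :
    nab (chartField e fun _ => v) (e.symm p) (chartDinv e p u)
      = chartDinv e p (connCoeff nab e p u v) := by
  rw [covariantDerivative_of_chartComp he nab hp (V := fun _ => v) contDiffAt_const]
  · simp
  · filter_upwards [e.open_target.mem_nhds hp] with q hq using chartComp_chartField he hq _

theorem covariantDerivative_applyJ (he : e ∈ holoAtlas m N) (nab : AffineConn m N) {p : Cn m}
    (hp : p ∈ e.target) {W : VField m N}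
    (hW : ContMDiffAt 𝓘(ℝ, Cn m) 𝓘(ℝ, Cn m).tangent 1
      (fun z => (⟨z, W z⟩ : TangentBundle 𝓘(ℝ, Cn m) N)) (e.symm p)) (u : Cn m) :
    nab (applyJ W) (e.symm p) (chartDinv e p u)
      = chartDinv e p (Complex.I • fderiv ℝ (chartComp e W) p u
        + connCoeff nab e p u (Complex.I • chartComp e W p)) := by
  have h1 : ContDiffAt ℝ 1 (chartComp e W) p := chartComp_contDiffAt he hp (k := 1) hW
  rw [covariantDerivative_of_chartComp he nab hp (V := fun q => Complex.I • chartComp e W q)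
    (h1.const_smul Complex.I)]
  · congr 2
    erw [((h1.differentiableAt (by simp)).hasFDerivAt.const_smul Complex.I).fderiv]
    rfl
  · filter_upwards [e.open_target.mem_nhds hp] with q hq using chartComp_applyJ he hq _

theorem mlieBracket_const (he : e ∈ holoAtlas m N) {x : N} (hx : x ∈ e.source) (u v : Cn m) :
    VectorField.mlieBracket 𝓘(ℝ, Cn m) (chartField e fun _ => u) (chartField e fun _ => v) x = 0 := by
  refine chartD_injective he hx ?_
  rw [mlieBracket_chartField he hx contDiffAt_const contDiffAt_const]
  simp

theorem smoothNear_const (he : e ∈ holoAtlas m N) {x : N} (hx : x ∈ e.source) (u : Cn m) :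
    SmoothNear (chartField e fun _ => u) x :=
  smoothNear_chartField he hx fun _ _ => contDiffAt_const

variable {nab : AffineConn m N} (hnab : IsSpecialConnection g nab)
include hnab

/-- Both structural equations are tested on fields with constant components, whose brackets vanish.
Torsionfreeness gives the symmetry; `d_∇ J = 0` gives `Γ(u, iv) = Γ(v, iu)`, which symmetry turns
into the rule for `i`. -/
theorem isSpecialBilin_connCoeff (he : e ∈ holoAtlas m N) {p : Cn m} (hp : p ∈ e.target) :
    IsSpecialBilin (connCoeff nab e p) := by
  have hx := e.map_target hp
  have hsymm : ∀ u v, connCoeff nab e p u v = connCoeff nab e p v u := by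
    intro u v
    have h := nab.torsion_eq_zero_iff.1 hnab.torsionfree
      (mdifferentiableAt_chartField he hx (V := fun _ => u) contDiffAt_const)
      (mdifferentiableAt_chartField he hx (V := fun _ => v) contDiffAt_const)
    rw [mlieBracket_const he hx, chartField_symm he hp, chartField_symm he hp,
      covariantDerivative_const he nab hp, covariantDerivative_const he nab hp, sub_eq_zero] at h
    exact chartDinv_injective he hp h
  refine ⟨hsymm, fun u v => ?_⟩
  have h := hnab.dJ_eq_zero (e.symm p) _ _ (smoothNear_const he hx u) (smoothNear_const he hx v)
  have hc : ∀ v : Cn m, ContMDiffAt 𝓘(ℝ, Cn m) 𝓘(ℝ, Cn m).tangent 1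
      (fun z => (⟨z, chartField e (fun _ => v) z⟩ : TangentBundle 𝓘(ℝ, Cn m) N)) (e.symm p) :=
    fun v => contMDiffAt_chartField he hx (k := 1) contDiffAt_const
  have hf : ∀ v : Cn m, fderiv ℝ (chartComp e (chartField e fun _ => v)) p = 0 := fun v => by
    have : chartComp e (chartField e fun _ => v) =ᶠ[𝓝 p] fun _ => v := by
      filter_upwards [e.open_target.mem_nhds hp] with q hq using chartComp_chartField he hq _
    rw [this.fderiv_eq]
    simp
  rw [mlieBracket_const he hx, map_zero, sub_zero, chartField_symm he hp, chartField_symm he hp,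
    covariantDerivative_applyJ he nab hp (hc v), covariantDerivative_applyJ he nab hp (hc u),
    sub_eq_zero, chartComp_chartField he hp, chartComp_chartField he hp, hf, hf] at h
  have h2 := chartDinv_injective he hp h
  simp only [zero_apply, smul_zero, zero_add] at h2
  rw [hsymm, ← h2]

theorem connCoeff_flat (he : e ∈ holoAtlas m N) {p : Cn m} (hp : p ∈ e.target) (u v w : Cn m) :
    fderiv ℝ (connCoeff nab e) p u v w - fderiv ℝ (connCoeff nab e) p v u w
      + connCoeff nab e p u (connCoeff nab e p v w)
      - connCoeff nab e p v (connCoeff nab e p u w) = 0 := by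
  have hx := e.map_target hp
  have h := hnab.flat (e.symm p) _ _ _ (smoothNear_const he hx u) (smoothNear_const he hx v)
    (smoothNear_const he hx w)
  have hΓ : ContDiffAt ℝ ∞ (connCoeff nab e) p :=
    (connCoeff_smooth he (hnab.smooth _ e.open_source)).contDiffAt (e.open_target.mem_nhds hp)
  have key : ∀ u v, nab (fun y => nab (chartField e fun _ => w) y (chartField e (fun _ => v) y))
      (e.symm p) (chartDinv e p u) = chartDinv e p (fderiv ℝ (connCoeff nab e) p u v w
        + connCoeff nab e p u (connCoeff nab e p v w)) := by
    intro u v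
    rw [covariantDerivative_of_chartComp he nab hp (V := fun q => connCoeff nab e q v w),
      fderiv_bilin_const (hΓ.differentiableAt (by simp))]
    · exact ((hΓ.clm_apply contDiffAt_const).clm_apply contDiffAt_const).of_le
        (by exact_mod_cast le_top)
    · filter_upwards [e.open_target.mem_nhds hp] with q hq
      rw [chartComp, chartField_symm he hq, covariantDerivative_const he nab hq,
        chartD_chartDinv he hq]
  rw [mlieBracket_const he hx, map_zero, sub_zero, chartField_symm he hp, chartField_symm he hp,
    key, key, ← map_sub] at h
  have h2 := chartDinv_injective he hp (h.trans (map_zero _).symm)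
  rw [← h2]
  abel

/-- The equation `∇Φ = 0` on fields with constant components, where `Φ(u, v)` reads `G(u, iv)`. -/
theorem inChart_symplectic (hg : IsPseudoKahler g) (he : e ∈ holoAtlas m N) {p : Cn m}
    (hp : p ∈ e.target) (t u v : Cn m) :
    fderiv ℝ (inChart g e) p t u (Complex.I • v)
      = inChart g e p (connCoeff nab e p t u) (Complex.I • v)
        + inChart g e p u (Complex.I • connCoeff nab e p t v) := by
  have hx := e.map_target hp
  have hG : DifferentiableAt ℝ (inChart g e) p :=
    ((hg.smooth e he).contDiffAt (e.open_target.mem_nhds hp)).differentiableAt (by simp)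
  have h := hnab.symplectic (e.symm p) (chartDinv e p t) _ _ (smoothNear_const he hx u)
    (smoothNear_const he hx v)
  have h1 : (fun y => fundForm g y (chartField e (fun _ => u) y) (chartField e (fun _ => v) y))
      =ᶠ[𝓝 (e.symm p)] fun y => (fun q => inChart g e q u (Complex.I • v)) (e y) := by
    filter_upwards [e.open_source.mem_nhds hx] with y hy
    obtain ⟨q, hq, rfl⟩ : ∃ q ∈ e.target, y = e.symm q :=
      ⟨e y, e.map_source hy, (e.left_inv hy).symm⟩
    rw [chartField_symm he hq, chartField_symm he hq, e.right_inv hq, inChart_apply,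
      chartDinv_I he hq]
    rfl
  have h2 : DifferentiableAt ℝ (fun q => inChart g e q u (Complex.I • v)) p :=
    (hasFDerivAt_bilin hG (differentiableAt_const u)
      (differentiableAt_const (Complex.I • v))).differentiableAt
  have h3 := (hasMFDerivAt_comp_chart he hx (h := fun q => inChart g e q u (Complex.I • v))
    (by rwa [e.right_inv hp])).congr_of_eventuallyEq h1
  have h4 : rdiff (fun y => fundForm g y (chartField e (fun _ => u) y)
      (chartField e (fun _ => v) y)) (e.symm p) (chartDinv e p t)
      = fderiv ℝ (inChart g e) p t u (Complex.I • v) := by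
    refine (congrArg (fun f : Cn m →L[ℝ] ℝ => f (chartDinv e p t)) h3.mfderiv).trans ?_
    change fderiv ℝ _ _ (chartD e (e.symm p) (chartDinv e p t)) = _
    rw [chartD_chartDinv he hp, e.right_inv hp, fderiv_bilin_const hG]
  rw [← h4, h, chartField_symm he hp, chartField_symm he hp, covariantDerivative_const he nab hp,
    covariantDerivative_const he nab hp, inChart_apply, inChart_apply, chartDinv_I he hp,
    chartDinv_I he hp]
  rfl

end ChartStructure

/-! ### The local structure of `N` and the global potential -/

namespace ProjSpecialKahler

variable {n : ℕ} {N M : Type*} [TopologicalSpace N]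
    [ChartedSpace (Cn (n + 1)) N] [IsManifold 𝓘(ℂ, Cn (n + 1)) ω N] [TopologicalSpace M]
    [ChartedSpace (Cn n) M] [IsManifold 𝓘(ℂ, Cn n) ω M] [MulAction ℂˣ N]
    [ContMDiffSMul 𝓘(ℂ, ℂ) 𝓘(ℂ, Cn (n + 1)) ω ℂˣ N] (S : ProjSpecialKahler n N M)
    {e : OpenPartialHomeomorph N (Cn (n + 1))}

/-- The components of the fundamental vector field in a chart. -/
abbrev locField (e : OpenPartialHomeomorph N (Cn (n + 1))) : Cn (n + 1) → Cn (n + 1) :=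
  chartComp e (fundField (n + 1))

/-- Each hypothesis on `H` is a sum of two terms. Holomorphy of the field and `Γ(iu, v) = Γ(u, iv)`
make them equal, which accounts for the `2 * c` in the hypothesis. -/
theorem fundField_homothetic (he : e ∈ holoAtlas (n + 1) N) {p : Cn (n + 1)} (hp : p ∈ e.target)
    (u : Cn (n + 1)) :
    fderiv ℝ (locField e) p u + connCoeff S.nab e p u (locField e p) = S.c • u ∧
    Complex.I • fderiv ℝ (locField e) p u + connCoeff S.nab e p u (Complex.I • locField e p)
      = S.c • Complex.I • u := by
  have hS := isSpecialBilin_connCoeff S.isSpecial he hp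
  have hη := (contDiffAt_fundField he hp).differentiableAt (by simp)
  have hs := contMDiffAt_fundField (m := n + 1) (e.symm p) (k := 1)
  obtain ⟨h1, h2⟩ := S.homothetic (e.symm p) (chartDinv e p u)
  have h3 := covariantDerivative_of_chartComp he S.nab hp (W := fundField (n + 1))
    (chartComp_contDiffAt he hp (k := 1) hs) (Filter.Eventually.of_forall fun q => rfl)
  rw [← chartDinv_I he hp, h3, covariantDerivative_applyJ he S.nab hp hs,
    ← (chartDinv e p).map_smul (2 * S.c)] at h2
  rw [← chartDinv_I he hp, h3, covariantDerivative_applyJ he S.nab hp hs,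
    ← (chartDinv e p).map_smul (2 * S.c)] at h1
  have h1' := chartDinv_injective he hp ((map_sub _ _ _).trans h1)
  have h2' := chartDinv_injective he hp ((map_add _ _ _).trans h2)
  rw [fderiv_real_I_smul hη, hS.I_left] at h1' h2'
  rw [I_smul_I_smul, I_smul_I_smul, map_neg, mul_comm, mul_smul] at h1'
  rw [mul_comm, mul_smul] at h2'
  constructor
  · have h5 : (2 : ℝ) • (fderiv ℝ (locField e) p u + connCoeff S.nab e p u (locField e p))
        = (2 : ℝ) • S.c • u := by
      rw [smul_comm 2 S.c, ← h1']
      module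
    exact smul_right_injective _ (two_ne_zero (α := ℝ)) h5
  · have h5 : (2 : ℝ) • (Complex.I • fderiv ℝ (locField e) p u
        + connCoeff S.nab e p u (Complex.I • locField e p))
        = (2 : ℝ) • S.c • Complex.I • u := by
      rw [smul_comm 2 S.c, ← h2', two_smul]
    exact smul_right_injective _ (two_ne_zero (α := ℝ)) h5

theorem hermPart_fundField (he : e ∈ holoAtlas (n + 1) N) {p : Cn (n + 1)} (hp : p ∈ e.target) :
    hermPart (cplxJ (n + 1) (e.symm p)) (fun u v => S.metric (e.symm p) u v)
      (fundField (n + 1) (e.symm p)) (fundField (n + 1) (e.symm p))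
      = ((inChart S.metric e p (locField e p) (locField e p) / 2 : ℝ) : ℂ) := by
  rw [← chartComp_symm he hp (fundField (n + 1)), ← hermOf_inChart he hp,
    (isHermBilin_inChart S.isPseudoKahler.symm S.isPseudoKahler.hermitian he hp).hermOf_self]

/-- The structure of `N` in a holomorphic chart. -/
theorem localSpecial (he : e ∈ holoAtlas (n + 1) N) :
    LocalSpecial e.target (inChart S.metric e) (connCoeff S.nab e) (locField e) S.c where
  isOpen := e.open_target
  metric_smooth := S.isPseudoKahler.smooth e he
  conn_smooth := connCoeff_smooth he (S.isSpecial.smooth _ e.open_source)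
  field_holo _ hp := contDiffAt_fundField he hp
  c_ne := S.c_ne_zero
  isHerm _ hp := isHermBilin_inChart S.isPseudoKahler.symm S.isPseudoKahler.hermitian he hp
  nondeg _ hp := inChart_nondegenerate S.isPseudoKahler he hp
  isSpecial _ hp := isSpecialBilin_connCoeff S.isSpecial he hp
  symplectic _ hp := inChart_symplectic S.isSpecial S.isPseudoKahler he hp
  flat _ hp := connCoeff_flat S.isSpecial he hp
  homothetic _ hp u := (S.fundField_homothetic he hp u).1
  homothetic_I _ hp u := (S.fundField_homothetic he hp u).2
  nonnull p hp h := S.nonnull (e.symm p) (by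
    rw [S.hermPart_fundField he hp, h]
    simp)

theorem potential_eq (he : e ∈ holoAtlas (n + 1) N) {p : Cn (n + 1)} (hp : p ∈ e.target) :
    S.potential (e.symm p) = locPot (inChart S.metric e) (locField e) S.c p := by
  rw [potential, S.hermPart_fundField he hp, Complex.ofReal_re, locPot]
  ring

theorem potential_eventuallyEq (he : e ∈ holoAtlas (n + 1) N) {p : Cn (n + 1)}
    (hp : p ∈ e.target) :
    (fun q => S.potential (e.symm q)) =ᶠ[𝓝 p] locPot (inChart S.metric e) (locField e) S.c := by
  filter_upwards [e.open_target.mem_nhds hp] with q hq using S.potential_eq he hq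

theorem potential_ne_zero (x : N) : S.potential x ≠ 0 := by
  have he : chartAt (Cn (n + 1)) x ∈ holoAtlas (n + 1) N := IsManifold.chart_mem_maximalAtlas x
  have hp := mem_chart_target (Cn (n + 1)) x
  have h := (S.localSpecial he).locPot_ne hp
  rwa [← S.potential_eq he hp, (chartAt _ x).left_inv (mem_chart_source _ x)] at h

theorem ddbar_congr {m : ℕ} {φ ψ : Cn m → ℝ} {p : Cn m} (h : φ =ᶠ[𝓝 p] ψ) (u v : Cn m) :
    ddbar φ p u v = ddbar ψ p u v := by
  rw [ddbar, ddbar, h.fderiv.fderiv_eq]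

theorem ddbar_log_potential (he : e ∈ holoAtlas (n + 1) N) {p : Cn (n + 1)} (hp : p ∈ e.target)
    (u v : Cn (n + 1)) :
    ddbar (fun q => Real.log |S.potential (e.symm q)|) p u v
      = locDdbarLog (inChart S.metric e) (locField e) S.c p u v := by
  rw [locDdbarLog, ← (S.localSpecial he).ddbar_log hp]
  refine ddbar_congr ?_ u v
  filter_upwards [S.potential_eventuallyEq he hp] with q hq
  rw [hq]

theorem potential_comp_chart {x : N} (he : e ∈ holoAtlas (n + 1) N) (hx : x ∈ e.source) :
    S.potential =ᶠ[𝓝 x] fun y => locPot (inChart S.metric e) (locField e) S.c (e y) := by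
  filter_upwards [e.open_source.mem_nhds hx] with y hy
  rw [← S.potential_eq he (e.map_source hy), e.left_inv hy]

theorem potential_contMDiff : ContMDiff 𝓘(ℝ, Cn (n + 1)) 𝓘(ℝ, ℝ) ∞ S.potential := by
  intro x
  have he : chartAt (Cn (n + 1)) x ∈ holoAtlas (n + 1) N := IsManifold.chart_mem_maximalAtlas x
  have hx := mem_chart_source (Cn (n + 1)) x
  have h1 := (S.localSpecial he).locPot_smoothAt (mem_chart_target (Cn (n + 1)) x)
  exact (h1.contMDiffAt.comp x ((contMDiffAt_chart he hx).of_le le_top)).congr_of_eventuallyEq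
    (S.potential_comp_chart he hx)

/-- Along an orbit `dK(vη) = 2c Re(v) K`, because `G(η, η) = 2c²K` and `G(iη, η) = 0`. This
differential equation on `ℂ` integrates to the claim. -/
theorem potential_orbit (z : ℂ) (x : N) :
    S.potential (expUnit z • x) = ‖Complex.exp (S.c * z)‖ ^ 2 * S.potential x := by
  have key : ∀ z : ℂ, DifferentiableAt ℝ (fun w : ℂ => S.potential (expUnit w • x)) z ∧
      ∀ v, fderiv ℝ (fun w : ℂ => S.potential (expUnit w • x)) z v
        = 2 * S.c * v.re * S.potential (expUnit z • x) := by
    intro z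
    set y := expUnit z • x with hy
    have he : chartAt (Cn (n + 1)) y ∈ holoAtlas (n + 1) N := IsManifold.chart_mem_maximalAtlas y
    have hx := mem_chart_source (Cn (n + 1)) y
    have hp := mem_chart_target (Cn (n + 1)) y
    have hS := S.localSpecial he
    have h := hasFDerivAt_comp_orbit he hx (S.potential_comp_chart he hx) (hS.locPot_diff hp)
    simp only [← hy] at h
    refine ⟨h.1, fun v => ?_⟩
    have hG := hS.isHerm _ hp
    have hpot := S.potential_eq he hp
    rw [(chartAt _ y).left_inv hx] at hpot
    have hc := S.c_ne_zero
    rw [h.2, hS.fderiv_locPot hp, hpot, complex_smul_eq, map_add, map_smul, map_smul, locPot]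
    simp only [add_apply, smul_apply, hG.I_self, smul_eq_mul, mul_zero, add_zero]
    field_simp
  -- The integrating factor makes the product constant on `ℂ`.
  have h1 : ∀ z : ℂ, HasFDerivAt (fun w : ℂ => S.potential (expUnit w • x)
      * Real.exp (-(2 * S.c * w.re))) (0 : ℂ →L[ℝ] ℝ) z := by
    intro z
    have h2 : HasFDerivAt (fun w : ℂ => Real.exp (-(2 * S.c * w.re)))
        (Real.exp (-(2 * S.c * z.re)) • -((2 * S.c) • Complex.reCLM)) z :=
      ((Complex.reCLM.hasFDerivAt (x := z)).const_mul (2 * S.c)).neg.exp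
    refine ((key z).1.hasFDerivAt.mul h2).congr_fderiv ?_
    ext v
    simp only [add_apply, smul_apply, neg_apply, (key z).2, Complex.reCLM_apply, smul_eq_mul,
      zero_apply]
    ring
  have h3 := is_const_of_fderiv_eq_zero (𝕜 := ℝ) (fun z => (h1 z).differentiableAt)
    (fun z => (h1 z).fderiv) z 0
  simp only [expUnit_zero, one_smul, Complex.zero_re, mul_zero, neg_zero, Real.exp_zero,
    mul_one] at h3
  rw [← h3, Complex.norm_exp, Complex.re_ofReal_mul, ← Real.exp_nat_mul]
  rw [mul_comm, mul_assoc, ← Real.exp_add]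
  have : -(2 * S.c * z.re) + ((2 : ℕ) : ℝ) * (S.c * z.re) = 0 := by
    push_cast
    ring
  rw [this, Real.exp_zero, mul_one]

theorem isHomogeneousPotential : S.IsHomogeneousPotential S.potential :=
  ⟨S.potential_contMDiff, fun _ he _ hp u v => by
    rw [ddbar_congr (S.potential_eventuallyEq he hp), (S.localSpecial he).ddbar_locPot hp]
    rfl, S.potential_orbit⟩

end ProjSpecialKahler

/-! ### Charts adapted to the quotient map -/

namespace ProjSpecialKahler

variable {n : ℕ} {N M : Type*} [TopologicalSpace N]
    [ChartedSpace (Cn (n + 1)) N] [IsManifold 𝓘(ℂ, Cn (n + 1)) ω N] [TopologicalSpace M]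
    [ChartedSpace (Cn n) M] [IsManifold 𝓘(ℂ, Cn n) ω M] [MulAction ℂˣ N]
    [ContMDiffSMul 𝓘(ℂ, ℂ) 𝓘(ℂ, Cn (n + 1)) ω ℂˣ N] (S : ProjSpecialKahler n N M)

/-- A chart `φ` of `N` in which the projection, followed by the chart `e` of `M`, is the linear
map `P`, with a linear right inverse `Q`. -/
structure IsAdapted (e : OpenPartialHomeomorph M (Cn n))
    (φ : OpenPartialHomeomorph N (Cn (n + 1)))
    (P : Cn (n + 1) →L[ℂ] Cn n) (Q : Cn n →L[ℂ] Cn (n + 1)) : Prop where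
  base : e ∈ holoAtlas n M
  total : φ ∈ holoAtlas (n + 1) N
  right_inv : ∀ z, P (Q z) = z
  mem_source : ∀ y ∈ φ.source, S.proj y ∈ e.source
  proj_eq : ∀ y ∈ φ.source, e (S.proj y) = P (φ y)

/-- The normal form of a submersion comes with its own chart `ψ` of `M`. Inserting the holomorphic
transition from `ψ` to `e` on the base factor makes the projection linear with respect to the given
`e`. -/
theorem exists_isAdapted {e : OpenPartialHomeomorph M (Cn n)} (he : e ∈ holoAtlas n M) {x : N}
    (hx : S.proj x ∈ e.source) : ∃ φ P Q, S.IsAdapted e φ P Q ∧ x ∈ φ.source := by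
  obtain ⟨F, _, _, hF⟩ := S.proj_submersion.isSubmersionAt x
  let φ₀ := hF.domChart
  let ψ := hF.codChart
  let L : Cn (n + 1) ≃L[ℂ] (Cn n × F) := hF.equiv
  let Lp := L.toHomeomorph.toOpenPartialHomeomorph
  let τ := ψ.symm.trans e
  let χ := τ.prod (OpenPartialHomeomorph.refl F)
  let φ := ((φ₀.trans Lp).trans χ).trans Lp.symm
  have hψe : ∀ y ∈ φ₀.source, ψ (S.proj y) = (L (φ₀ y)).1 := by
    intro y hy
    have hm : φ₀ y ∈ (hF.domChart.extend 𝓘(ℂ, Cn (n + 1))).target := by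
      simpa using φ₀.map_source hy
    have h := hF.writtenInCharts hm
    have h2 : φ₀.symm (φ₀ y) = y := φ₀.left_inv hy
    simpa [φ₀, ψ, h2] using h
  have hψs : ∀ y ∈ φ₀.source, S.proj y ∈ ψ.source := fun y hy => hF.source_subset_preimage_source hy
  have hφs : ∀ y, y ∈ φ.source ↔ y ∈ φ₀.source ∧ S.proj y ∈ e.source := by
    intro y
    have h1 : y ∈ φ.source ↔ y ∈ φ₀.source ∧ (L (φ₀ y)).1 ∈ ψ.target ∧
        ψ.symm (L (φ₀ y)).1 ∈ e.source := by
      simp [φ, Lp, χ, τ]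
    rw [h1]
    refine and_congr_right fun hy => ?_
    rw [← hψe y hy, ψ.left_inv (hψs y hy)]
    exact and_iff_right (ψ.map_source (hψs y hy))
  have hφv : ∀ y, φ y = L.symm (e (ψ.symm (L (φ₀ y)).1), (L (φ₀ y)).2) := fun y => rfl
  have hφt : ∀ q, q ∈ φ.target ↔ ((L q).1 ∈ e.target ∧ e.symm (L q).1 ∈ ψ.source) ∧
      L.symm (ψ (e.symm (L q).1), (L q).2) ∈ φ₀.target := by
    intro q
    simp [φ, Lp, χ, τ]
  have hφi : ∀ q, φ.symm q = φ₀.symm (L.symm (ψ (e.symm (L q).1), (L q).2)) := fun q => rfl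
  have hφ₀ : φ₀ ∈ holoAtlas (n + 1) N := hF.domChart_mem_maximalAtlas
  have hψ : ψ ∈ holoAtlas n M := hF.codChart_mem_maximalAtlas
  have hlin : ∀ {f : Cn n → Cn n} {q}, ContDiffAt ℂ ω f (L q).1 →
      ContDiffAt ℂ ω (fun q => L.symm (f (L q).1, (L q).2)) q := by
    intro f q hf
    have h1 : ContDiffAt ℂ ω (fun q => (L q).1) q := contDiff_fst.contDiffAt.comp q
      L.contDiff.contDiffAt
    have h2 : ContDiffAt ℂ ω (fun q => (L q).2) q := contDiff_snd.contDiffAt.comp q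
      L.contDiff.contDiffAt
    exact L.symm.contDiff.contDiffAt.comp q ((hf.comp q h1).prodMk h2)
  have hφ : φ ∈ holoAtlas (n + 1) N := by
    refine φ.mem_maximalAtlas_of_contMDiffOn (fun y hy => ContMDiffAt.contMDiffWithinAt ?_)
      fun q hq => ContMDiffAt.contMDiffWithinAt ?_
    · obtain ⟨hy, hy'⟩ := (hφs y).1 hy
      have h1 : (L (φ₀ y)).1 ∈ ψ.target := by
        rw [← hψe y hy]
        exact ψ.map_source (hψs y hy)
      have h2 : ψ.symm (L (φ₀ y)).1 ∈ e.source := by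
        rwa [← hψe y hy, ψ.left_inv (hψs y hy)]
      have h3 := (contMDiffAt_of_mem_maximalAtlas he h2).comp (L (φ₀ y)).1
        (contMDiffAt_symm_of_mem_maximalAtlas hψ h1)
      exact (hlin (contMDiffAt_iff_contDiffAt.1 h3)).contMDiffAt.comp y
        (contMDiffAt_of_mem_maximalAtlas hφ₀ hy)
    · obtain ⟨⟨h1, h2⟩, h3⟩ := (hφt q).1 hq
      have h4 := (contMDiffAt_of_mem_maximalAtlas hψ h2).comp (L q).1
        (contMDiffAt_symm_of_mem_maximalAtlas he h1)
      have h5 : ContMDiffAt 𝓘(ℂ, Cn (n + 1)) 𝓘(ℂ, Cn (n + 1)) ω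
          (fun q => L.symm (ψ (e.symm (L q).1), (L q).2)) q :=
        (hlin (contMDiffAt_iff_contDiffAt.1 h4)).contMDiffAt
      exact ContMDiffAt.comp (g := φ₀.symm) q (contMDiffAt_symm_of_mem_maximalAtlas hφ₀ h3) h5
  refine ⟨φ, (ContinuousLinearMap.fst ℂ (Cn n) F).comp (L : Cn (n + 1) →L[ℂ] Cn n × F),
    (L.symm : Cn n × F →L[ℂ] Cn (n + 1)).comp (ContinuousLinearMap.inl ℂ (Cn n) F),
    ⟨he, hφ, fun z => by simp, fun y hy => ((hφs y).1 hy).2, fun y hy => ?_⟩,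
    (hφs x).2 ⟨hF.mem_domChart_source, hx⟩⟩
  obtain ⟨hy, -⟩ := (hφs y).1 hy
  rw [hφv, ← hψe y hy, ψ.left_inv (hψs y hy)]
  simp

theorem exists_isAdapted_chartAt (x : N) :
    ∃ φ P Q, S.IsAdapted (chartAt (Cn n) (S.proj x)) φ P Q ∧ x ∈ φ.source :=
  S.exists_isAdapted (IsManifold.chart_mem_maximalAtlas _) (mem_chart_source _ _)

theorem proj_contMDiff : ContMDiff 𝓘(ℂ, Cn (n + 1)) 𝓘(ℂ, Cn n) ω S.proj :=
  S.proj_submersion.contMDiff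

theorem proj_mdifferentiableAt (x : N) :
    MDifferentiableAt 𝓘(ℝ, Cn (n + 1)) 𝓘(ℝ, Cn n) S.proj x :=
  S.proj_contMDiff.contMDiffAt.real_of_complex.mdifferentiableAt (by simp)

theorem proj_units_smul (b : ℂˣ) (x : N) : S.proj (b • x) = S.proj x :=
  ((S.proj_eq_iff x (b • x)).2 ⟨b, rfl⟩).symm

namespace IsAdapted

variable {S} {e : OpenPartialHomeomorph M (Cn n)} {φ : OpenPartialHomeomorph N (Cn (n + 1))}
    {P : Cn (n + 1) →L[ℂ] Cn n} {Q : Cn n →L[ℂ] Cn (n + 1)} (A : S.IsAdapted e φ P Q)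
include A

theorem proj_mem_target {p : Cn (n + 1)} (hp : p ∈ φ.target) : P p ∈ e.target := by
  have h := A.proj_eq _ (φ.map_target hp)
  rw [φ.right_inv hp] at h
  rw [← h]
  exact e.map_source (A.mem_source _ (φ.map_target hp))

theorem chartD_dproj {x : N} (hx : x ∈ φ.source) (w : RTangent (n + 1) x) :
    chartD e (S.proj x) (S.dproj x w) = P (chartD φ x w) := by
  have h1 := HasMFDerivAt.comp x
    ((mdifferentiable_chart_real A.base).mdifferentiableAt (A.mem_source x hx)).hasMFDerivAt
    (S.proj_mdifferentiableAt x).hasMFDerivAt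
  have h2 := hasMFDerivAt_comp_chart A.total hx (h := fun q => P q)
    (P.restrictScalars ℝ).differentiableAt
  have h3 : (fun y => P (φ y)) =ᶠ[𝓝 x] e ∘ S.proj := by
    filter_upwards [φ.open_source.mem_nhds hx] with y hy using (A.proj_eq y hy).symm
  have h4 := hasMFDerivAt_unique h1 (h2.congr_of_eventuallyEq h3.symm)
  refine (congrArg (fun f : Cn (n + 1) →L[ℝ] Cn n => f w) h4).trans ?_
  change fderiv ℝ (fun q => (P.restrictScalars ℝ) q) (φ x) (chartD φ x w) = _
  rw [(P.restrictScalars ℝ).fderiv]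
  rfl

theorem chartD_dproj_symm {p : Cn (n + 1)} (hp : p ∈ φ.target) (u : Cn (n + 1)) :
    chartD e (S.proj (φ.symm p)) (S.dproj (φ.symm p) (chartDinv φ p u)) = P u := by
  rw [A.chartD_dproj (φ.map_target hp), chartD_chartDinv A.total hp]

/-- The quotient map is constant on orbits, so its linear expression annihilates their velocity. -/
theorem proj_field {p : Cn (n + 1)} (hp : p ∈ φ.target) : P (locField φ p) = 0 := by
  have hx := φ.map_target hp
  have h1 := hasDerivAt_orbit_zero A.total hx
  have h2 := P.hasFDerivAt.comp_hasDerivAt (0 : ℂ) h1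
  have hc : ContinuousAt (fun w : ℂ => expUnit w • φ.symm p) 0 :=
    ((contMDiff_orbit (m := n + 1) (φ.symm p)).continuous).continuousAt
  have hx' : φ.source ∈ 𝓝 (expUnit 0 • φ.symm p) := by
    rw [expUnit_zero, one_smul]
    exact φ.open_source.mem_nhds hx
  have h3 : (fun w : ℂ => P (φ (expUnit w • φ.symm p))) =ᶠ[𝓝 0]
      fun _ => e (S.proj (φ.symm p)) := by
    filter_upwards [hc hx'] with w hw
    rw [← A.proj_eq _ hw, S.proj_units_smul]
  exact h2.unique ((hasDerivAt_const (0 : ℂ) _).congr_of_eventuallyEq h3)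

/-- A surjection from dimension `n + 1` to dimension `n` has a kernel of dimension one. It contains
the fundamental field, which is nonzero because it is not null. -/
theorem ker_proj {p : Cn (n + 1)} (hp : p ∈ φ.target) (u : Cn (n + 1)) (hu : P u = 0) :
    ∃ a : ℂ, u = a • locField φ p := by
  have hη : locField φ p ≠ 0 := fun h => (S.localSpecial A.total).nonnull p hp (by rw [h]; simp)
  have hsurj : LinearMap.range P.toLinearMap = ⊤ :=
    LinearMap.range_eq_top.2 fun z => ⟨Q z, A.right_inv z⟩
  have h1 := LinearMap.finrank_range_add_finrank_ker P.toLinearMap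
  rw [hsurj, finrank_top] at h1
  simp only [Module.finrank_fin_fun] at h1
  have h2 : Module.finrank ℂ (LinearMap.ker P.toLinearMap) = 1 := by omega
  obtain ⟨a, ha⟩ := (finrank_eq_one_iff_of_nonzero' (⟨locField φ p, A.proj_field hp⟩ :
    LinearMap.ker P.toLinearMap) (fun h => hη (congrArg Subtype.val h))).1 h2 ⟨u, hu⟩
  exact ⟨a, (congrArg Subtype.val ha).symm⟩

end IsAdapted

theorem dproj_surjective (x : N) : Function.Surjective (S.dproj x) := by
  intro v
  obtain ⟨φ, P, Q, A, hx⟩ := S.exists_isAdapted_chartAt x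
  obtain ⟨p, hp, rfl⟩ : ∃ p ∈ φ.target, x = φ.symm p :=
    ⟨φ x, φ.map_source hx, (φ.left_inv hx).symm⟩
  refine ⟨chartDinv φ p (Q (chartD (chartAt (Cn n) (S.proj (φ.symm p))) (S.proj (φ.symm p)) v)),
    chartD_injective A.base (A.mem_source _ hx) ?_⟩
  rw [A.chartD_dproj_symm hp, A.right_inv]

theorem dproj_cplxJ (x : N) (u : RTangent (n + 1) x) :
    S.dproj x (cplxJ (n + 1) x u) = cplxJ n _ (S.dproj x u) :=
  mfderiv_cplxJ (S.proj_contMDiff.contMDiffAt.mdifferentiableAt (by simp)) u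

end ProjSpecialKahler

/-! ### Linear algebra for descending forms -/

theorem exists_clm_of_isLinearMap {E F : Type*} [NormedAddCommGroup E] [NormedSpace ℝ E]
    [FiniteDimensional ℝ E] [NormedAddCommGroup F] [NormedSpace ℝ F] {f : E → F}
    (hf : IsLinearMap ℝ f) : ∃ L : E →L[ℝ] F, ∀ u, L u = f u :=
  ⟨LinearMap.toContinuousLinearMap hf.mk', fun _ => rfl⟩

theorem exists_clm₂_of_isLinearMap {E F : Type*} [NormedAddCommGroup E] [NormedSpace ℝ E]
    [FiniteDimensional ℝ E] [NormedAddCommGroup F] [NormedSpace ℝ F] {f : E → E → F}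
    (h₁ : ∀ v, IsLinearMap ℝ fun u => f u v) (h₂ : ∀ u, IsLinearMap ℝ (f u)) :
    ∃ L : E →L[ℝ] E →L[ℝ] F, ∀ u v, L u v = f u v := by
  choose A hA using fun u => exists_clm_of_isLinearMap (h₂ u)
  obtain ⟨L, hL⟩ := exists_clm_of_isLinearMap (f := A)
    ⟨fun u u' => by ext v; simp [hA, (h₁ v).map_add], fun r u => by ext v; simp [hA, (h₁ v).map_smul]⟩
  exact ⟨L, fun u v => by rw [hL, hA]⟩

theorem fderiv_comp_clm_const {W E F : Type*} [NormedAddCommGroup W] [NormedSpace ℝ W]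
    [NormedAddCommGroup E] [NormedSpace ℝ E] [NormedAddCommGroup F] [NormedSpace ℝ F]
    (T : E →L[ℝ] F) {G : W → E} {p : W} (hG : DifferentiableAt ℝ G p) :
    fderiv ℝ (fun z => T (G z)) p = T.comp (fderiv ℝ G p) :=
  (T.hasFDerivAt.comp p hG.hasFDerivAt).fderiv

section LocalForm

variable {m : ℕ} (G : Cn m → Cn m →L[ℝ] Cn m →L[ℝ] ℝ) (η : Cn m → Cn m) (c : ℝ)

theorem locDdbarLog_add_left (p u u' v : Cn m) : locDdbarLog G η c p (u + u') v
    = locDdbarLog G η c p u v + locDdbarLog G η c p u' v := by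
  simp only [locDdbarLog, hermOf_add_left, locOmega_add]
  ring

theorem locDdbarLog_smul_left (z : ℂ) (p u v : Cn m) :
    locDdbarLog G η c p (z • u) v = z * locDdbarLog G η c p u v := by
  simp only [locDdbarLog, hermOf_smul_left, locOmega_smul]
  ring

variable {G η c} {Γ : Cn m → Cn m →L[ℝ] Cn m →L[ℝ] Cn m} {U : Set (Cn m)}
  (H : LocalSpecial U G Γ η c) {p : Cn m} (hp : p ∈ U)
include H hp

theorem LocalSpecial.conj_locDdbarLog (u v : Cn m) :
    (starRingEnd ℂ) (locDdbarLog G η c p u v) = locDdbarLog G η c p v u := by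
  simp only [locDdbarLog, map_sub, map_div₀, map_mul, (H.isHerm p hp).conj_hermOf,
    Complex.conj_ofReal, Complex.conj_conj]
  ring

theorem LocalSpecial.locDdbarLog_add_right (u v v' : Cn m) : locDdbarLog G η c p u (v + v')
    = locDdbarLog G η c p u v + locDdbarLog G η c p u v' := by
  simp only [← H.conj_locDdbarLog hp _ u, locDdbarLog_add_left, map_add]

theorem LocalSpecial.locDdbarLog_smul_right (z : ℂ) (u v : Cn m) :
    locDdbarLog G η c p u (z • v) = (starRingEnd ℂ) z * locDdbarLog G η c p u v := by
  simp only [← H.conj_locDdbarLog hp _ u, locDdbarLog_smul_left, map_mul]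

/-- `h(η, v) / K = c ω̄(v)` and `ω(η) = c`, so the two terms cancel. This is the infinitesimal
condition for the form to descend to the quotient. -/
theorem LocalSpecial.locDdbarLog_field_left (v : Cn m) : locDdbarLog G η c p (η p) v = 0 := by
  have hK : (locPot G η c p : ℂ) ≠ 0 := by exact_mod_cast H.locPot_ne hp
  have hc : (c : ℂ) ≠ 0 := by exact_mod_cast H.c_ne
  rw [locDdbarLog, H.locOmega_field hp, locOmega]
  simp only [map_div₀, map_mul, (H.isHerm p hp).conj_hermOf, Complex.conj_ofReal]
  field_simp
  ring

theorem LocalSpecial.locDdbarLog_add_field (u v : Cn m) (a b : ℂ) :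
    locDdbarLog G η c p (u + a • η p) (v + b • η p) = locDdbarLog G η c p u v := by
  have h : locDdbarLog G η c p u (η p) = 0 := by
    rw [← H.conj_locDdbarLog hp, H.locDdbarLog_field_left hp, map_zero]
  simp only [locDdbarLog_add_left, H.locDdbarLog_add_right hp, locDdbarLog_smul_left,
    H.locDdbarLog_smul_right hp, H.locDdbarLog_field_left hp, h]
  ring

end LocalForm

/-- A real form of a Hermitian form. -/
theorem exists_isHermBilin {n : ℕ} {h : Cn n → Cn n → ℂ}
    (hadd : ∀ u u' v, h (u + u') v = h u v + h u' v) (hsmul : ∀ (z : ℂ) u v, h (z • u) v = z * h u v)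
    (hconj : ∀ u v, (starRingEnd ℂ) (h u v) = h v u) :
    ∃ B : Cn n →L[ℝ] Cn n →L[ℝ] ℝ, IsHermBilin B ∧ ∀ u v, hermOf B u v = h u v := by
  have hre : ∀ u v, (h u v).re = (h v u).re := fun u v => by rw [← hconj, Complex.conj_re]
  have hl : ∀ v, IsLinearMap ℝ fun u => 2 * (h u v).re := fun v =>
    ⟨fun u u' => by simp [hadd, mul_add], fun r u => by
      rw [← Complex.coe_smul, hsmul, Complex.re_ofReal_mul, smul_eq_mul]
      ring⟩
  obtain ⟨B, hB⟩ := exists_clm₂_of_isLinearMap (f := fun u v => 2 * (h u v).re) hl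
    fun u => by simpa only [hre u] using hl u
  have hH : IsHermBilin B := by
    refine ⟨fun u v => by rw [hB, hB, hre], fun u v => ?_⟩
    have h1 : h (Complex.I • u) (Complex.I • v) = h u v := by
      rw [hsmul, ← hconj, hsmul, map_mul, hconj, Complex.conj_I, ← mul_assoc]
      simp
    rw [hB, hB, h1]
  refine ⟨B, hH, fun u v => ?_⟩
  rw [hH.hermOf_eq_left, hB, hB, hsmul]
  apply Complex.ext <;> simp

/-! ### Existence and uniqueness of the projected metric -/

namespace ProjSpecialKahler

variable {n : ℕ} {N M : Type*} [TopologicalSpace N]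
    [ChartedSpace (Cn (n + 1)) N] [IsManifold 𝓘(ℂ, Cn (n + 1)) ω N] [TopologicalSpace M]
    [ChartedSpace (Cn n) M] [IsManifold 𝓘(ℂ, Cn n) ω M] [MulAction ℂˣ N]
    [ContMDiffSMul 𝓘(ℂ, ℂ) 𝓘(ℂ, Cn (n + 1)) ω ℂˣ N] (S : ProjSpecialKahler n N M)

/-- The connection form `ω = ∂ log |K|`. -/
def omegaForm (x : N) (u : RTangent (n + 1) x) : ℂ :=
  hermPart (cplxJ (n + 1) x) (fun a b => S.metric x a b) u (fundField (n + 1) x)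
    / (S.c * S.potential x)

/-- The form `∂ ∂̄ log |K|`. -/
def logForm (x : N) (u v : RTangent (n + 1) x) : ℂ :=
  hermPart (cplxJ (n + 1) x) (fun a b => S.metric x a b) u v / S.potential x
    - S.omegaForm x u * (starRingEnd ℂ) (S.omegaForm x v)

section Chart

variable {e : OpenPartialHomeomorph N (Cn (n + 1))}

theorem omegaForm_symm (he : e ∈ holoAtlas (n + 1) N) {p : Cn (n + 1)} (hp : p ∈ e.target)
    (u : Cn (n + 1)) : S.omegaForm (e.symm p) (chartDinv e p u)
      = locOmega (inChart S.metric e) (locField e) S.c p u := by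
  rw [omegaForm, locOmega, hermOf_inChart he hp, chartComp_symm he hp, S.potential_eq he hp]

theorem logForm_symm (he : e ∈ holoAtlas (n + 1) N) {p : Cn (n + 1)} (hp : p ∈ e.target)
    (u v : Cn (n + 1)) : S.logForm (e.symm p) (chartDinv e p u) (chartDinv e p v)
      = locDdbarLog (inChart S.metric e) (locField e) S.c p u v := by
  rw [logForm, locDdbarLog, hermOf_inChart he hp, S.omegaForm_symm he hp, S.omegaForm_symm he hp,
    S.potential_eq he hp]

end Chart

/-- The Hermitian form `B` on the tangent space of `M` pulls back to `± ∂ ∂̄ log |K|` at `x`. -/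
structure IsPullback (x : N) (B : Cn n →L[ℝ] Cn n →L[ℝ] ℝ) : Prop where
  isHerm : IsHermBilin B
  pullback : ∀ u v, hermOf B (S.dproj x u) (S.dproj x v)
    = Real.sign (S.potential x) * S.logForm x u v

theorem IsPullback.unique {S : ProjSpecialKahler n N M} {x : N} {B B' : Cn n →L[ℝ] Cn n →L[ℝ] ℝ}
    (h : S.IsPullback x B) (h' : S.IsPullback x B') : B = B' := by
  refine h.isHerm.ext_hermOf h'.isHerm fun u v => ?_
  obtain ⟨u, rfl⟩ := S.dproj_surjective x u
  obtain ⟨v, rfl⟩ := S.dproj_surjective x v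
  exact (h.pullback u v).trans (h'.pullback u v).symm

/-- In an adapted chart the form is defined through the linear lift `Q`. Any other lift differs by a
multiple of `η`, which is a null direction. -/
theorem exists_isPullback (x : N) : ∃ B, S.IsPullback x B := by
  obtain ⟨φ, P, Q, A, hx⟩ := S.exists_isAdapted_chartAt x
  set e := chartAt (Cn n) (S.proj x)
  obtain ⟨p, hp, rfl⟩ : ∃ p ∈ φ.target, x = φ.symm p :=
    ⟨φ x, φ.map_source hx, (φ.left_inv hx).symm⟩
  have H := S.localSpecial A.total
  let D : Cn n →L[ℝ] Cn n := chartD e (S.proj (φ.symm p))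
  have hD : ∀ z : ℂ, ∀ u, D (z • u) = z • D u := fun z u =>
    map_complex_smul_of_I (f := D) (fun u => chartD_cplxJ A.base (A.mem_source _ hx) u) z u
  obtain ⟨B, hB, hB'⟩ := exists_isHermBilin (n := n) (h := fun u v =>
    Real.sign (S.potential (φ.symm p))
      * locDdbarLog (inChart S.metric φ) (locField φ) S.c p (Q (D u)) (Q (D v)))
    (fun u u' v => by simp only [map_add, locDdbarLog_add_left, mul_add])
    (fun z u v => by
      simp only [hD, map_smul, locDdbarLog_smul_left]
      ring)
    (fun u v => by simp only [map_mul, Complex.conj_ofReal, H.conj_locDdbarLog hp])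
  refine ⟨B, hB, fun u v => ?_⟩
  have key : ∀ u : RTangent (n + 1) (φ.symm p), ∃ a : ℂ,
      Q (D (S.dproj (φ.symm p) u)) = chartD φ (φ.symm p) u + a • locField φ p := by
    intro u
    obtain ⟨a, ha⟩ := A.ker_proj hp (Q (P (chartD φ (φ.symm p) u)) - chartD φ (φ.symm p) u)
      (by rw [map_sub, A.right_inv, sub_self])
    refine ⟨a, ?_⟩
    rw [← ha, add_sub_cancel]
    exact congrArg Q (A.chartD_dproj hx u)
  obtain ⟨a, ha⟩ := key u
  obtain ⟨b, hb⟩ := key v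
  refine (hB' _ _).trans ?_
  rw [ha, hb, H.locDdbarLog_add_field hp, ← S.logForm_symm A.total hp,
    chartDinv_chartD A.total hp, chartDinv_chartD A.total hp]

theorem expUnit_surjective (b : ℂˣ) : ∃ z, expUnit z = b :=
  ⟨Complex.log b, Units.ext (Complex.exp_log b.ne_zero)⟩

theorem exists_potential_smul (b : ℂˣ) :
    ∃ r : ℝ, 0 < r ∧ ∀ x, S.potential (b • x) = r * S.potential x := by
  obtain ⟨z, rfl⟩ := expUnit_surjective b
  exact ⟨_, pow_pos (norm_pos_iff.2 (Complex.exp_ne_zero _)) 2, S.potential_orbit z⟩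

/-- The action of an element of `ℂˣ`, followed by a chart. -/
def smulChart (b : ℂˣ) (e : OpenPartialHomeomorph N (Cn (n + 1))) :
    OpenPartialHomeomorph N (Cn (n + 1)) :=
  Homeomorph.transOpenPartialHomeomorph
    { MulAction.toPerm b with
      continuous_toFun := (contMDiff_units_smul (m := n + 1) b).continuous
      continuous_invFun := (contMDiff_units_smul (m := n + 1) b⁻¹).continuous } e

section SmulChart

variable (b : ℂˣ) {e : OpenPartialHomeomorph N (Cn (n + 1))}

theorem smulChart_symm (p : Cn (n + 1)) : (smulChart b e).symm p = b⁻¹ • e.symm p := rfl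

theorem smulChart_mem (he : e ∈ holoAtlas (n + 1) N) : smulChart b e ∈ holoAtlas (n + 1) N := by
  refine OpenPartialHomeomorph.mem_maximalAtlas_of_contMDiffOn _
    (fun y hy => ContMDiffAt.contMDiffWithinAt ?_) fun q hq => ContMDiffAt.contMDiffWithinAt ?_
  · exact ContMDiffAt.comp (g := e) (f := fun y => b • y) y
      (contMDiffAt_of_mem_maximalAtlas he hy) (contMDiff_units_smul b).contMDiffAt
  · exact ContMDiffAt.comp (g := fun y => b⁻¹ • y) (f := e.symm) q
      (contMDiff_units_smul b⁻¹).contMDiffAt (contMDiffAt_symm_of_mem_maximalAtlas he hq)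

theorem dproj_chartDinv (he : e ∈ holoAtlas (n + 1) N) {p : Cn (n + 1)} (hp : p ∈ e.target)
    (u : Cn (n + 1)) : S.dproj (e.symm p) (chartDinv e p u)
      = mfderiv 𝓘(ℝ, Cn (n + 1)) 𝓘(ℝ, Cn n) (fun q => S.proj (e.symm q)) p u := by
  have h := mfderiv_comp p (S.proj_mdifferentiableAt (e.symm p))
    ((contMDiffAt_chart_symm he hp).mdifferentiableAt (by simp))
  exact (congrArg (fun f : Cn (n + 1) →L[ℝ] Cn n => f u) h).symm

theorem dproj_smulChart (he : e ∈ holoAtlas (n + 1) N) {p : Cn (n + 1)} (hp : p ∈ e.target)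
    (u : Cn (n + 1)) : (S.dproj ((smulChart b e).symm p) (chartDinv (smulChart b e) p u) : Cn n)
      = S.dproj (e.symm p) (chartDinv e p u) := by
  have h : (fun q => S.proj ((smulChart b e).symm q)) = fun q => S.proj (e.symm q) :=
    funext fun q => S.proj_units_smul _ _
  refine (S.dproj_chartDinv (smulChart_mem b he) hp u).trans (Eq.trans ?_
    (S.dproj_chartDinv he hp u).symm)
  exact congrArg (fun f => (mfderiv 𝓘(ℝ, Cn (n + 1)) 𝓘(ℝ, Cn n) f p : Cn (n + 1) →L[ℝ] Cn n) u) h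

/-- The translated chart gives a translated point the same coordinates. There `K` is multiplied by a
positive constant, so `log |K|` changes by an additive constant, which the derivatives do not see.
-/
theorem logForm_smulChart (he : e ∈ holoAtlas (n + 1) N) {p : Cn (n + 1)} (hp : p ∈ e.target)
    (u v : Cn (n + 1)) :
    S.logForm ((smulChart b e).symm p) (chartDinv (smulChart b e) p u)
      (chartDinv (smulChart b e) p v)
      = S.logForm (e.symm p) (chartDinv e p u) (chartDinv e p v) := by
  obtain ⟨r, hr, h⟩ := S.exists_potential_smul b⁻¹
  rw [S.logForm_symm he hp, S.logForm_symm (smulChart_mem b he) hp, ← S.ddbar_log_potential he hp,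
    ← S.ddbar_log_potential (smulChart_mem b he) hp]
  have h1 : (fun q => Real.log |S.potential ((smulChart b e).symm q)|)
      = fun q => Real.log r + Real.log |S.potential (e.symm q)| := by
    funext q
    rw [smulChart_symm, h, abs_mul, abs_of_pos hr,
      Real.log_mul hr.ne' (abs_ne_zero.2 (S.potential_ne_zero _))]
  have h2 : fderiv ℝ (fun q => Real.log r + Real.log |S.potential (e.symm q)|)
      = fderiv ℝ (fun q => Real.log |S.potential (e.symm q)|) := by
    funext q
    exact fderiv_const_add _
  rw [ddbar, ddbar, h1, h2]

end SmulChart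

/-- Both `∂∂̄ log |K|` and the sign of `K` are invariant under the action, so one form on the
tangent space of `M` serves the whole fibre. -/
theorem IsPullback.smul {S : ProjSpecialKahler n N M} {x : N} {B : Cn n →L[ℝ] Cn n →L[ℝ] ℝ}
    (h : S.IsPullback x B) (b : ℂˣ) : S.IsPullback (b • x) B := by
  obtain ⟨e, he, hx⟩ : ∃ e ∈ holoAtlas (n + 1) N, b • x ∈ e.source :=
    ⟨_, IsManifold.chart_mem_maximalAtlas _, mem_chart_source _ _⟩
  obtain ⟨p, hp, hpx⟩ : ∃ p ∈ e.target, b • x = e.symm p :=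
    ⟨e (b • x), e.map_source hx, (e.left_inv hx).symm⟩
  obtain rfl : x = (smulChart b e).symm p := by rw [smulChart_symm, ← hpx, inv_smul_smul]
  rw [hpx]
  refine ⟨h.isHerm, fun u v => ?_⟩
  obtain ⟨r, hr, hr'⟩ := S.exists_potential_smul b⁻¹
  have hs : Real.sign (S.potential ((smulChart b e).symm p)) = Real.sign (S.potential (e.symm p)) := by
    rw [smulChart_symm, hr']
    rcases (S.potential_ne_zero (e.symm p)).lt_or_gt with h | h
    · rw [Real.sign_of_neg h, Real.sign_of_neg (mul_neg_of_pos_of_neg hr h)]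
    · rw [Real.sign_of_pos h, Real.sign_of_pos (mul_pos hr h)]
  rw [← chartDinv_chartD he hp u, ← chartDinv_chartD he hp v, ← S.logForm_smulChart b he hp, ← hs,
    ← h.pullback]
  exact congrArg₂ (hermOf B) (S.dproj_smulChart b he hp _).symm (S.dproj_smulChart b he hp _).symm

/-- Fields of forms on `M` that pull back to `± ∂ ∂̄ log |K|`. -/
def IsPullbackField (g : BilinField n M) : Prop := ∀ x, S.IsPullback x (g (S.proj x))

theorem exists_isPullbackField : ∃ g, S.IsPullbackField g := by
  -- An arbitrary set-theoretic section suffices: invariance along the fibres makes the choice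
  -- irrelevant, and smoothness is recovered afterwards in adapted charts.
  choose σ hσ using S.proj_surjective
  choose B hB using S.exists_isPullback
  refine ⟨fun y => B (σ y), fun x => ?_⟩
  obtain ⟨b, hb⟩ := (S.proj_eq_iff _ _).1 (hσ (S.proj x))
  have h := (hB (σ (S.proj x))).smul b
  rwa [hb] at h

theorem IsPullbackField.unique {S : ProjSpecialKahler n N M} {g g' : BilinField n M}
    (h : S.IsPullbackField g) (h' : S.IsPullbackField g') : g = g' := by
  funext y
  obtain ⟨x, rfl⟩ := S.proj_surjective y
  exact (h x).unique (h' x)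

theorem IsProjectedMetric.isPullbackField {S : ProjSpecialKahler n N M} {g : BilinField n M}
    (h : S.IsProjectedMetric g) : S.IsPullbackField g := by
  intro x
  refine ⟨⟨h.1.symm _, h.1.hermitian _⟩, fun u v => ?_⟩
  obtain ⟨e, he, hx⟩ : ∃ e ∈ holoAtlas (n + 1) N, x ∈ e.source :=
    ⟨_, IsManifold.chart_mem_maximalAtlas _, mem_chart_source _ _⟩
  obtain ⟨p, hp, rfl⟩ : ∃ p ∈ e.target, x = e.symm p :=
    ⟨e x, e.map_source hx, (e.left_inv hx).symm⟩
  rw [← chartDinv_chartD he hp u, ← chartDinv_chartD he hp v, S.logForm_symm he hp,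
    ← S.ddbar_log_potential he hp]
  exact h.2 e he p hp _ _

namespace IsPullbackField

variable {S} {g : BilinField n M} (h : S.IsPullbackField g)
include h

theorem symm (y : M) (u v : RTangent n y) : g y u v = g y v u := by
  obtain ⟨x, rfl⟩ := S.proj_surjective y
  exact (h x).isHerm.symm u v

theorem hermitian (y : M) (u v : RTangent n y) : g y (cplxJ n y u) (cplxJ n y v) = g y u v := by
  obtain ⟨x, rfl⟩ := S.proj_surjective y
  exact (h x).isHerm.inv u v

/-- The projection in adapted charts. -/
theorem localProjection {e : OpenPartialHomeomorph M (Cn n)}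
    {φ : OpenPartialHomeomorph N (Cn (n + 1))} {P : Cn (n + 1) →L[ℂ] Cn n}
    {Q : Cn n →L[ℂ] Cn (n + 1)} (A : S.IsAdapted e φ P Q) :
    LocalProjection φ.target (inChart S.metric φ) (connCoeff S.nab φ) (locField φ) S.c P Q
      (inChart g e) where
  toLocalSpecial := S.localSpecial A.total
  right_inv := A.right_inv
  proj_field _ hp := A.proj_field hp
  ker_proj _ hp := A.ker_proj hp
  isHerm_proj _ hp := isHermBilin_inChart h.symm h.hermitian A.base (A.proj_mem_target hp)
  proj_metric p hp u v := by
    have hy := φ.map_target hp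
    have h1 := A.proj_eq _ hy
    rw [φ.right_inv hp] at h1
    rw [← A.chartD_dproj_symm hp u, ← A.chartD_dproj_symm hp v, ← h1,
      hermOf_inChart_chartD g A.base (A.mem_source _ hy), ← S.potential_eq A.total hp,
      ← S.logForm_symm A.total hp]
    exact (h _).pullback _ _

theorem exists_localProjection {e : OpenPartialHomeomorph M (Cn n)} (he : e ∈ holoAtlas n M)
    {q : Cn n} (hq : q ∈ e.target) :
    ∃ (φ : OpenPartialHomeomorph N (Cn (n + 1))) (P : Cn (n + 1) →L[ℂ] Cn n)
      (Q : Cn n →L[ℂ] Cn (n + 1)), LocalProjection φ.target (inChart S.metric φ)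
        (connCoeff S.nab φ) (locField φ) S.c P Q (inChart g e) ∧ ∃ p ∈ φ.target, P p = q := by
  obtain ⟨x, hx⟩ := S.proj_surjective (e.symm q)
  have hxe : S.proj x ∈ e.source := by
    rw [hx]
    exact e.map_target hq
  obtain ⟨φ, P, Q, A, hxφ⟩ := S.exists_isAdapted he hxe
  refine ⟨φ, P, Q, h.localProjection A, φ x, φ.map_source hxφ, ?_⟩
  rw [← A.proj_eq x hxφ, hx, e.right_inv hq]

/-- Smoothness, nondegeneracy and closedness are local, and each is read off in a chart adapted to
the given chart of `M` near a point of the fibre. -/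
theorem isPseudoKahler : IsPseudoKahler g where
  smooth e he q hq := by
    obtain ⟨φ, P, Q, L, p, hp, rfl⟩ := h.exists_localProjection he hq
    exact (L.proj_metric_smooth hp).contDiffWithinAt
  symm := h.symm
  nondegenerate y u hu := by
    have he : chartAt (Cn n) y ∈ holoAtlas n M := IsManifold.chart_mem_maximalAtlas _
    set e := chartAt (Cn n) y
    have hy : y ∈ e.source := mem_chart_source _ _
    obtain ⟨φ, P, Q, L, p, hp, hpq⟩ := h.exists_localProjection he (e.map_source hy)
    refine chartD_injective he hy ((L.proj_nondeg hp _ fun v => ?_).trans (map_zero _).symm)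
    obtain ⟨v, rfl⟩ : ∃ w, v = chartD e y w :=
      ⟨_, ((isInvertible_chartD he hy).self_apply_inverse v).symm⟩
    rw [hpq, inChart_chartD g he hy, hu]
  hermitian := h.hermitian
  closed e he q hq u v w := by
    obtain ⟨φ, P, Q, L, p, hp, rfl⟩ := h.exists_localProjection he hq
    have hd : DifferentiableAt ℝ (inChart g e) (P p) :=
      (L.proj_metric_smooth hp).differentiableAt (by simp)
    let T : (Cn n →L[ℝ] Cn n →L[ℝ] ℝ) →L[ℝ] (Cn n →L[ℝ] Cn n →L[ℝ] ℝ) :=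
      ContinuousLinearMap.compL ℝ (Cn n) (Cn n →L[ℝ] ℝ) (Cn n →L[ℝ] ℝ)
        (ContinuousLinearMap.precomp ℝ (multI n))
    have h1 : inChart (fundForm g) e =ᶠ[𝓝 (P p)] fun z => T (inChart g e z) := by
      filter_upwards [e.open_target.mem_nhds hq] with z hz
      ext a b
      change g (e.symm z) (chartDinv e z a) (cplxJ n _ (chartDinv e z b))
        = g (e.symm z) (chartDinv e z a) (chartDinv e z (Complex.I • b))
      rw [chartDinv_I he hz]
    have h2 : ∀ a b d, fderiv ℝ (inChart (fundForm g) e) (P p) a b d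
        = fderiv ℝ (inChart g e) (P p) a b (Complex.I • d) := by
      intro a b d
      rw [h1.fderiv_eq, fderiv_comp_clm_const (W := Cn n) (E := Cn n →L[ℝ] Cn n →L[ℝ] ℝ)
        (F := Cn n →L[ℝ] Cn n →L[ℝ] ℝ) T hd]
      rfl
    rw [h2, h2, h2]
    exact L.proj_closed hp u v w

theorem isProjectedMetric : S.IsProjectedMetric g := by
  refine ⟨h.isPseudoKahler, fun e he p hp u v => ?_⟩
  rw [S.ddbar_log_potential he hp, ← S.logForm_symm he hp]
  exact (h (e.symm p)).pullback _ _

end IsPullbackField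

theorem existsUnique_isProjectedMetric : ∃! g : BilinField n M, S.IsProjectedMetric g := by
  obtain ⟨g, hg⟩ := S.exists_isPullbackField
  exact ⟨g, hg.isProjectedMetric, fun g' hg' => hg'.isPullbackField.unique hg⟩

end ProjSpecialKahler

/-! ### Existence and uniqueness of the descended cubic form -/

namespace ProjSpecialKahler

variable {n : ℕ} {N M : Type*} [TopologicalSpace N]
    [ChartedSpace (Cn (n + 1)) N] [IsManifold 𝓘(ℂ, Cn (n + 1)) ω N] [TopologicalSpace M]
    [ChartedSpace (Cn n) M] [IsManifold 𝓘(ℂ, Cn n) ω M] [MulAction ℂˣ N]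
    [ContMDiffSMul 𝓘(ℂ, ℂ) 𝓘(ℂ, Cn (n + 1)) ω ℂˣ N] (S : ProjSpecialKahler n N M)

section Chart

variable {e : OpenPartialHomeomorph N (Cn (n + 1))} (he : e ∈ holoAtlas (n + 1) N)
  {p : Cn (n + 1)} (hp : p ∈ e.target)
include he hp

/-- Horizontality is defined by the derivative of `log |K|`; this replaces it by the algebraic
condition `h(u, η) = 0` up to a nonzero factor. -/
theorem isHorizontal_symm_iff (u : Cn (n + 1)) : S.IsHorizontal (e.symm p) (chartDinv e p u)
    ↔ locOmega (inChart S.metric e) (locField e) S.c p u = 0 := by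
  have H := S.localSpecial he
  have hx := e.map_target hp
  have h1 : (fun y => Real.log |S.potential y|) =ᶠ[𝓝 (e.symm p)]
      fun y => (fun q => Real.log |locPot (inChart S.metric e) (locField e) S.c q|) (e y) := by
    filter_upwards [S.potential_comp_chart he hx] with y hy
    rw [hy]
  have h2 := (hasMFDerivAt_comp_chart he hx
    (h := fun q => Real.log |locPot (inChart S.metric e) (locField e) S.c q|) (by
      rw [e.right_inv hp]
      exact (H.log_smoothAt hp).differentiableAt (by simp))).congr_of_eventuallyEq h1
  have h3 : ∀ u, rdiff (n := n + 1) (fun y => Real.log |S.potential y|) (e.symm p) (chartDinv e p u)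
      = fderiv ℝ (fun q => Real.log |locPot (inChart S.metric e) (locField e) S.c q|) p u := by
    intro u
    refine (congrArg (fun f : Cn (n + 1) →L[ℝ] ℝ => f (chartDinv e p u)) h2.mfderiv).trans ?_
    change fderiv ℝ _ _ (chartD e (e.symm p) (chartDinv e p u)) = _
    rw [chartD_chartDinv he hp, e.right_inv hp]
  rw [IsHorizontal, extHol, ← chartDinv_I he hp, h3, h3, H.locOmega_eq hp]

/-- The cubic form in a chart. -/
theorem cubicForm_symm (u v : Cn (n + 1)) {W : VField (n + 1) N} (hW : SmoothNear W (e.symm p)) :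
    cubicForm S.metric S.nab (e.symm p) (chartDinv e p u) (chartDinv e p v) W
      = locCubic (inChart S.metric e) (connCoeff S.nab e) p u v (chartComp e W p) := by
  have H := S.localSpecial he
  have hS := H.isSpecial p hp
  have hs := hW.self_of_nhds.of_le (show (1 : ℕ∞ω) ≤ ∞ by exact_mod_cast le_top)
  have h1 := covariantDerivative_of_chartComp he S.nab hp (W := W)
    (chartComp_contDiffAt he hp (k := 1) hs) (Filter.Eventually.of_forall fun q => rfl) v
  have h2 := covariantDerivative_applyJ he S.nab hp hs v
  set w := chartComp e W p
  have h3 : S.nab (applyJ W) (e.symm p) (chartDinv e p v)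
      - cplxJ (n + 1) (e.symm p) (S.nab W (e.symm p) (chartDinv e p v))
      = chartDinv e p ((-2 * Complex.I) • antiPart (connCoeff S.nab e p) v w) := by
    rw [h1, h2, ← chartDinv_I he hp]
    refine (map_sub (chartDinv e p) _ _).symm.trans (congrArg _ ?_)
    rw [holPart_add_antiPart (connCoeff S.nab e p) v (Complex.I • w),
      holPart_add_antiPart (connCoeff S.nab e p) v w, hS.holPart_I_right, hS.antiPart_I_right]
    module
  have h4 : ∀ a, fundForm S.metric (e.symm p) (chartDinv e p a)
      (chartDinv e p ((-2 * Complex.I) • antiPart (connCoeff S.nab e p) v w))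
      = 2 * inChart S.metric e p a (antiPart (connCoeff S.nab e p) v w) := by
    intro a
    have h5 : Complex.I • (-2 * Complex.I) • antiPart (connCoeff S.nab e p) v w
        = (2 : ℝ) • antiPart (connCoeff S.nab e p) v w := by
      rw [smul_smul, ← Complex.coe_smul]
      congr 1
      linear_combination (norm := (push_cast; ring)) -2 * Complex.I_sq
    change S.metric (e.symm p) (chartDinv e p a) (cplxJ (n + 1) _ _) = _
    rw [← chartDinv_I he hp, ← inChart_apply, h5, map_smul, smul_eq_mul]
  rw [cubicForm, h3, locCubic, (H.isHerm p hp).hermOf_eq_left, extHol, ← chartDinv_I he hp, h4, h4]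
  push_cast
  ring

theorem dproj_field : S.dproj (e.symm p) (chartDinv e p (locField e p)) = 0 := by
  obtain ⟨φ, P, Q, A, hx⟩ := S.exists_isAdapted_chartAt (e.symm p)
  refine chartD_injective A.base (A.mem_source _ hx) ?_
  rw [A.chartD_dproj hx, chartComp_symm he hp, map_zero]
  have h := A.proj_field (φ.map_source hx)
  rwa [locField, chartComp, φ.left_inv hx] at h

end Chart

/-- The pointwise form of the descent of the cubic form. -/
theorem exists_descendedCubic_at (x : N) : ∃ T : Cn n →L[ℝ] Cn n →L[ℝ] Cn n →L[ℝ] ℂ,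
    ∀ (u v : RTangent (n + 1) x) (W : VField (n + 1) N), SmoothNear W x →
      T (S.dproj x u) (S.dproj x v) (S.dproj x (W x)) = cubicForm S.metric S.nab x u v W := by
  obtain ⟨φ, P, Q, A, hx⟩ := S.exists_isAdapted_chartAt x
  set e := chartAt (Cn n) (S.proj x)
  obtain ⟨p, hp, rfl⟩ : ∃ p ∈ φ.target, x = φ.symm p :=
    ⟨φ x, φ.map_source hx, (φ.left_inv hx).symm⟩
  have H := S.localSpecial A.total
  let D : Cn n →L[ℝ] Cn n := chartD e (S.proj (φ.symm p))
  -- The lifts by `Q` need not be horizontal: the cubic form annihilates `η`, so every lift gives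
  -- the same value.
  let f : Cn n → Cn n → Cn n → ℂ := fun a b d =>
    locCubic (inChart S.metric φ) (connCoeff S.nab φ) p (Q (D a)) (Q (D b)) (Q (D d))
  have hr : ∀ (r : ℝ) a, Q (D (r • a)) = (r : ℂ) • Q (D a) := fun r a => by
    rw [map_smul, ← Complex.coe_smul, map_smul]
  choose T₂ hT₂ using fun a => exists_clm₂_of_isLinearMap (f := f a)
    (fun d => ⟨fun b b' => by simp only [f, map_add, H.locCubic_add_mid hp],
      fun r b => by simp only [f, hr, H.locCubic_smul_mid hp, Complex.real_smul]⟩)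
    (fun b => ⟨fun d d' => by simp only [f, map_add, H.locCubic_add_right hp],
      fun r d => by simp only [f, hr, H.locCubic_smul_right hp, Complex.real_smul]⟩)
  obtain ⟨T, hT⟩ := exists_clm_of_isLinearMap (f := T₂)
    ⟨fun a a' => by
      ext b d
      simp only [add_apply, hT₂, f, map_add, locCubic_add_left],
    fun r a => by
      ext b d
      simp only [smul_apply, hT₂, f, hr, locCubic_smul_left, Complex.real_smul]⟩
  refine ⟨T, fun u v W hW => ?_⟩
  have key : ∀ u : RTangent (n + 1) (φ.symm p), ∃ a : ℂ,
      Q (D (S.dproj (φ.symm p) u)) = chartD φ (φ.symm p) u + a • locField φ p := by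
    intro u
    obtain ⟨a, ha⟩ := A.ker_proj hp (Q (P (chartD φ (φ.symm p) u)) - chartD φ (φ.symm p) u)
      (by rw [map_sub, A.right_inv, sub_self])
    refine ⟨a, ?_⟩
    rw [← ha, add_sub_cancel]
    exact congrArg Q (A.chartD_dproj hx u)
  obtain ⟨a, ha⟩ := key u
  obtain ⟨b, hb⟩ := key v
  obtain ⟨d, hd⟩ := key (W (φ.symm p))
  have h1 : T (S.dproj (φ.symm p) u) (S.dproj (φ.symm p) v) (S.dproj (φ.symm p) (W (φ.symm p)))
      = f (S.dproj (φ.symm p) u) (S.dproj (φ.symm p) v) (S.dproj (φ.symm p) (W (φ.symm p))) :=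
    (congrArg (fun L : Cn n →L[ℝ] Cn n →L[ℝ] ℂ => L (S.dproj (φ.symm p) v)
      (S.dproj (φ.symm p) (W (φ.symm p)))) (hT _)).trans (hT₂ _ _ _)
  refine h1.trans ?_
  simp only [f]
  rw [ha, hb, hd, H.locCubic_add_field hp, ← chartDinv_chartD A.total hp u,
    ← chartDinv_chartD A.total hp v, S.cubicForm_symm A.total hp _ _ hW,
    chartDinv_chartD A.total hp, chartDinv_chartD A.total hp]
  rfl

theorem exists_isDescendedCubic : ∃ Xi, S.IsDescendedCubic Xi := by
  choose T hT using S.exists_descendedCubic_at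
  exact ⟨T, fun x u v W _ _ hW _ => hT x u v W hW⟩

namespace IsDescendedCubic

variable {S} {Xi : S.CubicFamily} (h : S.IsDescendedCubic Xi)
include h

/-- The defining property concerns horizontal vectors only. Adding a multiple of `η` makes any
vector horizontal and changes neither its projection nor the cubic form, so the formula holds for
all lifts. -/
theorem apply_symm {e : OpenPartialHomeomorph N (Cn (n + 1))} (he : e ∈ holoAtlas (n + 1) N)
    {p : Cn (n + 1)} (hp : p ∈ e.target) (u v w : Cn (n + 1)) :
    Xi (e.symm p) (S.dproj (e.symm p) (chartDinv e p u)) (S.dproj (e.symm p) (chartDinv e p v))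
      (S.dproj (e.symm p) (chartDinv e p w))
      = locCubic (inChart S.metric e) (connCoeff S.nab e) p u v w := by
  have H := S.localSpecial he
  have hc : (S.c : ℂ) ≠ 0 := by exact_mod_cast S.c_ne_zero
  have key : ∀ u, ∃ a : ℂ, S.IsHorizontal (e.symm p) (chartDinv e p (u + a • locField e p)) ∧
      S.dproj (e.symm p) (chartDinv e p (u + a • locField e p))
        = S.dproj (e.symm p) (chartDinv e p u) := by
    intro u
    -- The coefficient is dictated by `ω(η) = c`.
    refine ⟨-(locOmega (inChart S.metric e) (locField e) S.c p u / S.c), ?_, ?_⟩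
    · rw [S.isHorizontal_symm_iff he hp, locOmega_add, locOmega_smul, H.locOmega_field hp]
      field_simp
      ring
    · generalize -(locOmega (inChart S.metric e) (locField e) S.c p u / S.c) = a
      have h1 : S.dproj (e.symm p) (chartDinv e p (a • locField e p)) = 0 := by
        rw [complex_smul_eq]
        have h0 := S.dproj_field he hp
        have h2 : S.dproj (e.symm p) (chartDinv e p (Complex.I • locField e p)) = 0 := by
          rw [chartDinv_I he hp, S.dproj_cplxJ, h0, map_zero]
        have h3 := ((S.dproj (e.symm p)).comp (chartDinv e p)).map_add
          (a.re • locField e p) (a.im • Complex.I • locField e p)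
        rw [map_smul, map_smul] at h3
        refine h3.trans ?_
        change a.re • S.dproj (e.symm p) (chartDinv e p (locField e p))
          + a.im • S.dproj (e.symm p) (chartDinv e p (Complex.I • locField e p)) = 0
        rw [h0, h2, smul_zero, smul_zero, add_zero]
      refine (((S.dproj (e.symm p)).comp (chartDinv e p)).map_add u _).trans ?_
      change S.dproj (e.symm p) (chartDinv e p u)
        + S.dproj (e.symm p) (chartDinv e p (a • locField e p)) = _
      rw [h1, add_zero]
  obtain ⟨a, ha, ha'⟩ := key u
  obtain ⟨b, hb, hb'⟩ := key v
  obtain ⟨d, hd, hd'⟩ := key w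
  have hx := e.map_target hp
  have hW := smoothNear_const he hx (w + d • locField e p)
  have hWx := chartField_symm he hp fun _ => w + d • locField e p
  have h1 := h (e.symm p) _ _ (chartField e fun _ => w + d • locField e p) ha hb hW
    (by rwa [hWx])
  rw [S.cubicForm_symm he hp _ _ hW, hWx, chartComp_chartField he hp, H.locCubic_add_field hp,
    ha', hb', hd'] at h1
  exact h1

end IsDescendedCubic

theorem existsUnique_isDescendedCubic : ∃! Xi : S.CubicFamily, S.IsDescendedCubic Xi := by
  obtain ⟨Xi, hXi⟩ := S.exists_isDescendedCubic
  refine ⟨Xi, hXi, fun Xi' hXi' => ?_⟩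
  funext x
  obtain ⟨e, he, hx⟩ : ∃ e ∈ holoAtlas (n + 1) N, x ∈ e.source :=
    ⟨_, IsManifold.chart_mem_maximalAtlas _, mem_chart_source _ _⟩
  obtain ⟨p, hp, rfl⟩ : ∃ p ∈ e.target, x = e.symm p :=
    ⟨e x, e.map_source hx, (e.left_inv hx).symm⟩
  ext u v w
  obtain ⟨u, rfl⟩ := S.dproj_surjective _ u
  obtain ⟨v, rfl⟩ := S.dproj_surjective _ v
  obtain ⟨w, rfl⟩ := S.dproj_surjective _ w
  rw [← chartDinv_chartD he hp u, ← chartDinv_chartD he hp v, ← chartDinv_chartD he hp w,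
    hXi.apply_symm he hp, hXi'.apply_symm he hp]

end ProjSpecialKahler

/-! ### Holomorphy and homogeneity of the descended cubic form -/

namespace ProjSpecialKahler

variable {n : ℕ} {N M : Type*} [TopologicalSpace N]
    [ChartedSpace (Cn (n + 1)) N] [IsManifold 𝓘(ℂ, Cn (n + 1)) ω N] [TopologicalSpace M]
    [ChartedSpace (Cn n) M] [IsManifold 𝓘(ℂ, Cn n) ω M] [MulAction ℂˣ N]
    [ContMDiffSMul 𝓘(ℂ, ℂ) 𝓘(ℂ, Cn (n + 1)) ω ℂˣ N] {S : ProjSpecialKahler n N M}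

namespace IsAdapted

variable {e : OpenPartialHomeomorph M (Cn n)} {φ : OpenPartialHomeomorph N (Cn (n + 1))}
    {P : Cn (n + 1) →L[ℂ] Cn n} {Q : Cn n →L[ℂ] Cn (n + 1)} (A : S.IsAdapted e φ P Q)
include A

/-- In an adapted chart `P` annihilates the field identically; differentiating puts its derivative
in the kernel of `P`. -/
theorem fderiv_field {p : Cn (n + 1)} (hp : p ∈ φ.target) (u : Cn (n + 1)) :
    ∃ a : ℂ, fderiv ℝ (locField φ) p u = a • locField φ p := by
  refine A.ker_proj hp _ ?_
  have h1 : (fun q => (P.restrictScalars ℝ) (locField φ q)) =ᶠ[𝓝 p] fun _ => 0 := by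
    filter_upwards [φ.open_target.mem_nhds hp] with q hq using A.proj_field hq
  have h2 := fderiv_comp_clm_const (P.restrictScalars ℝ)
    ((S.localSpecial A.total).field_diff_real hp)
  rw [h1.fderiv_eq, fderiv_fun_const] at h2
  exact (congrArg (fun f : Cn (n + 1) →L[ℝ] Cn n => f u) h2).symm

/-- In the Lie derivative formula the three correction terms contain `∂η`, a multiple of `η`, and
vanish. Holomorphy extends the result from `η` to its complex multiples. -/
theorem fderiv_locCubic {p : Cn (n + 1)} (hp : p ∈ φ.target) (u v w : Cn (n + 1)) (z : ℂ) :
    fderiv ℝ (fun q => locCubic (inChart S.metric φ) (connCoeff S.nab φ) q u v w) p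
        (z • locField φ p)
      = z * (2 * S.c * locCubic (inChart S.metric φ) (connCoeff S.nab φ) p u v w) := by
  have H := S.localSpecial A.total
  have h1 := H.fderiv_locCubic_field hp u v w
  obtain ⟨a, ha⟩ := A.fderiv_field hp u
  obtain ⟨b, hb⟩ := A.fderiv_field hp v
  obtain ⟨d, hd⟩ := A.fderiv_field hp w
  rw [ha, hb, hd, locCubic_smul_left, H.locCubic_smul_mid hp, H.locCubic_smul_right hp,
    H.locCubic_field_left hp, H.locCubic_field_mid hp, H.locCubic_field_right hp] at h1
  simp only [mul_zero, add_zero] at h1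
  have h2 : DifferentiableAt ℂ
      (fun q => locCubic (inChart S.metric φ) (connCoeff S.nab φ) q u v w) p :=
    (H.locCubic_differentiable u v w).differentiableAt (H.mem_nhds hp)
  rw [map_complex_smul_of_I (fun t => fderiv_real_I_smul h2 t), h1, smul_eq_mul]

/-- `Q a` is a lift of the coordinate vector `a`, so the components of the descended form can be
computed upstairs without passing to horizontal lifts. -/
theorem inverse_coordVec {x : N} (hx : x ∈ φ.source) (a : Cn n) :
    (chartD e (S.proj x)).inverse a = S.dproj x (chartDinv φ (φ x) (Q a) : Cn (n + 1)) := by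
  obtain ⟨p, hp, rfl⟩ : ∃ p ∈ φ.target, x = φ.symm p :=
    ⟨φ x, φ.map_source hx, (φ.left_inv hx).symm⟩
  refine chartD_injective A.base (A.mem_source _ hx) ?_
  rw [φ.right_inv hp]
  refine Eq.trans ?_ (A.chartD_dproj_symm hp (Q a)).symm
  rw [A.right_inv]
  exact (isInvertible_chartD A.base (A.mem_source _ hx)).self_apply_inverse a

end IsAdapted

namespace IsDescendedCubic

variable {Xi : S.CubicFamily} (h : S.IsDescendedCubic Xi)
include h

theorem cubicComp_eq {e : OpenPartialHomeomorph M (Cn n)}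
    {φ : OpenPartialHomeomorph N (Cn (n + 1))} {P : Cn (n + 1) →L[ℂ] Cn n}
    {Q : Cn n →L[ℂ] Cn (n + 1)} (A : S.IsAdapted e φ P Q) {x : N} (hx : x ∈ φ.source)
    (i j k : Fin n) : S.cubicComp Xi e x i j k
      = locCubic (inChart S.metric φ) (connCoeff S.nab φ) (φ x) (Q (coordVec i))
        (Q (coordVec j)) (Q (coordVec k)) := by
  obtain ⟨p, hp, rfl⟩ : ∃ p ∈ φ.target, x = φ.symm p :=
    ⟨φ x, φ.map_source hx, (φ.left_inv hx).symm⟩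
  have key : ∀ a, (chartD e (S.proj (φ.symm p))).inverse a
      = S.dproj (φ.symm p) (chartDinv φ p (Q a)) := by
    intro a
    have := A.inverse_coordVec hx a
    rwa [φ.right_inv hp] at this
  rw [φ.right_inv hp, ← h.apply_symm A.total hp, ← key, ← key, ← key]
  rfl

theorem cubicComp_contMDiffOn {e : OpenPartialHomeomorph M (Cn n)} (he : e ∈ holoAtlas n M)
    (i j k : Fin n) : ContMDiffOn 𝓘(ℂ, Cn (n + 1)) 𝓘(ℂ, ℂ) ω (fun x => S.cubicComp Xi e x i j k)
      (S.proj ⁻¹' e.source) := by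
  intro x hx
  obtain ⟨φ, P, Q, A, hxφ⟩ := S.exists_isAdapted he hx
  have H := S.localSpecial A.total
  have h1 := ((H.locCubic_analytic (Q (coordVec i)) (Q (coordVec j)) (Q (coordVec k))).contDiffAt
    (H.mem_nhds (φ.map_source hxφ))).contMDiffAt.comp x
    (contMDiffAt_of_mem_maximalAtlas A.total hxφ)
  refine (h1.congr_of_eventuallyEq ?_).contMDiffWithinAt
  filter_upwards [φ.open_source.mem_nhds hxφ] with y hy using h.cubicComp_eq A hy i j k

/-- Along an orbit the component satisfies `F' = 2cF`, although the adapted chart changes from point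
to point; the solution is `exp(2cz) F(0)`. -/
theorem cubicComp_orbit {e : OpenPartialHomeomorph M (Cn n)} (he : e ∈ holoAtlas n M) {x : N}
    (hx : S.proj x ∈ e.source) (z : ℂ) (i j k : Fin n) :
    S.cubicComp Xi e (expUnit z • x) i j k
      = Complex.exp (S.c * z) ^ 2 * S.cubicComp Xi e x i j k := by
  set F : ℂ → ℂ := fun w => S.cubicComp Xi e (expUnit w • x) i j k with hF
  have key : ∀ z : ℂ, DifferentiableAt ℝ F z ∧ ∀ v, fderiv ℝ F z v = v * (2 * S.c * F z) := by
    intro z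
    obtain ⟨φ, P, Q, A, hxφ⟩ := S.exists_isAdapted he (x := expUnit z • x) (by
      rwa [S.proj_units_smul])
    have H := S.localSpecial A.total
    have hp := φ.map_source hxφ
    have h1 := hasFDerivAt_comp_orbit A.total hxφ
      (f := fun y => S.cubicComp Xi e y i j k)
      (φ := fun q => locCubic (inChart S.metric φ) (connCoeff S.nab φ) q (Q (coordVec i))
        (Q (coordVec j)) (Q (coordVec k)))
      (by filter_upwards [φ.open_source.mem_nhds hxφ] with y hy using h.cubicComp_eq A hy i j k)
      (((H.locCubic_smooth _ _ _).contDiffAt (H.mem_nhds hp)).differentiableAt (by simp))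
    refine ⟨h1.1, fun v => ?_⟩
    rw [hF, h1.2, A.fderiv_locCubic hp, ← h.cubicComp_eq A hxφ]
  have h1 : ∀ z : ℂ, HasFDerivAt (fun w : ℂ => F w * Complex.exp (-(2 * S.c * w)))
      (0 : ℂ →L[ℝ] ℂ) z := by
    intro z
    have h2 : HasDerivAt (fun w : ℂ => Complex.exp (-(2 * S.c * w)))
        (Complex.exp (-(2 * S.c * z)) * -(2 * S.c * 1)) z :=
      ((hasDerivAt_id z).const_mul (2 * S.c : ℂ)).neg.cexp
    refine ((key z).1.hasFDerivAt.mul (h2.hasFDerivAt.restrictScalars ℝ)).congr_fderiv ?_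
    ext v
    simp only [add_apply, smul_apply, (key z).2, smul_eq_mul, zero_apply,
      ContinuousLinearMap.coe_restrictScalars', ContinuousLinearMap.toSpanSingleton_apply]
    ring
  have h3 := is_const_of_fderiv_eq_zero (𝕜 := ℝ) (fun z => (h1 z).differentiableAt)
    (fun z => (h1 z).fderiv) z 0
  simp only [mul_zero, neg_zero, Complex.exp_zero, mul_one] at h3
  have h4 : F 0 = S.cubicComp Xi e x i j k := by
    rw [hF]
    simp only [expUnit_zero, one_smul]
  rw [← h4, ← h3, ← Complex.exp_nat_mul, mul_left_comm, ← Complex.exp_add]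
  have : ((2 : ℕ) : ℂ) * (S.c * z) + -(2 * S.c * z) = 0 := by
    push_cast
    ring
  rw [this, Complex.exp_zero, mul_one]

theorem isHolomorphicSection : S.IsHolomorphicSection Xi := by
  have key : ∀ x, ∃ f : RTangent (n + 1) x → RTangent (n + 1) x → RTangent (n + 1) x → ℂ,
      (∀ u v w, Xi x (S.dproj x u) (S.dproj x v) (S.dproj x w) = f u v w) ∧
      (∀ u v w, f (cplxJ (n + 1) x u) v w = Complex.I * f u v w) ∧
      (∀ u v w, f u v w = f v u w) ∧ ∀ u v w, f u v w = f u w v := by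
    intro x
    obtain ⟨e, he, hx⟩ : ∃ e ∈ holoAtlas (n + 1) N, x ∈ e.source :=
      ⟨_, IsManifold.chart_mem_maximalAtlas _, mem_chart_source _ _⟩
    obtain ⟨p, hp, rfl⟩ : ∃ p ∈ e.target, x = e.symm p :=
      ⟨e x, e.map_source hx, (e.left_inv hx).symm⟩
    have H := S.localSpecial he
    refine ⟨fun u v w => locCubic (inChart S.metric e) (connCoeff S.nab e) p
      (chartD e (e.symm p) u) (chartD e (e.symm p) v) (chartD e (e.symm p) w),
      fun u v w => ?_, fun u v w => ?_, fun u v w => H.locCubic_symm_left hp _ _ _,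
      fun u v w => H.locCubic_symm_right hp _ _ _⟩
    · beta_reduce
      rw [← h.apply_symm he hp, chartDinv_chartD he hp, chartDinv_chartD he hp,
        chartDinv_chartD he hp]
    · simp only [chartD_cplxJ he hx, locCubic_smul_left]
  refine ⟨fun x u v w => ?_, fun x u v w => ?_, fun x u v w => ?_, fun e he i j k =>
    h.cubicComp_contMDiffOn he i j k, fun e he x hx z i j k => h.cubicComp_orbit he hx z i j k⟩
  all_goals
    obtain ⟨f, hf, hI, hl, hr⟩ := key x
    obtain ⟨u, rfl⟩ := S.dproj_surjective _ u
    obtain ⟨v, rfl⟩ := S.dproj_surjective _ v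
    obtain ⟨w, rfl⟩ := S.dproj_surjective _ w
  · rw [← S.dproj_cplxJ, hf, hf, hI]
  · rw [hf, hf, hl]
  · rw [hf, hf, hr]

end IsDescendedCubic

end ProjSpecialKahler

end

/-! ### The main theorem -/

theorem mainTheorem4 {n : ℕ} {N M : Type*} [TopologicalSpace N]
    [ChartedSpace (Cn (n + 1)) N] [IsManifold 𝓘(ℂ, Cn (n + 1)) ω N] [TopologicalSpace M]
    [ChartedSpace (Cn n) M] [IsManifold 𝓘(ℂ, Cn n) ω M] [MulAction ℂˣ N]
    [ContMDiffSMul 𝓘(ℂ, ℂ) 𝓘(ℂ, Cn (n + 1)) ω ℂˣ N] (S : ProjSpecialKahler n N M) :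
    S.IsHomogeneousPotential S.potential ∧
    (∃! g : BilinField n M, S.IsProjectedMetric g) ∧
    (∃! Xi : S.CubicFamily, S.IsDescendedCubic Xi) ∧
    ∀ (g : BilinField n M) (Xi : S.CubicFamily), S.IsProjectedMetric g → S.IsDescendedCubic Xi →
      S.IsHolomorphicSection Xi ∧
      ∀ e ∈ holoAtlas n M, ∀ x : N, S.proj x ∈ e.source → ∀ i j k l : Fin n,
        riemannComp (inChart g e) (e (S.proj x)) j i k l
          = 1 / (4 * (S.potential x : ℂ) ^ 2) *
              (∑ j' : Fin n, ∑ p' : Fin n, ∑ p : Fin n,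
                invMetricComp (inChart g e) (e (S.proj x)) j j'
                  * invMetricComp (inChart g e) (e (S.proj x)) p' p
                  * S.cubicComp Xi e x p' k i
                  * (starRingEnd ℂ) (S.cubicComp Xi e x p j' l))
            + (Real.sign (S.potential x) : ℂ) * (if j = i then 1 else 0)
                * metricComp (inChart g e) (e (S.proj x)) k l
            + (Real.sign (S.potential x) : ℂ) * (if j = k then 1 else 0)
                * metricComp (inChart g e) (e (S.proj x)) i l := by
  refine ⟨S.isHomogeneousPotential, S.existsUnique_isProjectedMetric,
    S.existsUnique_isDescendedCubic, fun g Xi hg hXi => ⟨hXi.isHolomorphicSection, ?_⟩⟩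
  intro e he x hx i j k l
  -- In a chart of `N` adapted to `e` all ingredients at `x` take their local form, and the identity
  -- becomes `riemannComp_eq`.
  obtain ⟨φ, P, Q, A, hxφ⟩ := S.exists_isAdapted he hx
  have hp := φ.map_source hxφ
  have hK := S.potential_eq A.total hp
  rw [φ.left_inv hxφ] at hK
  simp only [hXi.cubicComp_eq A hxφ]
  rw [A.proj_eq x hxφ, hK]
  exact (hg.isPullbackField.localProjection A).riemannComp_eq hp j i k l
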